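/- Let $\mathbb K$ be $\mathbb R$ or $\mathbb C$, let $\lambda,\mu\in\mathbb K$, and let $M$ be $\mathbb R$ or $S^1=\mathbb R/\mathbb Z$, with affine coordinate $x$. All functions are $\mathbb K$-valued. For $w\in\mathbb K$ let $\mathcal F_w(M)$ be the space of $w$-densities $\varphi=\phi(x)(dx)^w$, $\phi\in C^\infty(M)$, on which the group $\mathrm{Diff}_+(M)$ of orientation-preserving diffeomorphisms acts by $\rho^w_{f^{-1}}(\phi(x)(dx)^w)=(f'(x))^w\,\phi(f(x))\,(dx)^w$. For an integer $k\ge 0$ let $\mathcal D^k_{\lambda,\mu}(M)$ be the space of linear differential operators $A=\sum_{i=0}^k a_i(x)\frac{d^i}{dx^i}:\mathcal F_\lambda(M)\to\mathcal F_\mu(M)$ of order at most $k$ with smooth coefficients, on which $\mathrm{Diff}_+(M)$ acts by $A\mapsto\rho^\mu_f\circ A\circ\rho^\lambda_{f^{-1}}$. Let $\mathcal I^k_{\lambda,\mu}(M)$ be the algebra of all $\mathbb K$-linear maps $T:\mathcal D^k_{\lambda,\mu}(M)\to\mathcal D^k_{\lambda,\mu}(M)$ that commute with this action. Call $T$ local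 if, for every open $U\subset M$ and every $A$ vanishing on $U$, the operator $T(A)$ vanishes on $U$. Let $\mathfrak t_2$ be the algebra of lower triangular $2\times2$ matrices over $\mathbb K$. (i) If $(\lambda,\mu)\neq(0,1)$, then for every $k\ge0$ the algebra $\mathcal I^k_{\lambda,\mu}(\mathbb R)$ coincides with $\mathcal I^k_{\lambda,\mu}(S^1)$ in the following sense: there is an isomorphism of $\mathbb K$-algebras $e:\mathcal I^k_{\lambda,\mu}(S^1)\to\mathcal I^k_{\lambda,\mu}(\mathbb R)$ such that, whenever $B\in\mathcal D^k_{\lambda,\mu}(\mathbb R)$ is the lift of $A\in\mathcal D^k_{\lambda,\mu}(S^1)$ along the covering $\mathbb R\to S^1$, the operator $e(T)(B)$ is the lift of $T(A)$, for every $T\in\mathcal I^k_{\lambda,\mu}(S^1)$. (ii) If $(\lambda,\mu)=(0,1)$, then for every $k\ge 0$ all elements of $\mathcal I^k_{0,1}(\mathbb R)$ are local, and there are isomorphisms of $\mathbb K$-algebras $$\mathcal I^k_{0,1}(\mathbb R)\cong\mathfrak t_2\oplus\mathbb K^2\ \ (k\ge3),\qquad \mathcal I^2_{0,1}(\mathbb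 R)\cong\mathfrak t_2\oplus\mathbb K,\qquad \mathcal I^1_{0,1}(\mathbb R)\cong\mathfrak t_2 .$$ -/

import Mathlib

open scoped ContDiff

noncomputable section

namespace DensityOperators

/-! Throughout, `P : ℝ` is a period and the one-dimensional manifold is the quotient `ℝ / P ℤ` with
its affine coordinate `x`. For `P = 0` this is the real line, for `P = 1` it is the circle
`S¹ = ℝ / ℤ`; functions on the quotient are the `P`-periodic functions on `ℝ`. -/

/-- The period for which `ℝ / P ℤ` is the real line (every function has period `0`). -/
abbrev line : ℝ := 0

/-- The period for which `ℝ / P ℤ` is the circle `S¹`. -/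
abbrev circle : ℝ := 1

/-- The algebra of smooth `𝕜`-valued functions on `ℝ / P ℤ`. Writing a `w`-density as
`φ(x) (dx)^w`, this is also the underlying vector space of the space of `w`-densities, for each
weight `w`; the weight enters through the action `pullback` of diffeomorphisms. -/
def SmoothFun (𝕜 : Type*) [RCLike 𝕜] (P : ℝ) : Subalgebra 𝕜 (ℝ → 𝕜) where
  carrier := {φ | ContDiff ℝ ∞ φ ∧ Function.Periodic φ P}
  mul_mem' ha hb := ⟨ha.1.mul hb.1, ha.2.mul hb.2⟩
  add_mem' ha hb := ⟨ha.1.add hb.1, ha.2.add hb.2⟩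
  algebraMap_mem' _ := ⟨contDiff_const, fun _ => rfl⟩

/-- The orientation-preserving diffeomorphisms of `ℝ / P ℤ`, given by their lifts to `ℝ`: increasing
bijections, smooth with smooth inverse, that commute with the translation by `P`. -/
structure OrientedDiffeo (P : ℝ) where
  toOrderIso : ℝ ≃o ℝ
  smooth : ContDiff ℝ ∞ toOrderIso
  smooth_symm : ContDiff ℝ ∞ toOrderIso.symm
  map_add_period : ∀ x, toOrderIso (x + P) = toOrderIso x + P

namespace OrientedDiffeo

variable {P : ℝ}

instance : CoeFun (OrientedDiffeo P) (fun _ => ℝ → ℝ) := ⟨fun f => f.toOrderIso⟩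

/-- The inverse diffeomorphism. -/
def symm (f : OrientedDiffeo P) : OrientedDiffeo P where
  toOrderIso := f.toOrderIso.symm
  smooth := f.smooth_symm
  smooth_symm := f.smooth
  map_add_period x := by
    rw [OrderIso.symm_apply_eq, f.map_add_period, OrderIso.apply_symm_apply]

theorem differentiable (f : OrientedDiffeo P) : Differentiable ℝ f :=
  f.smooth.differentiable (by simp)

theorem apply_symm (f : OrientedDiffeo P) (x : ℝ) : f (f.symm x) = x :=
  f.toOrderIso.apply_symm_apply x

theorem symm_apply (f : OrientedDiffeo P) (x : ℝ) : f.symm (f x) = x :=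
  f.toOrderIso.symm_apply_apply x

theorem deriv_pos (f : OrientedDiffeo P) (x : ℝ) : 0 < deriv f x := by
  have h0 : 0 ≤ deriv f x := f.toOrderIso.monotone.deriv_nonneg
  have h1 : HasDerivAt (fun y => f.symm (f y)) (deriv f.symm (f x) * deriv f x) x :=
    (f.symm.differentiable (f x)).hasDerivAt.comp x (f.differentiable x).hasDerivAt
  have h2 : deriv f.symm (f x) * deriv f x = 1 :=
    h1.unique ((hasDerivAt_id x).congr_of_eventuallyEq
      (Filter.Eventually.of_forall fun y => f.symm_apply y))
  rcases h0.lt_or_eq with h | h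
  · exact h
  · rw [← h, mul_zero] at h2
    exact absurd h2 zero_ne_one

theorem deriv_add_period (f : OrientedDiffeo P) (x : ℝ) : deriv f (x + P) = deriv f x := by
  rw [← deriv_comp_add_const, funext f.map_add_period, deriv_add_const]

theorem contDiff_deriv (f : OrientedDiffeo P) : ContDiff ℝ ∞ (deriv f) :=
  (contDiff_infty_iff_deriv.1 f.smooth).2

end OrientedDiffeo

variable {𝕜 : Type*} [RCLike 𝕜] {P : ℝ}

/-- The power `(f')^w` of the derivative of a diffeomorphism, for a real or complex exponent `w`:
`t^w = exp (w log t)` for `t > 0`. -/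
def jacobianPow (w : 𝕜) (f : OrientedDiffeo P) : SmoothFun 𝕜 P :=
  ⟨fun x => NormedSpace.exp (w * (Real.log (deriv f x) : 𝕜)), by
    constructor
    · have h : ContDiff ℝ ∞ fun x => w * (Real.log (deriv f x) : 𝕜) :=
        contDiff_const.mul
          ((RCLike.ofRealCLM (K := 𝕜)).contDiff.comp
            (f.contDiff_deriv.log fun x => (f.deriv_pos x).ne'))
      have he : ContDiff ℝ ∞ (NormedSpace.exp : 𝕜 → 𝕜) :=
        contDiff_iff_contDiffAt.2 fun x => (NormedSpace.exp_analytic (𝕂 := ℝ) x).contDiffAt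
      exact he.comp h
    · intro x
      simp only [f.deriv_add_period]⟩

/-- The operator `d/dx` on functions. -/
def D : Module.End 𝕜 (SmoothFun 𝕜 P) where
  toFun φ := ⟨deriv φ, by
    refine ⟨(contDiff_infty_iff_deriv.1 φ.2.1).2, fun x => ?_⟩
    rw [← deriv_comp_add_const, funext φ.2.2]⟩
  map_add' φ ψ := Subtype.ext <| funext fun x =>
    deriv_add (φ.2.1.differentiable (by simp) x) (ψ.2.1.differentiable (by simp) x)
  map_smul' c φ := Subtype.ext <| funext fun x =>
    deriv_const_smul c (φ.2.1.differentiable (by simp) x)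

/-- The substitution `φ ↦ φ ∘ f` in functions. -/
def comp (φ : SmoothFun 𝕜 P) (f : OrientedDiffeo P) : SmoothFun 𝕜 P :=
  ⟨fun x => φ.1 (f x), φ.2.1.comp f.smooth, fun x => by
    change φ.1 (f (x + P)) = φ.1 (f x)
    rw [f.map_add_period, φ.2.2]⟩

/-- The action of diffeomorphisms on `w`-densities (the action of `f⁻¹`, that is, the pull-back
by `f`): `φ(x) (dx)^w ↦ (f'(x))^w φ(f(x)) (dx)^w`. -/
def pullback (w : 𝕜) (f : OrientedDiffeo P) : Module.End 𝕜 (SmoothFun 𝕜 P) where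
  toFun φ := jacobianPow w f * comp φ f
  map_add' _ _ := mul_add _ (comp _ f) (comp _ f)
  map_smul' _ _ := Subtype.ext <| funext fun _ => mul_left_comm _ _ _

/-- Multiplication by a function. -/
abbrev mulOp (a : SmoothFun 𝕜 P) : Module.End 𝕜 (SmoothFun 𝕜 P) := LinearMap.mulLeft 𝕜 a

variable (𝕜 P) in
/-- The space of linear differential operators of order at most `k`: the operators
`a_k d^k/dx^k + ⋯ + a_1 d/dx + a_0` with smooth coefficients. Between densities of weights `lam` and
`mu`, it is this same space for all weights; they enter through the action `opAction`. -/
def DiffOp (k : ℕ) : Submodule 𝕜 (Module.End 𝕜 (SmoothFun 𝕜 P)) where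
  carrier := {A | ∃ a : ℕ → SmoothFun 𝕜 P, A = ∑ i ∈ Finset.range (k + 1), mulOp (a i) * D ^ i}
  add_mem' := by
    rintro _ _ ⟨a, rfl⟩ ⟨b, rfl⟩
    refine ⟨a + b, ?_⟩
    rw [← Finset.sum_add_distrib]
    refine Finset.sum_congr rfl fun i _ => ?_
    ext1 φ
    simp [add_mul]
  zero_mem' := ⟨0, by simp⟩
  smul_mem' := by
    rintro c _ ⟨a, rfl⟩
    refine ⟨c • a, ?_⟩
    rw [Finset.smul_sum]
    refine Finset.sum_congr rfl fun i _ => ?_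
    ext1 φ
    simp

theorem mulOp_mul_D_pow_mem {k i : ℕ} (hi : i ≤ k) (a : SmoothFun 𝕜 P) :
    mulOp a * D ^ i ∈ DiffOp 𝕜 P k := by
  refine ⟨fun j => if j = i then a else 0, ?_⟩
  rw [Finset.sum_eq_single i]
  · simp
  · intro j _ hj
    simp [hj]
  · intro h
    exact absurd (Finset.mem_range.2 (Nat.lt_succ_of_le hi)) h

theorem D_mul (a b : SmoothFun 𝕜 P) : D (a * b) = D a * b + a * D b :=
  Subtype.ext <| funext fun x =>
    deriv_mul (a.2.1.differentiable (by simp) x) (b.2.1.differentiable (by simp) x)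

/-- The derivative `f'` as a function with values in `𝕜`. -/
def derivFun (f : OrientedDiffeo P) : SmoothFun 𝕜 P :=
  ⟨fun x => ((deriv f x : ℝ) : 𝕜), (RCLike.ofRealCLM (K := 𝕜)).contDiff.comp f.contDiff_deriv,
    fun x => by simp only [f.deriv_add_period]⟩

theorem D_comp (φ : SmoothFun 𝕜 P) (f : OrientedDiffeo P) :
    D (comp φ f) = derivFun f * comp (D φ) f := by
  refine Subtype.ext <| funext fun x => ?_
  have h : HasDerivAt (fun y => φ.1 (f y)) (deriv f x • deriv φ.1 (f x)) x :=
    ((φ.2.1.differentiable (by simp) (f x)).hasDerivAt).scomp x (f.differentiable x).hasDerivAt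
  refine h.deriv.trans ?_
  rw [RCLike.real_smul_eq_coe_mul]
  rfl

theorem jacobianPow_neg_mul (w : 𝕜) (f : OrientedDiffeo P) :
    jacobianPow (-w) f * jacobianPow w f = 1 := by
  refine Subtype.ext <| funext fun x => ?_
  change NormedSpace.exp (-w * (Real.log (deriv f x) : 𝕜)) *
    NormedSpace.exp (w * (Real.log (deriv f x) : 𝕜)) = 1
  rw [← NormedSpace.exp_add, neg_mul, neg_add_cancel, NormedSpace.exp_zero]

theorem D_mul_pullback (w : 𝕜) (f : OrientedDiffeo P) :
    D * pullback w f = mulOp (derivFun f) * pullback w f * D +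
      mulOp (D (jacobianPow w f) * jacobianPow (-w) f) * pullback w f := by
  ext1 φ
  change D (jacobianPow w f * comp φ f) = derivFun f * (jacobianPow w f * comp (D φ) f) +
    (D (jacobianPow w f) * jacobianPow (-w) f) * (jacobianPow w f * comp φ f)
  rw [D_mul, D_comp]
  linear_combination (-D (jacobianPow w f) * comp φ f) * jacobianPow_neg_mul w f

theorem mulOp_mul (a b : SmoothFun 𝕜 P) : mulOp (a * b) = mulOp a * mulOp b :=
  LinearMap.ext fun _ => mul_assoc _ _ _

theorem D_mul_mulOp (a : SmoothFun 𝕜 P) : D * mulOp a = mulOp (D a) + mulOp a * D :=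
  LinearMap.ext fun _ => D_mul _ _

theorem D_pow_mul_pullback (w : 𝕜) (f : OrientedDiffeo P) (i : ℕ) :
    D ^ i * pullback w f ∈ Submodule.span 𝕜
      {E | ∃ j ≤ i, ∃ c : SmoothFun 𝕜 P, E = mulOp c * pullback w f * D ^ j} := by
  induction i with
  | zero =>
    refine Submodule.subset_span ⟨0, le_rfl, 1, LinearMap.ext fun φ => ?_⟩
    exact (one_mul _).symm
  | succ i ih =>
    rw [pow_succ', mul_assoc]
    refine Submodule.span_induction (p := fun E _ => D * E ∈ _) ?_ ?_ ?_ ?_ ih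
    · rintro _ ⟨j, hj, c, rfl⟩
      have key : D * (mulOp c * pullback w f * D ^ j) =
          mulOp (D c) * pullback w f * D ^ j +
            (mulOp (c * derivFun f) * pullback w f * D ^ (j + 1) +
              mulOp (c * (D (jacobianPow w f) * jacobianPow (-w) f)) * pullback w f * D ^ j) := by
        rw [← mul_assoc, ← mul_assoc, D_mul_mulOp, add_mul, mul_assoc (mulOp c), D_mul_pullback,
          mulOp_mul c, mulOp_mul c, pow_succ' D j]
        simp only [mul_add, add_mul, mul_assoc]
      rw [key]
      exact add_mem (Submodule.subset_span ⟨j, hj.trans i.le_succ, _, rfl⟩)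
        (add_mem (Submodule.subset_span ⟨j + 1, Nat.succ_le_succ hj, _, rfl⟩)
          (Submodule.subset_span ⟨j, hj.trans i.le_succ, _, rfl⟩))
    · rw [mul_zero]
      exact zero_mem _
    · intro E F _ _ hE hF
      rw [mul_add]
      exact add_mem hE hF
    · intro c E _ hE
      rw [mul_smul_comm]
      exact Submodule.smul_mem _ c hE

theorem pullback_mul_mulOp_mul_pullback (lam mu : 𝕜) (f g : OrientedDiffeo P)
    (hfg : ∀ x, g (f x) = x) (a : SmoothFun 𝕜 P) :
    pullback mu f * (mulOp a * pullback lam g) =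
      mulOp (jacobianPow mu f * comp (a * jacobianPow lam g) f) := by
  ext1 φ
  refine Subtype.ext <| funext fun x => ?_
  change (jacobianPow mu f).1 x * (a.1 (f x) * ((jacobianPow lam g).1 (f x) * φ.1 (g (f x)))) =
    ((jacobianPow mu f).1 x * (a.1 (f x) * (jacobianPow lam g).1 (f x))) * φ.1 x
  rw [hfg]
  ring

/-- Differential operators of order at most `k` are preserved by changes of coordinates. -/
theorem pullback_mul_mul_pullback_mem (lam mu : 𝕜) (f : OrientedDiffeo P) {k : ℕ}
    {A : Module.End 𝕜 (SmoothFun 𝕜 P)} (hA : A ∈ DiffOp 𝕜 P k) :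
    pullback mu f * A * pullback lam f.symm ∈ DiffOp 𝕜 P k := by
  obtain ⟨a, rfl⟩ := hA
  rw [Finset.mul_sum, Finset.sum_mul]
  refine Submodule.sum_mem _ fun i hi => ?_
  rw [mul_assoc, mul_assoc]
  refine Submodule.span_induction
    (p := fun E _ => pullback mu f * (mulOp (a i) * E) ∈ DiffOp 𝕜 P k) ?_ ?_ ?_ ?_
    (D_pow_mul_pullback lam f.symm i)
  · rintro _ ⟨j, hj, c, rfl⟩
    have h : pullback mu f * (mulOp (a i) * (mulOp c * pullback lam f.symm * D ^ j)) =
        pullback mu f * (mulOp (a i * c) * pullback lam f.symm) * D ^ j := by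
      rw [mulOp_mul]
      simp only [mul_assoc]
    rw [h, pullback_mul_mulOp_mul_pullback _ _ _ _ f.symm_apply]
    exact mulOp_mul_D_pow_mem (hj.trans (Nat.lt_succ_iff.1 (Finset.mem_range.1 hi))) _
  · simp only [mul_zero]
    exact zero_mem _
  · intro E F _ _ hE hF
    simp only [mul_add]
    exact add_mem hE hF
  · intro c E _ hE
    simp only [mul_smul_comm]
    exact Submodule.smul_mem _ c hE

/-- The action of diffeomorphisms on differential operators of order at most `k` from
`lam`-densities to `mu`-densities: `f⁻¹` sends `A` to `ρ^mu_{f⁻¹} ∘ A ∘ ρ^lam_f`. -/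
def opAction (k : ℕ) (lam mu : 𝕜) (f : OrientedDiffeo P) : Module.End 𝕜 (DiffOp 𝕜 P k) where
  toFun A := ⟨pullback mu f * A.1 * pullback lam f.symm,
    pullback_mul_mul_pullback_mem lam mu f A.2⟩
  map_add' A B := Subtype.ext (by simp [mul_add, add_mul])
  map_smul' c A := Subtype.ext (by simp)

variable (P) in
/-- The algebra of symmetries: the linear maps from the space of differential operators of order at
most `k` from `lam`-densities to `mu`-densities to itself that commute with the action of all
orientation-preserving diffeomorphisms. -/
def Symmetries (k : ℕ) (lam mu : 𝕜) : Subalgebra 𝕜 (Module.End 𝕜 (DiffOp 𝕜 P k)) :=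
  Subalgebra.centralizer 𝕜 (Set.range (opAction (P := P) k lam mu))

/-- A differential operator vanishes on a set. -/
def VanishesOn {k : ℕ} (A : DiffOp 𝕜 P k) (U : Set ℝ) : Prop :=
  ∀ φ : SmoothFun 𝕜 P, ∀ x ∈ U, (A.1 φ).1 x = 0

/-- A linear map on differential operators is local if, whenever `A` vanishes on an open set, so
does its image. -/
def IsLocal {k : ℕ} (T : Module.End 𝕜 (DiffOp 𝕜 P k)) : Prop :=
  ∀ (A : DiffOp 𝕜 P k) (U : Set ℝ), IsOpen U → VanishesOn A U → VanishesOn (T A) U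

/-- The pull-back of a function along the covering `ℝ → S¹`. -/
def unroll (φ : SmoothFun 𝕜 circle) : SmoothFun 𝕜 line :=
  ⟨φ.1, φ.2.1, fun x => by simp⟩

/-- The differential operator `B` on the line is the lift, along the covering `ℝ → S¹`, of the
differential operator `A` on the circle. -/
def IsLift {k : ℕ} (A : DiffOp 𝕜 circle k) (B : DiffOp 𝕜 line k) : Prop :=
  ∀ φ : SmoothFun 𝕜 circle, B.1 (unroll φ) = unroll (A.1 φ)

variable (𝕜) in
/-- The algebra of lower triangular `n × n` matrices. -/
def lowerTriangular (n : ℕ) : Subalgebra 𝕜 (Matrix (Fin n) (Fin n) 𝕜) where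
  carrier := {M | ∀ i j, i < j → M i j = 0}
  mul_mem' := by
    intro M N hM hN i j hij
    rw [Matrix.mul_apply]
    refine Finset.sum_eq_zero fun l _ => ?_
    rcases lt_or_ge i l with h | h
    · rw [hM i l h, zero_mul]
    · rw [hN l j (h.trans_lt hij), mul_zero]
  add_mem' := by
    intro M N hM hN i j hij
    rw [Matrix.add_apply, hM i j hij, hN i j hij, add_zero]
  algebraMap_mem' c i j hij := by
    rw [Matrix.algebraMap_matrix_apply, if_neg hij.ne]

end DensityOperators

end

open scoped ContDiff

noncomputable section

namespace DensityOperators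

open Filter Topology

variable {𝕜 : Type*} [RCLike 𝕜] {P Q R : ℝ}

/-! ### Cut-offs, periodic bumps and periodic representatives of germs -/

section Periodization

/-! The whole argument rests on locality. On the line every symmetry `T` is local, whatever the
weights. If `A` is supported in a half-line, then `A = S - τ^*S` for a unit translation `τ` and an
operator `S` with support in the same half-line (a telescoping sum). For `x₀` outside this half-line
there is a diffeomorphism that is the identity on the support of `S` and coincides with `τ` near
`x₀`. It fixes `S`, hence `T S`, so the values of `T S` at `x₀` and `τ(x₀)` agree and `T A` vanishes
at `x₀`. An operator vanishing near `x₀` is a sum of two such operators.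

On the circle, locality fails only for the weights `(0, 1)`. If `A` vanishes near `x₀`, then `T A`
is invariant under all small diffeomorphisms supported near `x₀`. For `λ ≠ μ`, invariance under the
jets of the vector fields `(x - x₀)^m d/dx` with `m = 1, 2, 3` gives linear equations on the
weights, and these leave only `(0, 1)` (`weight_eq_add_of_invariant`, `weight_of_invariant`). For `λ
= μ` symbols of order `n` are densities of weight `-n`, and each such density vanishing near `p` is
a sum of differences `f^*a - a` with `f` the identity near `p` (`mem_coboundaries`). Operators `f^*B
- B` are sent by `T` to operators vanishing at `p`, so an induction on the order applies.

Part (i) follows by gluing germs. A symmetry on the line commutes with the unit translation, so it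
restricts to periodic operators. The restriction is injective because germs of operators on the line
are germs of periodic ones, and surjective when circle symmetries are local, because germs of
diffeomorphisms of the line are also germs of diffeomorphisms of the circle.

For part (ii) a symmetry is measured by a few scalars. Translations and dilations force `T(dⁿ/dxⁿ)`
to be a multiple of `dⁿ/dxⁿ`, and `T(x d/dx) = κ x d/dx + τ`. By induction on the order the
multiples for `n ≤ 3` together with `τ` determine `T` (`eq_zero_of_forall_eigenvalue`): modulo lower
orders, `u dⁿ/dxⁿ` with `u > 0` and `n ≠ 1` is the transform of `dⁿ/dxⁿ` by a diffeomorphism with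
`(f')^(1-n) = u`. For `n ≥ 4` no new freedom appears, because the coefficient of order `n - 2` of
that transform is not linear in `u`. Conversely, five symmetries realize all values
(`exists_symmetry`): the identity, the formal adjoint `A ↦ A'`, `A ↦ A(1)`, and, writing `A'(1) = a₀
- b'`, the maps `A ↦ b d/dx` and `A ↦ b'`. The multiples for `n = 1` and `n = 0` and the scalar `τ`
multiply like the entries of a lower triangular matrix, the multiples for `n = 2, 3` like
independent characters. -/

/-- A smooth cut-off function for the interval `[c + η, c + 1 - η]`, supported in the interval
`[c + η / 2, c + 1 - η / 2]`. -/
def cutoff (c η x : ℝ) : ℝ :=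
  Real.smoothTransition (2 / η * (x - c) - 1) * Real.smoothTransition (2 / η * (c + 1 - x) - 1)

theorem contDiff_cutoff (c η : ℝ) : ContDiff ℝ ∞ (cutoff c η) := by
  unfold cutoff
  exact (Real.smoothTransition.contDiff.comp (by fun_prop)).mul
    (Real.smoothTransition.contDiff.comp (by fun_prop))

theorem cutoff_eq_one {c η x : ℝ} (hη : 0 < η) (hx : x ∈ Set.Icc (c + η) (c + 1 - η)) :
    cutoff c η x = 1 := by
  have h (t : ℝ) (ht : η ≤ t) : Real.smoothTransition (2 / η * t - 1) = 1 := by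
    apply Real.smoothTransition.one_of_one_le
    have : 2 / η * η ≤ 2 / η * t := by gcongr
    rw [div_mul_cancel₀ _ hη.ne'] at this
    linarith
  rw [cutoff, h _ (by linarith [hx.1]), h _ (by linarith [hx.2]), one_mul]

theorem cutoff_eq_zero_left {c η x : ℝ} (hη : 0 < η) (hx : x ≤ c + η / 2) :
    cutoff c η x = 0 := by
  rw [cutoff, Real.smoothTransition.zero_of_nonpos, zero_mul]
  have : 2 / η * (x - c) ≤ 2 / η * (η / 2) := by gcongr; linarith
  have h2 : 2 / η * (η / 2) = 1 := by field_simp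
  linarith

theorem cutoff_eq_zero_right {c η x : ℝ} (hη : 0 < η) (hx : c + 1 - η / 2 ≤ x) :
    cutoff c η x = 0 := by
  rw [cutoff, mul_comm, Real.smoothTransition.zero_of_nonpos, zero_mul]
  have : 2 / η * (c + 1 - x) ≤ 2 / η * (η / 2) := by gcongr; linarith
  have h2 : 2 / η * (η / 2) = 1 := by field_simp
  linarith

variable {E : Type*} [NormedAddCommGroup E] [NormedSpace ℝ E]

/-- A smooth function can be changed near the end points of an interval of length one, so that it
extends to a periodic smooth function. -/
theorem exists_periodic_eqOn_Icc {g : ℝ → E} (hg : ContDiff ℝ ∞ g) (c : ℝ) {η : ℝ} (hη : 0 < η)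
    (hη' : η < 1 / 2) :
    ∃ G : ℝ → E, ContDiff ℝ ∞ G ∧ Function.Periodic G 1 ∧
      Set.EqOn G g (Set.Icc (c + η) (c + 1 - η)) ∧
      Set.EqOn G 0 (Set.Icc (c - η / 2) (c + η / 2)) ∧
      ∀ x ∈ Set.Ico c (c + 1), g x = 0 → G x = 0 := by
  set h : ℝ → E := fun x => cutoff c η x • g x with hh
  have hsm : ContDiff ℝ ∞ h := (contDiff_cutoff c η).smul hg
  -- Repeating `h` over the periods `[c + m, c + m + 1)` is smooth at the junctions because `h`
  -- vanishes within `η / 2` of both ends.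
  set G : ℝ → E := fun x => h (c + Int.fract (x - c)) with hG
  have hper : Function.Periodic G 1 := fun x => by
    simp only [hG]
    rw [show x + 1 - c = (x - c) + 1 by ring, Int.fract_add_one]
  have hon (m : ℤ) (x : ℝ) (hx : x ∈ Set.Ico (c + m) (c + m + 1)) : G x = h (x - m) := by
    have : ⌊x - c⌋ = m := Int.floor_eq_iff.2 ⟨by linarith [hx.1], by linarith [hx.2]⟩
    simp only [hG, Int.fract, this]
    congr 1
    ring
  have hz (m : ℤ) (x : ℝ) (hx : x ∈ Set.Icc (c + m - η / 2) (c + m + η / 2)) : G x = 0 := by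
    rcases lt_or_ge x (c + m) with hlt | hge
    · rw [hon (m - 1) x ⟨by push_cast; linarith [hx.1], by push_cast; linarith⟩]
      simp only [hh]
      rw [cutoff_eq_zero_right hη, zero_smul]
      push_cast
      linarith [hx.1]
    · rw [hon m x ⟨hge, by linarith [hx.2]⟩]
      simp only [hh]
      rw [cutoff_eq_zero_left hη, zero_smul]
      linarith [hx.2]
  refine ⟨G, ?_, hper, ?_, ?_, ?_⟩
  · refine contDiff_iff_contDiffAt.2 fun x => ?_
    set m := ⌊x - c⌋ with hm
    have h1 : c + m ≤ x := by linarith [Int.floor_le (x - c)]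
    have h2 : x < c + m + 1 := by linarith [Int.lt_floor_add_one (x - c)]
    rcases h1.eq_or_lt with h1 | h1
    · have : G =ᶠ[𝓝 x] fun _ => 0 := by
        filter_upwards [Icc_mem_nhds (show c + m - η / 2 < x by linarith)
          (show x < c + m + η / 2 by linarith)] with y hy using hz m y hy
      exact contDiffAt_const.congr_of_eventuallyEq this
    · have : G =ᶠ[𝓝 x] fun y => h (y - m) := by
        filter_upwards [Ioo_mem_nhds h1 h2] with y hy using hon m y ⟨hy.1.le, hy.2⟩
      exact ((hsm.comp (contDiff_id.sub contDiff_const)).contDiffAt).congr_of_eventuallyEq this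
  · intro x hx
    rw [hon 0 x ⟨by simp; linarith [hx.1], by simp; linarith [hx.2]⟩]
    simp only [hh, Int.cast_zero, sub_zero]
    rw [cutoff_eq_one hη hx, one_smul]
  · intro x hx
    exact hz 0 x (by simpa using hx)
  · intro x hx h0
    rw [hon 0 x (by simpa using hx)]
    simp [hh, h0]

/-- There are periodic bump functions with arbitrarily small supports. -/
theorem exists_periodic_bump (x₀ : ℝ) {η : ℝ} (hη : 0 < η) :
    ∃ χ : ℝ → ℝ, ContDiff ℝ ∞ χ ∧ Function.Periodic χ 1 ∧ (∀ x, 0 ≤ χ x) ∧ (∀ x, χ x ≤ 1) ∧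
      (∀ᶠ x in 𝓝 x₀, χ x = 1) ∧ ∀ x, χ x ≠ 0 → ∃ n : ℤ, |x - x₀ - n| < η := by
  let b : ContDiffBump x₀ := ⟨η / 2, η, by linarith, by linarith⟩
  obtain ⟨G, hG, hper, heq, -, h0⟩ := exists_periodic_eqOn_Icc (g := b)
    b.contDiff (x₀ - 1 / 2)
    (show (0 : ℝ) < 1 / 4 by norm_num) (by norm_num)
  -- Nothing is known of the size of `G` near the ends of the period; composing with the transition
  -- function forces values in `[0, 1]` and keeps the values `0` and `1`.
  refine ⟨fun x => Real.smoothTransition (G x), Real.smoothTransition.contDiff.comp hG,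
    fun x => by simp only [hper x], fun x => Real.smoothTransition.nonneg _,
    fun x => Real.smoothTransition.le_one _, ?_, fun x hx => ?_⟩
  · filter_upwards [b.eventuallyEq_one, Icc_mem_nhds
      (show x₀ - 1 / 2 + 1 / 4 < x₀ by linarith)
      (show x₀ < x₀ - 1 / 2 + 1 - 1 / 4 by linarith)] with y hy hy'
    simp only [heq hy']
    rw [hy]
    exact Real.smoothTransition.one
  · refine ⟨⌊x - (x₀ - 1 / 2)⌋, ?_⟩
    by_contra hcon
    apply hx
    have h1 := hper.sub_int_mul_eq (x := x) ⌊x - (x₀ - 1 / 2)⌋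
    rw [mul_one] at h1
    simp only []
    rw [← h1, h0, Real.smoothTransition.zero]
    · constructor
      · linarith [Int.floor_le (x - (x₀ - 1 / 2))]
      · linarith [Int.lt_floor_add_one (x - (x₀ - 1 / 2))]
    · rw [b.zero_of_le_dist]
      rw [Real.dist_eq]
      rw [show x - ⌊x - (x₀ - 1 / 2)⌋ - x₀ = x - x₀ - ⌊x - (x₀ - 1 / 2)⌋ by ring]
      exact not_lt.1 hcon

/-- Every germ of smooth functions is represented by a function on the quotient of the line. -/
theorem exists_smoothFun_eventuallyEq (P : ℝ) {φ : ℝ → 𝕜} (hφ : ContDiff ℝ ∞ φ) (x : ℝ) :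
    ∃ ψ : SmoothFun 𝕜 P, ψ.1 =ᶠ[𝓝 x] φ := by
  rcases eq_or_ne P 0 with rfl | hP
  · exact ⟨⟨φ, hφ, fun y => by simp⟩, EventuallyEq.rfl⟩
  -- Rescale to period one; the interval is centred at `x / P`.
  · obtain ⟨G, hG, hper, heq, -, -⟩ := exists_periodic_eqOn_Icc
      (hφ.comp (contDiff_const.mul contDiff_id : ContDiff ℝ ∞ fun y => P * y)) (x / P - 1 / 2)
      (show (0 : ℝ) < 1 / 4 by norm_num) (by norm_num)
    refine ⟨⟨fun y => G (y / P), hG.comp (contDiff_id.div_const P), fun y => ?_⟩, ?_⟩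
    · change G ((y + P) / P) = _
      rw [add_div, div_self hP, hper]
    · have hc : ContinuousAt (fun y : ℝ => y / P) x := by fun_prop
      filter_upwards [hc.preimage_mem_nhds (Icc_mem_nhds
        (show x / P - 1 / 2 + 1 / 4 < x / P by linarith)
        (show x / P < x / P - 1 / 2 + 1 - 1 / 4 by linarith))] with y hy
      rw [heq hy]
      simp only [Function.comp]
      rw [mul_div_cancel₀ _ hP]

end Periodization

/-! ### Coefficients and germs of differential operators -/

section Coefficients

theorem D_pow_apply (i : ℕ) (φ : SmoothFun 𝕜 P) : ((D ^ i) φ).1 = iteratedDeriv i φ.1 := by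
  induction i generalizing φ with
  | zero => simp
  | succ i ih =>
    rw [pow_succ, iteratedDeriv_succ']
    exact ih (D φ)

/-- The powers of the coordinate centered at `x`. -/
def monomialAt (x : ℝ) (j : ℕ) (y : ℝ) : 𝕜 := ((y - x : ℝ) : 𝕜) ^ j

theorem contDiff_ofReal_comp {f : ℝ → ℝ} (hf : ContDiff ℝ ∞ f) :
    ContDiff ℝ ∞ fun y => (f y : 𝕜) :=
  (RCLike.ofRealCLM (K := 𝕜)).contDiff.comp hf

theorem contDiff_monomialAt (x : ℝ) (j : ℕ) : ContDiff ℝ ∞ (monomialAt (𝕜 := 𝕜) x j) :=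
  (contDiff_ofReal_comp (contDiff_id.sub contDiff_const)).pow j

theorem hasDerivAt_ofReal_sub (x y : ℝ) :
    HasDerivAt (fun y : ℝ => ((y - x : ℝ) : 𝕜)) 1 y := by
  have := (RCLike.ofRealCLM (K := 𝕜)).hasFDerivAt.comp_hasDerivAt y ((hasDerivAt_id y).sub_const x)
  simpa [Function.comp_def] using this

theorem deriv_monomialAt (x : ℝ) (j : ℕ) :
    deriv (monomialAt (𝕜 := 𝕜) x j) = fun y => (j : 𝕜) * monomialAt x (j - 1) y := by
  funext y
  have := ((hasDerivAt_ofReal_sub (𝕜 := 𝕜) x y).pow j).deriv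
  rw [mul_one] at this
  exact this

theorem iteratedDeriv_monomialAt (x : ℝ) (i j : ℕ) :
    iteratedDeriv i (monomialAt (𝕜 := 𝕜) x j) =
      fun y => (j.descFactorial i : 𝕜) * monomialAt x (j - i) y := by
  induction i with
  | zero => funext y; simp
  | succ i ih =>
    rw [iteratedDeriv_succ, ih]
    funext y
    rw [deriv_const_mul_field', deriv_monomialAt, Nat.descFactorial_succ]
    simp only [Nat.sub_sub]
    push_cast
    ring

theorem iteratedDeriv_monomialAt_self (x : ℝ) (i j : ℕ) :
    iteratedDeriv i (monomialAt (𝕜 := 𝕜) x j) x = if i = j then (j.factorial : 𝕜) else 0 := by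
  rw [iteratedDeriv_monomialAt]
  rcases lt_trichotomy i j with h | h | h
  · simp [monomialAt, h.ne, (Nat.sub_pos_of_lt h).ne']
  · subst h
    simp [monomialAt, Nat.descFactorial_self]
  · simp [h.ne', Nat.descFactorial_eq_zero_iff_lt.2 h]

theorem sum_mulOp_mul_D_pow_apply (n : ℕ) (a : ℕ → SmoothFun 𝕜 P) (φ : SmoothFun 𝕜 P) (x : ℝ) :
    ((∑ i ∈ Finset.range n, mulOp (a i) * D ^ i : Module.End 𝕜 (SmoothFun 𝕜 P)) φ).1 x =
      ∑ i ∈ Finset.range n, (a i).1 x * iteratedDeriv i φ.1 x := by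
  rw [LinearMap.sum_apply, AddSubmonoidClass.coe_finsetSum, Finset.sum_apply]
  refine Finset.sum_congr rfl fun i _ => ?_
  rw [← D_pow_apply]
  rfl

/-- Applied to a function equal to `(y - x)^j` near `x`, the operator returns `j! a_j(x)` at `x`;
the periodic representatives of germs make this test function available on every quotient. -/
theorem coefficients_unique {n : ℕ} {a b : ℕ → SmoothFun 𝕜 P}
    (h : ∑ i ∈ Finset.range n, mulOp (a i) * D ^ i = ∑ i ∈ Finset.range n, mulOp (b i) * D ^ i)
    {j : ℕ} (hj : j < n) : a j = b j := by
  refine Subtype.ext <| funext fun x => ?_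
  obtain ⟨φ, hφ⟩ := exists_smoothFun_eventuallyEq P (contDiff_monomialAt (𝕜 := 𝕜) x j) x
  have key (c : ℕ → SmoothFun 𝕜 P) :
      ((∑ i ∈ Finset.range n, mulOp (c i) * D ^ i : Module.End 𝕜 (SmoothFun 𝕜 P)) φ).1 x = (c j).1 x * j.factorial := by
    rw [sum_mulOp_mul_D_pow_apply, Finset.sum_eq_single j]
    · rw [hφ.iteratedDeriv_eq, iteratedDeriv_monomialAt_self, if_pos rfl]
    · intro i _ hi
      rw [hφ.iteratedDeriv_eq, iteratedDeriv_monomialAt_self, if_neg hi, mul_zero]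
    · intro hn
      exact absurd (Finset.mem_range.2 hj) hn
  have := key a
  rw [h, key b] at this
  exact (mul_right_cancel₀ (Nat.cast_ne_zero.2 j.factorial_ne_zero) this).symm

/-- The differential operator with the given coefficients. -/
def ofCoef (k : ℕ) (a : ℕ → SmoothFun 𝕜 P) : DiffOp 𝕜 P k :=
  ⟨∑ i ∈ Finset.range (k + 1), mulOp (a i) * D ^ i, a, rfl⟩

/-- The coefficients of a differential operator. -/
def coef {k : ℕ} : DiffOp 𝕜 P k →ₗ[𝕜] (ℕ → SmoothFun 𝕜 P) where
  -- The chosen family is determined only up to order `k`; the value `0` beyond makes all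
  -- coefficients independent of the choice.
  toFun A i := if i ≤ k then A.2.choose i else 0
  map_add' A B := by
    funext i
    simp only [Pi.add_apply]
    split_ifs with hi
    · have : (A + B).2.choose i = (A.2.choose + B.2.choose) i := by
        refine coefficients_unique (n := k + 1) ?_ (Nat.lt_succ_of_le hi)
        rw [← (A + B).2.choose_spec]
        conv_lhs => rw [Submodule.coe_add, A.2.choose_spec, B.2.choose_spec]
        rw [← Finset.sum_add_distrib]
        refine Finset.sum_congr rfl fun i _ => ?_
        ext1 φ
        simp [add_mul]
      exact this
    · simp
  map_smul' c A := by
    funext i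
    simp only [Pi.smul_apply, RingHom.id_apply]
    split_ifs with hi
    · have : (c • A).2.choose i = (c • A.2.choose) i := by
        refine coefficients_unique (n := k + 1) ?_ (Nat.lt_succ_of_le hi)
        rw [← (c • A).2.choose_spec]
        conv_lhs => rw [Submodule.coe_smul, A.2.choose_spec]
        rw [Finset.smul_sum]
        refine Finset.sum_congr rfl fun i _ => ?_
        ext1 φ
        simp
      exact this
    · simp

variable {k l : ℕ}

theorem coef_of_lt (A : DiffOp 𝕜 P k) {i : ℕ} (hi : k < i) : coef A i = 0 :=
  if_neg hi.not_ge

theorem eq_sum_coef (A : DiffOp 𝕜 P k) :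
    A.1 = ∑ i ∈ Finset.range (k + 1), mulOp (coef A i) * D ^ i := by
  conv_lhs => rw [A.2.choose_spec]
  refine Finset.sum_congr rfl fun i hi => ?_
  rw [show coef A i = A.2.choose i from if_pos (Nat.lt_succ_iff.1 (Finset.mem_range.1 hi))]

theorem coef_eq_of_eq_sum {A : DiffOp 𝕜 P k} {a : ℕ → SmoothFun 𝕜 P}
    (h : A.1 = ∑ i ∈ Finset.range (k + 1), mulOp (a i) * D ^ i) {i : ℕ} (hi : i ≤ k) :
    coef A i = a i :=
  coefficients_unique ((eq_sum_coef A).symm.trans h) (Nat.lt_succ_of_le hi)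

theorem coef_ofCoef (a : ℕ → SmoothFun 𝕜 P) {i : ℕ} (hi : i ≤ k) : coef (ofCoef k a) i = a i :=
  coef_eq_of_eq_sum rfl hi

theorem ext_coef {A B : DiffOp 𝕜 P k} (h : ∀ i ≤ k, ∀ x, (coef A i).1 x = (coef B i).1 x) :
    A = B := by
  refine Subtype.ext ?_
  rw [eq_sum_coef A, eq_sum_coef B]
  refine (Finset.sum_congr rfl fun i hi => ?_)
  rw [show coef A i = coef B i from
    Subtype.ext (funext (h i (Nat.lt_succ_iff.1 (Finset.mem_range.1 hi))))]

/-- The value at a point of a differential operator applied to a function that need not be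
periodic. -/
def evalAt (A : DiffOp 𝕜 P k) (φ : ℝ → 𝕜) (x : ℝ) : 𝕜 :=
  ∑ i ∈ Finset.range (k + 1), (coef A i).1 x * iteratedDeriv i φ x

theorem apply_eq_evalAt (A : DiffOp 𝕜 P k) (φ : SmoothFun 𝕜 P) (x : ℝ) :
    (A.1 φ).1 x = evalAt A φ.1 x := by
  conv_lhs => rw [eq_sum_coef A]
  exact sum_mulOp_mul_D_pow_apply _ _ _ _

theorem evalAt_congr (A : DiffOp 𝕜 P k) {φ ψ : ℝ → 𝕜} {x : ℝ} (h : φ =ᶠ[𝓝 x] ψ) :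
    evalAt A φ x = evalAt A ψ x :=
  Finset.sum_congr rfl fun i _ => by rw [h.iteratedDeriv_eq]

theorem evalAt_monomialAt (A : DiffOp 𝕜 P k) (x : ℝ) (j : ℕ) :
    evalAt A (monomialAt x j) x = (coef A j).1 x * j.factorial := by
  rcases le_or_gt j k with hj | hj
  · rw [evalAt, Finset.sum_eq_single j]
    · rw [iteratedDeriv_monomialAt_self, if_pos rfl]
    · intro i _ hi
      rw [iteratedDeriv_monomialAt_self, if_neg hi, mul_zero]
    · intro hn
      exact absurd (Finset.mem_range.2 (Nat.lt_succ_of_le hj)) hn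
  · rw [coef_of_lt A hj, evalAt, Finset.sum_eq_zero]
    · simp
    · intro i hi
      rw [iteratedDeriv_monomialAt_self, if_neg (by have := Finset.mem_range.1 hi; omega), mul_zero]

/-- The periods and the orders may differ, so that operators on the circle and on the line can be
compared at a point. -/
theorem coef_eq_of_evalAt_eq {A : DiffOp 𝕜 P k} {B : DiffOp 𝕜 Q l} {x : ℝ}
    (h : ∀ φ : ℝ → 𝕜, ContDiff ℝ ∞ φ → evalAt A φ x = evalAt B φ x) (i : ℕ) :
    (coef A i).1 x = (coef B i).1 x := by
  have := h _ (contDiff_monomialAt x i)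
  rw [evalAt_monomialAt, evalAt_monomialAt] at this
  exact mul_right_cancel₀ (Nat.cast_ne_zero.2 i.factorial_ne_zero) this

theorem evalAt_eq_of_coef_eq {A : DiffOp 𝕜 P k} {B : DiffOp 𝕜 Q k} {x : ℝ}
    (h : ∀ i, (coef A i).1 x = (coef B i).1 x) (φ : ℝ → 𝕜) : evalAt A φ x = evalAt B φ x :=
  Finset.sum_congr rfl fun i _ => by rw [h]

theorem coef_eq_of_apply_eq {A B : DiffOp 𝕜 P k} {x : ℝ}
    (h : ∀ φ, (A.1 φ).1 x = (B.1 φ).1 x) (i : ℕ) : (coef A i).1 x = (coef B i).1 x := by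
  refine coef_eq_of_evalAt_eq (fun φ hφ => ?_) i
  obtain ⟨ψ, hψ⟩ := exists_smoothFun_eventuallyEq P hφ x
  rw [← evalAt_congr A hψ, ← evalAt_congr B hψ, ← apply_eq_evalAt, ← apply_eq_evalAt, h]

theorem vanishesOn_iff {A : DiffOp 𝕜 P k} {U : Set ℝ} :
    VanishesOn A U ↔ ∀ x ∈ U, ∀ i, (coef A i).1 x = 0 := by
  constructor
  · intro h x hx i
    have := coef_eq_of_apply_eq (A := A) (B := 0) (x := x) (fun φ => h φ x hx) i
    rw [this, map_zero]
    rfl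
  · intro h φ x hx
    rw [apply_eq_evalAt]
    exact Finset.sum_eq_zero fun i _ => by rw [h x hx, zero_mul]

variable (𝕜 P k) in
/-- The subtraction of differential operators. -/
abbrev diffOpAddCommGroup : AddCommGroup (DiffOp 𝕜 P k) := Module.addCommMonoidToAddCommGroup 𝕜

attribute [local instance] diffOpAddCommGroup

/-- Two differential operators have the same germ at `x`. -/
def GermEq (x : ℝ) (A : DiffOp 𝕜 P k) (B : DiffOp 𝕜 Q k) : Prop :=
  ∀ᶠ y in 𝓝 x, ∀ i, (coef A i).1 y = (coef B i).1 y

namespace GermEq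

variable {x : ℝ} {A A' : DiffOp 𝕜 P k} {B B' : DiffOp 𝕜 Q k} {C : DiffOp 𝕜 R k}

theorem refl (A : DiffOp 𝕜 P k) (x : ℝ) : GermEq x A A := Eventually.of_forall fun _ _ => rfl

theorem symm (h : GermEq x A B) : GermEq x B A := h.mono fun _ h i => (h i).symm

theorem trans (h : GermEq x A B) (h' : GermEq x B C) : GermEq x A C := by
  filter_upwards [h, h'] with y hy hy' i using (hy i).trans (hy' i)

theorem self (h : GermEq x A B) (i : ℕ) : (coef A i).1 x = (coef B i).1 x := h.self_of_nhds i

theorem add (h : GermEq x A B) (h' : GermEq x A' B') : GermEq x (A + A') (B + B') := by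
  filter_upwards [h, h'] with y hy hy' i
  rw [map_add, map_add]
  exact congrArg₂ (· + ·) (hy i) (hy' i)

theorem smul (c : 𝕜) (h : GermEq x A B) : GermEq x (c • A) (c • B) := by
  filter_upwards [h] with y hy i
  rw [map_smul, map_smul]
  exact congrArg (c * ·) (hy i)

theorem sub (h : GermEq x A B) (h' : GermEq x A' B') : GermEq x (A - A') (B - B') := by
  filter_upwards [h, h'] with y hy hy' i
  rw [map_sub, map_sub]
  exact congrArg₂ (· - ·) (hy i) (hy' i)

theorem eventually (h : GermEq x A B) : ∀ᶠ y in 𝓝 x, GermEq y A B :=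
  eventually_eventually_nhds.2 h

end GermEq

theorem eq_of_germEq {A B : DiffOp 𝕜 P k} (h : ∀ x, GermEq x A B) : A = B :=
  ext_coef fun i _ x => (h x).self i

end Coefficients

/-! ### The action of diffeomorphisms and locality in terms of germs -/

section Action

attribute [local instance] diffOpAddCommGroup

variable {k : ℕ}

theorem jacobianPow_pos_ne (w : 𝕜) (f : OrientedDiffeo P) (x : ℝ) : (jacobianPow w f).1 x ≠ 0 := by
  intro h
  have := congrFun (congrArg Subtype.val (jacobianPow_neg_mul w f)) x
  change (jacobianPow (-w) f).1 x * (jacobianPow w f).1 x = 1 at this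
  rw [h, mul_zero] at this
  exact zero_ne_one this

theorem jacobianPow_eq_of_eventuallyEq (w : 𝕜) {f : OrientedDiffeo P} {g : OrientedDiffeo Q} {x : ℝ}
    (h : (f : ℝ → ℝ) =ᶠ[𝓝 x] g) : (jacobianPow w f).1 x = (jacobianPow w g).1 x := by
  change NormedSpace.exp (w * (Real.log (deriv f x) : 𝕜)) =
    NormedSpace.exp (w * (Real.log (deriv g x) : 𝕜))
  rw [h.deriv_eq]

theorem deriv_symm_mul_deriv (f : OrientedDiffeo P) (x : ℝ) :
    deriv f.symm (f x) * deriv f x = 1 := by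
  have h1 : HasDerivAt (fun y => f.symm (f y)) (deriv f.symm (f x) * deriv f x) x :=
    (f.symm.differentiable (f x)).hasDerivAt.comp x (f.differentiable x).hasDerivAt
  exact h1.unique ((hasDerivAt_id x).congr_of_eventuallyEq
      (Filter.Eventually.of_forall fun y => f.symm_apply y))

theorem jacobianPow_symm_mul (w : 𝕜) (f : OrientedDiffeo P) (x : ℝ) :
    (jacobianPow w f.symm).1 (f x) * (jacobianPow w f).1 x = 1 := by
  change NormedSpace.exp (w * (Real.log (deriv f.symm (f x)) : 𝕜)) *
    NormedSpace.exp (w * (Real.log (deriv f x) : 𝕜)) = 1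
  rw [← NormedSpace.exp_add, ← mul_add, ← RCLike.ofReal_add, ← Real.log_mul
    (f.symm.deriv_pos _).ne' (f.deriv_pos _).ne', deriv_symm_mul_deriv, Real.log_one]
  simp

theorem pullback_symm_mul_pullback (w : 𝕜) (f : OrientedDiffeo P) :
    pullback w f.symm * pullback w f = 1 := by
  ext1 φ
  refine Subtype.ext <| funext fun x => ?_
  change (jacobianPow w f.symm).1 x * ((jacobianPow w f).1 (f.symm x) * φ.1 (f (f.symm x))) = φ.1 x
  have := jacobianPow_symm_mul w f (f.symm x)
  rw [f.apply_symm] at this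
  rw [f.apply_symm, ← mul_assoc, this, one_mul]

/-- The relation `(f^*A)(f^*φ) = f^*(A φ)`, for functions that need not be periodic. Tested on
suitable `φ`, it replaces explicit formulas for the transformed coefficients. -/
theorem evalAt_opAction (lam mu : 𝕜) (f : OrientedDiffeo P) (A : DiffOp 𝕜 P k) {φ : ℝ → 𝕜}
    (hφ : ContDiff ℝ ∞ φ) (x : ℝ) :
    evalAt (opAction k lam mu f A) (fun y => (jacobianPow lam f).1 y * φ (f y)) x =
      (jacobianPow mu f).1 x * evalAt A φ (f x) := by
  obtain ⟨ψ, hψ⟩ := exists_smoothFun_eventuallyEq P hφ (f x)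
  have h1 : (pullback lam f ψ).1 =ᶠ[𝓝 x] fun y => (jacobianPow lam f).1 y * φ (f y) := by
    filter_upwards [(f.smooth.continuous.tendsto x).eventually hψ] with y hy
    change (jacobianPow lam f).1 y * ψ.1 (f y) = _
    rw [hy]
  rw [← evalAt_congr _ h1, ← evalAt_congr A hψ, ← apply_eq_evalAt, ← apply_eq_evalAt]
  change ((pullback mu f * A.1 * pullback lam f.symm) (pullback lam f ψ)).1 x = _
  rw [mul_assoc, Module.End.mul_apply, Module.End.mul_apply,
    ← Module.End.mul_apply (pullback lam f.symm),
    pullback_symm_mul_pullback]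
  rfl

/-- Every smooth function is the pull-back of a smooth function. -/
theorem exists_pullback_eq (w : 𝕜) (f : OrientedDiffeo P) {ψ : ℝ → 𝕜} (hψ : ContDiff ℝ ∞ ψ) :
    ∃ φ : ℝ → 𝕜, ContDiff ℝ ∞ φ ∧ (fun y => (jacobianPow w f).1 y * φ (f y)) = ψ := by
  refine ⟨fun z => (jacobianPow w f.symm).1 z * ψ (f.symm z),
    (jacobianPow w f.symm).2.1.mul (hψ.comp f.smooth_symm), funext fun y => ?_⟩
  simp only []
  rw [f.symm_apply, ← mul_assoc, mul_comm ((jacobianPow w f).1 y), jacobianPow_symm_mul, one_mul]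

/-- The germ of the diffeomorphism at `x` and the coefficients of the operator at its image
determine the result at `x`. The two diffeomorphisms may belong to different quotients, which is
what the passage between circle and line uses. -/
theorem coef_opAction_congr (lam mu : 𝕜) {f : OrientedDiffeo P} {g : OrientedDiffeo Q} {x : ℝ}
    (hfg : (f : ℝ → ℝ) =ᶠ[𝓝 x] g) {A : DiffOp 𝕜 P k} {B : DiffOp 𝕜 Q k}
    (hAB : ∀ i, (coef A i).1 (f x) = (coef B i).1 (f x)) (i : ℕ) :
    (coef (opAction k lam mu f A) i).1 x = (coef (opAction k lam mu g B) i).1 x := by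
  refine coef_eq_of_evalAt_eq (fun ψ hψ => ?_) i
  obtain ⟨φ, hφ, rfl⟩ := exists_pullback_eq lam f hψ
  have h1 : (fun y => (jacobianPow lam f).1 y * φ (f y)) =ᶠ[𝓝 x]
      fun y => (jacobianPow lam g).1 y * φ (g y) := by
    filter_upwards [eventually_eventually_nhds.2 hfg] with y hy
    rw [jacobianPow_eq_of_eventuallyEq lam hy, hy.self_of_nhds]
  rw [evalAt_opAction _ _ _ _ hφ, evalAt_congr _ h1, evalAt_opAction _ _ _ _ hφ,
    jacobianPow_eq_of_eventuallyEq mu hfg, evalAt_eq_of_coef_eq hAB, hfg.self_of_nhds]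

theorem GermEq.opAction (lam mu : 𝕜) {f : OrientedDiffeo P} {g : OrientedDiffeo Q} {x : ℝ}
    (hfg : (f : ℝ → ℝ) =ᶠ[𝓝 x] g) {A : DiffOp 𝕜 P k} {B : DiffOp 𝕜 Q k}
    (hAB : GermEq (f x) A B) :
    GermEq x (opAction k lam mu f A) (opAction k lam mu g B) := by
  filter_upwards [eventually_eventually_nhds.2 hfg,
    (f.smooth.continuous.tendsto x).eventually hAB] with y hy hy'
  exact coef_opAction_congr lam mu hy hy'

/-- The identity diffeomorphism. -/
def OrientedDiffeo.refl (P : ℝ) : OrientedDiffeo P where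
  toOrderIso := OrderIso.refl ℝ
  smooth := contDiff_id
  smooth_symm := contDiff_id
  map_add_period _ := rfl

theorem pullback_refl (w : 𝕜) : pullback w (OrientedDiffeo.refl P) = 1 := by
  ext1 φ
  refine Subtype.ext <| funext fun x => ?_
  change NormedSpace.exp (w * (Real.log (deriv (fun y : ℝ => y) x) : 𝕜)) * φ.1 x = φ.1 x
  simp

theorem opAction_refl (lam mu : 𝕜) (A : DiffOp 𝕜 P k) :
    opAction k lam mu (OrientedDiffeo.refl P) A = A := by
  refine Subtype.ext ?_
  change pullback mu (OrientedDiffeo.refl P) * A.1 * pullback lam (OrientedDiffeo.refl P) = A.1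
  rw [pullback_refl, pullback_refl, one_mul, mul_one]

/-- A diffeomorphism that is the identity near `x` acts trivially on germs at `x`. -/
theorem coef_opAction_of_eventuallyEq_id (lam mu : 𝕜) {f : OrientedDiffeo P} {x : ℝ}
    (hf : (f : ℝ → ℝ) =ᶠ[𝓝 x] id) (A : DiffOp 𝕜 P k) (i : ℕ) :
    (coef (opAction k lam mu f A) i).1 x = (coef A i).1 x := by
  conv_rhs => rw [← opAction_refl lam mu A]
  exact coef_opAction_congr lam mu (g := OrientedDiffeo.refl P) hf (fun _ => rfl) i

theorem coef_opAction_eq_zero (lam mu : 𝕜) (f : OrientedDiffeo P) {x : ℝ} {A : DiffOp 𝕜 P k}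
    (hA : ∀ i, (coef A i).1 (f x) = 0) (i : ℕ) : (coef (opAction k lam mu f A) i).1 x = 0 := by
  rw [coef_opAction_congr lam mu (g := f) EventuallyEq.rfl (B := 0) (fun i => by
    rw [hA, map_zero]; rfl), map_zero, map_zero]
  rfl

theorem comm_opAction {lam mu : 𝕜} {T : Module.End 𝕜 (DiffOp 𝕜 P k)}
    (hT : T ∈ Symmetries P k lam mu) (f : OrientedDiffeo P) (A : DiffOp 𝕜 P k) :
    T (opAction k lam mu f A) = opAction k lam mu f (T A) :=
  (LinearMap.congr_fun (Subalgebra.mem_centralizer_iff 𝕜 |>.1 hT _ ⟨f, rfl⟩) A).symm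

theorem mem_symmetries {lam mu : 𝕜} {T : Module.End 𝕜 (DiffOp 𝕜 P k)}
    (hT : ∀ (f : OrientedDiffeo P) (A : DiffOp 𝕜 P k),
      T (opAction k lam mu f A) = opAction k lam mu f (T A)) : T ∈ Symmetries P k lam mu := by
  refine (Subalgebra.mem_centralizer_iff 𝕜).2 ?_
  rintro _ ⟨f, rfl⟩
  exact LinearMap.ext fun A => (hT f A).symm

theorem isLocal_iff {T : Module.End 𝕜 (DiffOp 𝕜 P k)} :
    IsLocal T ↔ ∀ (A : DiffOp 𝕜 P k) (x : ℝ), GermEq x A (0 : DiffOp 𝕜 P k) →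
      ∀ i, (coef (T A) i).1 x = 0 := by
  have h0 (i : ℕ) (y : ℝ) : (coef (0 : DiffOp 𝕜 P k) i).1 y = 0 := by rw [map_zero]; rfl
  constructor
  · intro h A x hA i
    obtain ⟨U, hU, hUo, hxU⟩ := eventually_nhds_iff.1 hA
    exact vanishesOn_iff.1 (h A U hUo (vanishesOn_iff.2 fun y hy i => by rw [hU y hy i, h0]))
      x hxU i
  · intro h A U hU hA
    refine vanishesOn_iff.2 fun x hx i => h A x ?_ i
    filter_upwards [hU.mem_nhds hx] with y hy i
    rw [vanishesOn_iff.1 hA y hy, h0]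

theorem IsLocal.germEq {T : Module.End 𝕜 (DiffOp 𝕜 P k)} (hT : IsLocal T) {A B : DiffOp 𝕜 P k}
    {x : ℝ} (h : GermEq x A B) : GermEq x (T A) (T B) := by
  filter_upwards [h.eventually] with y hy i
  have h1 : GermEq y (A - B) (0 : DiffOp 𝕜 P k) := by
    have := hy.sub (GermEq.refl B y)
    rwa [sub_self] at this
  have := isLocal_iff.1 hT _ _ h1 i
  rw [map_sub, map_sub] at this
  exact sub_eq_zero.1 this

end Action

/-! ### Construction of diffeomorphisms -/

section Diffeomorphisms

/-- A uniform lower bound on the derivative, and not only its positivity, makes `F` surjective onto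
the line. -/
theorem exists_diffeo {F : ℝ → ℝ} (hF : ContDiff ℝ ∞ F) {δ : ℝ} (hδ : 0 < δ)
    (hd : ∀ x, δ ≤ deriv F x) (hper : ∀ x, F (x + P) = F x + P) :
    ∃ f : OrientedDiffeo P, ∀ x, f x = F x := by
  have hdiff : Differentiable ℝ F := hF.differentiable (by simp)
  have hmono : StrictMono F := strictMono_of_deriv_pos fun x => hδ.trans_le (hd x)
  have hlow := mul_sub_le_image_sub_of_le_deriv hdiff hd
  have hsurj : Function.Surjective F := by
    refine hF.continuous.surjective ?_ ?_
    · refine tendsto_atTop_mono' atTop (f₁ := fun x => δ * x + F 0) ?_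
        (tendsto_atTop_add_const_right _ _ (tendsto_id.const_mul_atTop hδ))
      filter_upwards [eventually_ge_atTop 0] with x hx
      have := hlow hx
      simp only [sub_zero] at this
      linarith
    · refine tendsto_atBot_mono' (f₁ := fun x => δ * x + F 0) (f₂ := F) atBot ?_
        (tendsto_atBot_add_const_right _ _ (tendsto_id.const_mul_atBot hδ))
      filter_upwards [eventually_le_atBot 0] with x hx
      have := hlow hx
      linarith
  refine ⟨⟨hmono.orderIsoOfSurjective F hsurj, hF, ?_, hper⟩, fun _ => rfl⟩
  exact (hmono.orderIsoOfSurjective F hsurj).toHomeomorph.contDiff_symm_deriv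
    (fun x => (hδ.trans_le (hd x)).ne') (fun x => (hdiff x).hasDerivAt) hF

/-- The diffeomorphism is a primitive of `h`. The condition on the integral over a period makes it
commute with the translation by `P`; for `P = 0` it is vacuous. -/
theorem exists_diffeo_of_deriv {h : ℝ → ℝ} (hh : ContDiff ℝ ∞ h) {δ : ℝ} (hδ : 0 < δ)
    (hd : ∀ x, δ ≤ h x) (hper : Function.Periodic h P) (hint : ∫ x in (0 : ℝ)..P, h x = P)
    (x₀ y₀ : ℝ) :
    ∃ f : OrientedDiffeo P, f x₀ = y₀ ∧ ∀ x, HasDerivAt f (h x) x := by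
  have hF (x : ℝ) : HasDerivAt (fun x => y₀ + ∫ t in x₀..x, h t) (h x) x :=
    (intervalIntegral.integral_hasDerivAt_right (hh.continuous.intervalIntegrable _ _)
      (hh.continuous.stronglyMeasurableAtFilter _ _) hh.continuous.continuousAt).const_add y₀
  have hF' : deriv (fun x => y₀ + ∫ t in x₀..x, h t) = h := funext fun x => (hF x).deriv
  obtain ⟨f, hf⟩ := exists_diffeo (P := P) (F := fun x => y₀ + ∫ t in x₀..x, h t)
    (contDiff_infty_iff_deriv.2 ⟨fun x => (hF x).differentiableAt, by rwa [hF']⟩) hδ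
    (fun x => by rw [hF']; exact hd x) (fun x => by
      have h1 := hper.intervalIntegral_add_eq x 0
      rw [zero_add, hint] at h1
      rw [← intervalIntegral.integral_add_adjacent_intervals
        (hh.continuous.intervalIntegrable x₀ x) (hh.continuous.intervalIntegrable x (x + P)), h1,
        add_assoc])
  have hf' : (f : ℝ → ℝ) = fun x => y₀ + ∫ t in x₀..x, h t := funext hf
  exact ⟨f, by rw [hf]; simp, fun x => by rw [hf']; exact hF x⟩

/-- The translation by `c`. -/
def translation (P c : ℝ) : OrientedDiffeo P where
  toOrderIso := OrderIso.addRight c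
  smooth := contDiff_id.add contDiff_const
  smooth_symm := contDiff_id.sub contDiff_const
  map_add_period _ := add_right_comm _ _ _

theorem jacobianPow_translation (w : 𝕜) (c x : ℝ) : (jacobianPow w (translation P c)).1 x = 1 := by
  change NormedSpace.exp (w * (Real.log (deriv (fun y : ℝ => y + c) x) : 𝕜)) = 1
  simp

variable {k : ℕ}

theorem coef_opAction_translation (lam mu : 𝕜) (c : ℝ) (A : DiffOp 𝕜 P k) (i : ℕ) (x : ℝ) :
    (coef (opAction k lam mu (translation P c) A) i).1 x = (coef A i).1 (x + c) := by
  have h := evalAt_opAction lam mu (translation P c) A (contDiff_monomialAt (x + c) i) x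
  have h2 : (fun y => (jacobianPow lam (translation P c)).1 y *
      monomialAt (𝕜 := 𝕜) (x + c) i (translation P c y)) = monomialAt x i := by
    funext y
    rw [jacobianPow_translation, one_mul]
    change ((y + c - (x + c) : ℝ) : 𝕜) ^ i = ((y - x : ℝ) : 𝕜) ^ i
    rw [add_sub_add_right_eq_sub]
  rw [h2, evalAt_monomialAt, jacobianPow_translation, one_mul] at h
  have h3 := h.trans (evalAt_monomialAt A (x + c) i)
  exact mul_right_cancel₀ (Nat.cast_ne_zero.2 i.factorial_ne_zero) h3

theorem coef_opAction_of_eventuallyEq_translation (lam mu : 𝕜) {f : OrientedDiffeo P} {c x : ℝ}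
    (hf : (f : ℝ → ℝ) =ᶠ[𝓝 x] fun y => y + c) (A : DiffOp 𝕜 P k) (i : ℕ) :
    (coef (opAction k lam mu f A) i).1 x = (coef A i).1 (x + c) := by
  rw [← coef_opAction_translation lam mu]
  exact coef_opAction_congr lam mu (g := translation P c) hf (fun _ => rfl) i

end Diffeomorphisms

/-! ### Locality of symmetries on the line -/

section LineLocality

variable {k : ℕ}

attribute [local instance] diffOpAddCommGroup

/-- There is a diffeomorphism of the line that is the translation by `-σ` near `x₀`, and the
identity on the half-line that lies beyond `q` in the direction `σ`. -/
theorem exists_diffeo_translation_near {σ x₀ q : ℝ} (hσ : σ * σ = 1) (hq : σ * x₀ < q) :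
    ∃ f : OrientedDiffeo line, (f : ℝ → ℝ) =ᶠ[𝓝 x₀] (fun y => y + -σ) ∧
      ∀ x, q ≤ σ * x → f x = x := by
  set δ := (q - σ * x₀) / 2 with hδ
  have hδ0 : 0 < δ := by rw [hδ]; linarith
  have hl (x : ℝ) : HasDerivAt (fun x => (q - σ * x) / δ) (-σ / δ) x := by
    have := (((hasDerivAt_id x).const_mul σ).const_sub q).div_const δ
    simpa using this
  have hst (x : ℝ) : HasDerivAt Real.smoothTransition (deriv Real.smoothTransition x) x :=
    ((Real.smoothTransition.contDiff (n := 1)).differentiable (by simp) x).hasDerivAt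
  -- The shift by `-σ` is switched off while `σ x` runs from `q - δ` to `q`. As `σ² = 1`, the
  -- derivative is one plus a nonnegative term.
  obtain ⟨f, hf⟩ := exists_diffeo (P := line)
    (F := fun x => x - σ * Real.smoothTransition ((q - σ * x) / δ))
    (contDiff_id.sub (contDiff_const.mul (Real.smoothTransition.contDiff.comp (by fun_prop))))
    one_pos (fun x => by
      have := ((hasDerivAt_id x).sub (((hst ((q - σ * x) / δ)).comp x (hl x)).const_mul σ)).deriv
      have h2 : deriv (fun x => x - σ * Real.smoothTransition ((q - σ * x) / δ)) x = _ := this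
      rw [h2]
      have h3 : 0 ≤ deriv Real.smoothTransition ((q - σ * x) / δ) :=
        Real.smoothTransition.monotone.deriv_nonneg
      have h4 : σ * (deriv Real.smoothTransition ((q - σ * x) / δ) * (-σ / δ)) =
        - (deriv Real.smoothTransition ((q - σ * x) / δ) / δ) := by
        linear_combination (-(deriv Real.smoothTransition ((q - σ * x) / δ) / δ)) * hσ
      rw [h4]
      have := div_nonneg h3 hδ0.le
      linarith) (fun x => by simp)
  refine ⟨f, ?_, fun x hx => ?_⟩
  · have hc : ContinuousAt (fun x => σ * x) x₀ := by fun_prop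
    filter_upwards [hc.preimage_mem_nhds (Iio_mem_nhds (show σ * x₀ < q - δ by
      rw [hδ]; linarith))] with y hy
    rw [hf, Real.smoothTransition.one_of_one_le, mul_one, sub_eq_add_neg]
    rw [le_div_iff₀ hδ0]
    have : σ * y < q - δ := hy
    linarith
  · rw [hf, Real.smoothTransition.zero_of_nonpos, mul_zero, sub_zero]
    exact div_nonpos_of_nonpos_of_nonneg (by linarith) hδ0.le

/-- A smooth function supported in a half-line is of the form `s(x) - s(x - σ)` with a smooth
function `s` supported in the same half-line. -/
theorem exists_sub_translate_eq {E : Type*} [NormedAddCommGroup E] [NormedSpace ℝ E] {a : ℝ → E}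
    (ha : ContDiff ℝ ∞ a) {σ q : ℝ} (hσ : σ * σ = 1) (h0 : ∀ x, σ * x < q → a x = 0) :
    ∃ s : ℝ → E, ContDiff ℝ ∞ s ∧ (∀ x, σ * x < q → s x = 0) ∧ ∀ x, s x - s (x - σ) = a x := by
  have hz {x : ℝ} {n : ℕ} (hn : ⌈σ * x - q⌉₊ < n) : a (x - σ * n) = 0 := by
    apply h0
    have := Nat.lt_of_ceil_lt hn
    rw [mul_sub, ← mul_assoc, hσ]
    linarith
  -- This is `∑ a(x - σ n)` over all `n ≥ 0`, truncated where the terms start to vanish; locally the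
  -- number of terms can be taken constant.
  set s : ℝ → E := fun x => ∑ n ∈ Finset.range (⌈σ * x - q⌉₊ + 1), a (x - σ * n) with hs
  have hsum {x : ℝ} {N : ℕ} (hN : ⌈σ * x - q⌉₊ < N) :
      s x = ∑ n ∈ Finset.range N, a (x - σ * n) := by
    refine Finset.sum_subset (Finset.range_mono hN) fun n _ hn => hz ?_
    simpa using hn
  refine ⟨s, contDiff_iff_contDiffAt.2 fun x => ?_, fun x hx => ?_, fun x => ?_⟩
  · have hev : s =ᶠ[𝓝 x] fun y => ∑ n ∈ Finset.range (⌈σ * x - q⌉₊ + 2), a (y - σ * n) := by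
      have hc : ContinuousAt (fun x => σ * x) x := by fun_prop
      filter_upwards [hc.preimage_mem_nhds (Iio_mem_nhds (show σ * x < σ * x + 1 by linarith))]
        with y hy
      refine hsum ?_
      rw [Nat.lt_succ_iff, Nat.ceil_le]
      have h1 : σ * y < σ * x + 1 := hy
      have h2 := Nat.le_ceil (σ * x - q)
      push_cast
      linarith
    refine ContDiffAt.congr_of_eventuallyEq ?_ hev
    exact ContDiffAt.sum fun n _ => (ha.comp (contDiff_id.sub contDiff_const)).contDiffAt
  · refine Finset.sum_eq_zero fun n _ => h0 _ ?_
    rw [mul_sub, ← mul_assoc, hσ]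
    have : (0 : ℝ) ≤ n := Nat.cast_nonneg n
    linarith
  · set N := max (⌈σ * x - q⌉₊) (⌈σ * (x - σ) - q⌉₊) + 1 with hN
    rw [hsum (x := x) (N := N + 1) (by omega), hsum (x := x - σ) (N := N) (by omega),
      Finset.sum_range_succ']
    have : ∀ n : ℕ, x - σ * ((n + 1 : ℕ) : ℝ) = x - σ - σ * n := fun n => by push_cast; ring
    simp only [this]
    simp

/-- Write `A = S - τ^*S` with `τ` the translation by `-σ`. A diffeomorphism equal to `τ` near `x₀`
and to the identity on the support of `S` fixes `S`, hence also `T S`, which therefore takes the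
same values at `x₀` and at `x₀ - σ`. -/
theorem coef_eq_zero_of_halfLine {lam mu : 𝕜} {T : Module.End 𝕜 (DiffOp 𝕜 line k)}
    (hT : T ∈ Symmetries line k lam mu) {σ q x₀ : ℝ} (hσ : σ * σ = 1) {A : DiffOp 𝕜 line k}
    (hA : ∀ x, σ * x < q → ∀ i, (coef A i).1 x = 0) (hx₀ : σ * x₀ < q) (i : ℕ) :
    (coef (T A) i).1 x₀ = 0 := by
  choose s hs hs0 hsa using fun i =>
    exists_sub_translate_eq (coef A i).2.1 hσ (fun x hx => hA x hx i)
  set S : DiffOp 𝕜 line k := ofCoef k fun i => ⟨s i, hs i, fun x => by simp⟩ with hS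
  have hSc (i : ℕ) (hi : i ≤ k) : (coef S i).1 = s i := by rw [hS, coef_ofCoef _ hi]
  have hS0 (x : ℝ) (hx : σ * x < q) (i : ℕ) : (coef S i).1 x = 0 := by
    rcases le_or_gt i k with hi | hi
    · rw [hSc i hi, hs0 i x hx]
    · rw [coef_of_lt _ hi]; rfl
  have hAS : A = S - opAction k lam mu (translation line (-σ)) S := by
    refine ext_coef fun i hi x => ?_
    rw [map_sub]
    change _ = (coef S i).1 x - (coef _ i).1 x
    rw [coef_opAction_translation, hSc i hi, ← sub_eq_add_neg, hsa]
  obtain ⟨f, hf1, hf2⟩ := exists_diffeo_translation_near (q := (σ * x₀ + q) / 2) hσ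
    (show σ * x₀ < (σ * x₀ + q) / 2 by linarith)
  have hfq : f (σ * q) = σ * q := hf2 _ (by rw [← mul_assoc, hσ]; linarith)
  -- Beyond `q` the diffeomorphism is the identity; before `q` both sides vanish, since the
  -- increasing map `f` fixes the boundary point `σ q` and preserves that half-line.
  have hfS : opAction k lam mu f S = S := by
    refine ext_coef fun i hi x => ?_
    rcases lt_or_ge (σ * x) q with hx | hx
    · rw [hS0 x hx]
      refine coef_opAction_eq_zero lam mu f (fun i => hS0 _ ?_ i) i
      rcases mul_self_eq_one_iff.1 hσ with rfl | rfl
      · have := f.toOrderIso.strictMono (show x < 1 * q by linarith)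
        rw [hfq] at this
        linarith
      · have := f.toOrderIso.strictMono (show -1 * q < x by linarith)
        rw [hfq] at this
        linarith
    · refine coef_opAction_of_eventuallyEq_id lam mu ?_ S i
      have hc : ContinuousAt (fun x => σ * x) x := by fun_prop
      filter_upwards [hc.preimage_mem_nhds (Ioi_mem_nhds (show (σ * x₀ + q) / 2 < σ * x by
        linarith))] with y hy using hf2 y (le_of_lt hy)
  have h1 : (coef (T S) i).1 x₀ = (coef (T S) i).1 (x₀ + -σ) := by
    rw [← coef_opAction_of_eventuallyEq_translation lam mu hf1, ← comm_opAction hT, hfS]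
  rw [hAS, map_sub, map_sub, comm_opAction hT]
  change (coef (T S) i).1 x₀ - (coef _ i).1 x₀ = 0
  rw [coef_opAction_translation, h1, sub_self]

/-- On the line, every symmetry is local. -/
theorem isLocal_of_mem_symmetries_line {lam mu : 𝕜} {T : Module.End 𝕜 (DiffOp 𝕜 line k)}
    (hT : T ∈ Symmetries line k lam mu) : IsLocal T := by
  refine isLocal_iff.2 fun A x₀ hA i => ?_
  have hA' : ∀ᶠ y in 𝓝 x₀, ∀ i, (coef A i).1 y = 0 := by
    filter_upwards [hA] with y hy i
    rw [hy, map_zero]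
    rfl
  obtain ⟨η, hη, hball⟩ := Metric.eventually_nhds_iff.1 hA'
  have hz (y : ℝ) (h1 : x₀ - η < y) (h2 : y < x₀ + η) (i : ℕ) : (coef A i).1 y = 0 :=
    hball (by rw [Real.dist_eq, abs_lt]; constructor <;> linarith) i
  -- The operator can be cut at `x₀` by an indicator function without losing smoothness, because it
  -- vanishes near `x₀`.
  have hsm (s : Set ℝ) (hs : ∀ y, y ≠ x₀ → s =ᶠ[𝓝 y] (Set.univ : Set ℝ) ∨ s =ᶠ[𝓝 y] (∅ : Set ℝ))
      (i : ℕ) :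
      ContDiff ℝ ∞ (s.indicator (coef A i).1) := by
    refine contDiff_iff_contDiffAt.2 fun y => ?_
    by_cases hy : y = x₀
    · subst hy
      refine (contDiffAt_const (c := (0 : 𝕜))).congr_of_eventuallyEq ?_
      filter_upwards [hA'] with z hz
      by_cases hzs : z ∈ s
      · rw [Set.indicator_of_mem hzs, hz]
      · rw [Set.indicator_of_notMem hzs]
    · rcases hs y hy with h | h
      · refine ((coef A i).2.1.contDiffAt).congr_of_eventuallyEq ?_
        filter_upwards [h.mem_iff] with z hz
        rw [Set.indicator_of_mem (hz.2 trivial)]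
      · refine (contDiffAt_const (c := (0 : 𝕜))).congr_of_eventuallyEq ?_
        filter_upwards [h.mem_iff] with z hz
        rw [Set.indicator_of_notMem (fun h => hz.1 h)]
  have hIoi (y : ℝ) (hy : y ≠ x₀) :
      Set.Ioi x₀ =ᶠ[𝓝 y] (Set.univ : Set ℝ) ∨ Set.Ioi x₀ =ᶠ[𝓝 y] (∅ : Set ℝ) := by
    rcases lt_or_gt_of_ne hy with h | h
    · right
      filter_upwards [Iio_mem_nhds h] with z hz
      exact propext ⟨fun h' => (lt_asymm h' hz).elim, fun h' => h'.elim⟩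
    · left
      filter_upwards [Ioi_mem_nhds h] with z hz
      exact propext ⟨fun _ => trivial, fun _ => hz⟩
  have hIio (y : ℝ) (hy : y ≠ x₀) :
      Set.Iio x₀ =ᶠ[𝓝 y] (Set.univ : Set ℝ) ∨ Set.Iio x₀ =ᶠ[𝓝 y] (∅ : Set ℝ) := by
    rcases lt_or_gt_of_ne hy with h | h
    · left
      filter_upwards [Iio_mem_nhds h] with z hz
      exact propext ⟨fun _ => trivial, fun _ => hz⟩
    · right
      filter_upwards [Ioi_mem_nhds h] with z hz
      exact propext ⟨fun h' => (lt_asymm h' hz).elim, fun h' => h'.elim⟩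
  set B : DiffOp 𝕜 line k := ofCoef k fun i =>
    ⟨(Set.Ioi x₀).indicator (coef A i).1, hsm _ hIoi i, fun x => by simp⟩ with hB
  set C : DiffOp 𝕜 line k := ofCoef k fun i =>
    ⟨(Set.Iio x₀).indicator (coef A i).1, hsm _ hIio i, fun x => by simp⟩ with hC
  have hABC : A = B + C := by
    refine ext_coef fun i hi x => ?_
    rw [map_add]
    change _ = (coef B i).1 x + (coef C i).1 x
    rw [hB, hC, coef_ofCoef _ hi, coef_ofCoef _ hi]
    simp only [Set.indicator_apply, Set.mem_Ioi, Set.mem_Iio]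
    rcases lt_trichotomy x x₀ with h | rfl | h
    · simp [h, h.not_gt]
    · simpa using hA'.self_of_nhds i
    · simp [h, h.not_gt]
  have hB0 : (coef (T B) i).1 x₀ = 0 := by
    refine coef_eq_zero_of_halfLine hT (one_mul 1) (q := x₀ + η) (fun x hx i => ?_)
      (by linarith) i
    rcases le_or_gt i k with hi | hi
    · rw [hB, coef_ofCoef _ hi]
      refine Set.indicator_apply_eq_zero.2 fun hx' => hz x ?_ (by linarith) i
      have : x₀ < x := hx'
      linarith
    · rw [coef_of_lt _ hi]; rfl
  have hC0 : (coef (T C) i).1 x₀ = 0 := by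
    refine coef_eq_zero_of_halfLine hT (show (-1 : ℝ) * -1 = 1 by norm_num) (q := -x₀ + η)
      (fun x hx i => ?_) (by linarith) i
    rcases le_or_gt i k with hi | hi
    · rw [hC, coef_ofCoef _ hi]
      refine Set.indicator_apply_eq_zero.2 fun hx' => hz x (by linarith) ?_ i
      have : x < x₀ := hx'
      linarith
    · rw [coef_of_lt _ hi]; rfl
  rw [hABC, map_add, map_add]
  change (coef (T B) i).1 x₀ + (coef (T C) i).1 x₀ = 0
  rw [hB0, hC0, add_zero]

end LineLocality

/-! ### Small diffeomorphisms supported near a point of the circle -/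

section Perturbation

theorem exists_abs_le_of_periodic {v : ℝ → ℝ} (hv : Continuous v) (hper : Function.Periodic v 1) :
    ∃ M, 0 < M ∧ ∀ x, |v x| ≤ M := by
  obtain ⟨M, hM⟩ := isCompact_Icc.exists_bound_of_continuousOn (s := Set.Icc (0 : ℝ) 1)
    hv.continuousOn
  refine ⟨max M 1, by positivity, fun x => ?_⟩
  obtain ⟨y, hy, hxy⟩ := hper.exists_mem_Ico₀ one_pos x
  rw [hxy]
  exact (hM y ⟨hy.1, hy.2.le⟩).trans (le_max_left _ _)

theorem exists_diffeo_perturbation {u : ℝ → ℝ} (hu : ContDiff ℝ ∞ u)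
    (hper : Function.Periodic u 1) :
    ∃ ε₀ > 0, ∀ ε, |ε| < ε₀ → ∃ f : OrientedDiffeo circle, ∀ x, f x = x + ε * u x := by
  have hper' : Function.Periodic (deriv u) 1 := fun x => by
    rw [← deriv_comp_add_const, funext hper]
  obtain ⟨M, hM0, hM⟩ := exists_abs_le_of_periodic (contDiff_infty_iff_deriv.1 hu).2.continuous hper'
  refine ⟨1 / (2 * M), by positivity, fun ε hε => ?_⟩
  refine exists_diffeo (F := fun x => x + ε * u x) (contDiff_id.add (contDiff_const.mul hu))
    (show (0 : ℝ) < 1 / 2 by norm_num) (fun x => ?_) (fun x => ?_)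
  · have h1 : HasDerivAt (fun x => x + ε * u x) (1 + ε * deriv u x) x :=
      (hasDerivAt_id x).add (((hu.differentiable (by simp)) x).hasDerivAt.const_mul ε)
    rw [h1.deriv]
    have h2 : |ε * deriv u x| ≤ 1 / 2 := by
      rw [abs_mul]
      calc |ε| * |deriv u x| ≤ 1 / (2 * M) * M := by
            exact mul_le_mul hε.le (hM x) (abs_nonneg _) (by positivity)
        _ = 1 / 2 := by field_simp
    linarith [(abs_le.1 h2).1]
  · change x + 1 + ε * u (x + 1) = x + ε * u x + 1
    rw [hper]
    ring

variable {k : ℕ}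

theorem coef_add_int (A : DiffOp 𝕜 circle k) (i : ℕ) (x : ℝ) (n : ℤ) :
    (coef A i).1 (x + n) = (coef A i).1 x := by
  have := (coef A i).2.2.int_mul n x
  rwa [mul_one] at this

/-- If `A` vanishes near a point of the circle, then its image under a symmetry is invariant under
the diffeomorphisms supported near that point. -/
theorem exists_perturbation_opAction_eq {lam mu : 𝕜} {T : Module.End 𝕜 (DiffOp 𝕜 circle k)}
    (hT : T ∈ Symmetries circle k lam mu) {A : DiffOp 𝕜 circle k} {x₀ : ℝ}
    (hA : ∀ᶠ y in 𝓝 x₀, ∀ i, (coef A i).1 y = 0) {G : ℝ → ℝ} (hG : ContDiff ℝ ∞ G) :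
    ∃ ε₀ > 0, ∀ ε, |ε| < ε₀ → ∃ f : OrientedDiffeo circle,
      ((f : ℝ → ℝ) =ᶠ[𝓝 x₀] fun x => x + ε * G x) ∧ opAction k lam mu f (T A) = T A := by
  obtain ⟨η, hη, hball⟩ := Metric.eventually_nhds_iff.1 hA
  have hz (y : ℝ) (n : ℤ) (hy : |y - x₀ - n| < η) (i : ℕ) : (coef A i).1 y = 0 := by
    have := coef_add_int A i (y - n) n
    rw [sub_add_cancel] at this
    rw [this]
    refine hball ?_ i
    rw [Real.dist_eq]
    rwa [sub_right_comm]
  obtain ⟨χ, hχ, hχper, -, -, hχ1, hχsupp⟩ := exists_periodic_bump x₀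
    (show (0 : ℝ) < η / 4 by linarith)
  obtain ⟨g, hg⟩ := exists_smoothFun_eventuallyEq (𝕜 := ℝ) circle hG x₀
  have hu : ContDiff ℝ ∞ fun x => χ x * g.1 x := hχ.mul g.2.1
  have huper : Function.Periodic (fun x => χ x * g.1 x) 1 := hχper.mul g.2.2
  obtain ⟨ε₁, hε₁, hf⟩ := exists_diffeo_perturbation hu huper
  obtain ⟨M, hM0, hM⟩ := exists_abs_le_of_periodic hu.continuous huper
  refine ⟨min ε₁ (η / (2 * M)), by positivity, fun ε hε => ?_⟩
  obtain ⟨f, hf⟩ := hf ε (hε.trans_le (min_le_left _ _))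
  have hsmall (x : ℝ) : |ε * (χ x * g.1 x)| ≤ η / 2 := by
    rw [abs_mul]
    calc |ε| * |χ x * g.1 x| ≤ η / (2 * M) * M :=
          mul_le_mul (hε.le.trans (min_le_right _ _)) (hM x) (abs_nonneg _) (by positivity)
      _ = η / 2 := by field_simp
  refine ⟨f, ?_, ?_⟩
  · filter_upwards [hχ1, hg] with y hy hy'
    rw [hf, hy, hy', one_mul]
  · rw [← comm_opAction hT]
    congr 1
    refine ext_coef fun i _ x => ?_
    -- The displacement is at most `η / 2` and is supported within `η / 4` of `x₀ + ℤ`. Points at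
    -- distance less than `η / 2` stay where `A` vanishes; near all other points `f` is the
    -- identity.
    by_cases hx : ∃ n : ℤ, |x - x₀ - n| < η / 2
    · obtain ⟨n, hn⟩ := hx
      rw [hz x n (by linarith)]
      refine coef_opAction_eq_zero lam mu f (fun i => hz _ n ?_ i) i
      rw [hf]
      have h1 := abs_le.1 (hsmall x)
      have h2 := abs_lt.1 hn
      rw [abs_lt]
      constructor <;> linarith
    · refine coef_opAction_of_eventuallyEq_id lam mu ?_ A i
      filter_upwards [Metric.ball_mem_nhds x (show (0 : ℝ) < η / 4 by linarith)] with y hy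
      rw [hf]
      by_cases hχy : χ y = 0
      · simp [hχy]
      · obtain ⟨n, hn⟩ := hχsupp y hχy
        refine absurd ⟨n, ?_⟩ hx
        rw [Metric.mem_ball, Real.dist_eq] at hy
        have h1 := abs_lt.1 hy
        have h2 := abs_lt.1 hn
        rw [abs_lt]
        constructor <;> linarith

end Perturbation

/-! ### Constraints on the weights, and locality on the circle for distinct weights -/

section Weights

variable {k : ℕ}

theorem iteratedDeriv_succ_linear_mul {h : ℝ → 𝕜} (hh : ContDiff ℝ ∞ h) (x₀ : ℝ) (n : ℕ) :
    iteratedDeriv (n + 1) (fun y => ((y - x₀ : ℝ) : 𝕜) * h y) =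
      fun y => ((y - x₀ : ℝ) : 𝕜) * iteratedDeriv (n + 1) h y + (n + 1) * iteratedDeriv n h y := by
  have hd (m : ℕ) (y : ℝ) : HasDerivAt (iteratedDeriv m h) (iteratedDeriv (m + 1) h y) y := by
    rw [iteratedDeriv_succ]
    exact (hh.differentiable_iteratedDeriv m (by exact_mod_cast WithTop.coe_lt_top _) y).hasDerivAt
  induction n with
  | zero =>
    funext y
    rw [iteratedDeriv_one]
    refine ((hasDerivAt_ofReal_sub x₀ y).mul (hd 0 y)).deriv.trans ?_
    push_cast
    ring
  | succ n ih =>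
    rw [iteratedDeriv_succ, ih]
    funext y
    refine (((hasDerivAt_ofReal_sub x₀ y).mul (hd (n + 1) y)).add
      ((hd n y).const_mul ((n : 𝕜) + 1))).deriv.trans ?_
    push_cast
    ring

/-- The constant is `(m + j)! / m!`, but only its being nonzero is used. -/
theorem iteratedDeriv_monomialAt_mul (x₀ : ℝ) (m j : ℕ) :
    ∃ c : 𝕜, c ≠ 0 ∧ ∀ q : ℝ → 𝕜, ContDiff ℝ ∞ q →
      iteratedDeriv (m + j) (fun y => monomialAt x₀ j y * q y) x₀ = c * iteratedDeriv m q x₀ := by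
  induction j with
  | zero => exact ⟨1, one_ne_zero, fun q _ => by simp [monomialAt]⟩
  | succ j ih =>
    obtain ⟨c, hc, h⟩ := ih
    refine ⟨((m + j : ℕ) + 1) * c, mul_ne_zero (Nat.cast_add_one_ne_zero _) hc, fun q hq => ?_⟩
    have : (fun y => monomialAt x₀ (j + 1) y * q y) =
        fun y => ((y - x₀ : ℝ) : 𝕜) * (monomialAt x₀ j y * q y) := by
      funext y
      simp only [monomialAt]
      ring
    rw [this, ← add_assoc,
      iteratedDeriv_succ_linear_mul ((contDiff_monomialAt x₀ j).mul hq)]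
    simp only [sub_self, map_zero, zero_mul, zero_add]
    rw [h q hq, mul_assoc]

theorem eq_zero_of_eventually_exp_eq_one {z : 𝕜}
    (h : ∀ᶠ t : ℝ in 𝓝 0, NormedSpace.exp (z * (t : 𝕜)) = 1) : z = 0 := by
  have h1 : HasDerivAt (fun t : ℝ => NormedSpace.exp (t • z)) z 0 := by
    simpa using hasDerivAt_exp_smul_const (𝕂 := ℝ) z (0 : ℝ)
  have h2 : (fun t : ℝ => NormedSpace.exp (t • z)) =ᶠ[𝓝 0] fun _ => (1 : 𝕜) := by
    filter_upwards [h] with t ht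
    rw [RCLike.real_smul_eq_coe_mul, mul_comm, ht]
  exact h1.unique ((hasDerivAt_const (0 : ℝ) (1 : 𝕜)).congr_of_eventuallyEq h2)

variable {lam mu : 𝕜} {B : DiffOp 𝕜 circle k} {x₀ : ℝ}

theorem deriv_eventuallyEq_of_perturbation {f : OrientedDiffeo circle} {ε : ℝ} {n : ℕ}
    (hf : (f : ℝ → ℝ) =ᶠ[𝓝 x₀] fun x => x + ε * (x - x₀) ^ (n + 1)) :
    deriv f =ᶠ[𝓝 x₀] fun x => 1 + (n + 1) * ε * (x - x₀) ^ n := by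
  filter_upwards [eventually_eventually_nhds.2 hf] with y hy
  have h1 : HasDerivAt (fun x => x + ε * (x - x₀) ^ (n + 1))
      (1 + ε * (((n + 1 : ℕ) : ℝ) * (y - x₀) ^ n * 1)) y :=
    (hasDerivAt_id y).add ((((hasDerivAt_id y).sub_const x₀).pow (n + 1)).const_mul ε)
  have hy' : (f : ℝ → ℝ) =ᶠ[𝓝 y] fun x => x + ε * (x - x₀) ^ (n + 1) := hy
  rw [hy'.deriv_eq, h1.deriv]
  push_cast
  ring

/-- The weights are related by an invariant operator, by its invariance under dilations. -/
theorem weight_eq_add_of_invariant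
    (h : ∃ ε₀ > 0, ∀ ε, |ε| < ε₀ → ∃ f : OrientedDiffeo circle,
      ((f : ℝ → ℝ) =ᶠ[𝓝 x₀] fun x => x + ε * (x - x₀) ^ 1) ∧ opAction k lam mu f B = B)
    {i : ℕ} (hi : (coef B i).1 x₀ ≠ 0) : mu = lam + i := by
  obtain ⟨ε₀, hε₀, h⟩ := h
  suffices lam + i - mu = 0 by linear_combination -this
  refine eq_zero_of_eventually_exp_eq_one ?_
  have hc : Tendsto (fun t : ℝ => |Real.exp t - 1|) (𝓝 0) (𝓝 0) := by
    have : Continuous fun t : ℝ => |Real.exp t - 1| := by fun_prop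
    simpa using this.tendsto 0
  filter_upwards [hc.eventually (Iio_mem_nhds hε₀)] with t ht
  -- Dilations are parametrized by their logarithm `t`, so that `(f')^w = exp (w t)` near `x₀`.
  -- Testing on the monomial of degree `i` compares `exp ((lam + i) t)` with `exp (mu t)`.
  obtain ⟨f, hf, hfB⟩ := h (Real.exp t - 1) ht
  have hd := deriv_eventuallyEq_of_perturbation (n := 0) hf
  have hjac (w : 𝕜) : (jacobianPow w f).1 =ᶠ[𝓝 x₀] fun _ => NormedSpace.exp (w * (t : 𝕜)) := by
    filter_upwards [hd] with y hy
    change NormedSpace.exp (w * (Real.log (deriv f y) : 𝕜)) = _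
    rw [hy]
    simp
  have h1 := evalAt_opAction lam mu f B (contDiff_monomialAt x₀ i) x₀
  have hfx : f x₀ = x₀ := by rw [hf.self_of_nhds]; simp
  have h2 : (fun y => (jacobianPow lam f).1 y * monomialAt (𝕜 := 𝕜) x₀ i (f y)) =ᶠ[𝓝 x₀]
      fun y => (NormedSpace.exp (lam * (t : 𝕜)) * (Real.exp t : 𝕜) ^ i) * monomialAt x₀ i y := by
    filter_upwards [hjac lam, hf] with y hy hy'
    rw [hy, hy', monomialAt, monomialAt, mul_assoc, ← mul_pow, ← RCLike.ofReal_mul]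
    congr 4
    ring
  have h3 (c : 𝕜) : evalAt B (fun y => c * monomialAt x₀ i y) x₀ =
      c * evalAt B (monomialAt x₀ i) x₀ := by
    rw [evalAt, evalAt, Finset.mul_sum]
    refine Finset.sum_congr rfl fun m _ => ?_
    rw [iteratedDeriv_const_mul_field]
    ring
  rw [hfB, hfx, evalAt_congr B h2, h3, (hjac mu).self_of_nhds, evalAt_monomialAt] at h1
  have h4 := mul_right_cancel₀ (mul_ne_zero hi (Nat.cast_ne_zero.2 i.factorial_ne_zero)) h1
  have h5 : (Real.exp t : 𝕜) ^ i = NormedSpace.exp ((i : 𝕜) * (t : 𝕜)) := by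
    rw [← RCLike.ofReal_pow, ← Real.exp_nat_mul]
    have : (i : 𝕜) * (t : 𝕜) = ((i * t : ℝ) : 𝕜) := by push_cast; rfl
    rw [this, Real.exp_eq_exp_ℝ]
    exact NormedSpace.algebraMap_exp_comm (𝕂 := ℝ) (𝔸 := 𝕜) _
  rw [h5, ← NormedSpace.exp_add] at h4
  rw [show (lam + i - mu) * (t : 𝕜) = (lam * t + i * t) + -(mu * t) by ring, NormedSpace.exp_add,
    h4, ← NormedSpace.exp_add, add_neg_cancel, NormedSpace.exp_zero]

/-- Invariance is tested on `(y - x₀)^j`. Its pull-back is `(y - x₀)^j` times the function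
differentiated here, and the only coefficient of `B` at `x₀`, of order `n + j`, sees a nonzero
multiple of the `n`-th derivative of that factor. The other side vanishes because `B` has no
coefficient of order `j` at `x₀`. -/
theorem iteratedDeriv_eq_zero_of_invariant {n : ℕ} (hn : n ≠ 0) {f : OrientedDiffeo circle} {ε : ℝ}
    (hf : (f : ℝ → ℝ) =ᶠ[𝓝 x₀] fun x => x + ε * (x - x₀) ^ (n + 1))
    (hfB : opAction k lam mu f B = B) {j : ℕ} (hj : (coef B (n + j)).1 x₀ ≠ 0)
    (hB : ∀ m ≠ n + j, (coef B m).1 x₀ = 0) :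
    iteratedDeriv n (fun y => (jacobianPow lam f).1 y * ((1 + ε * (y - x₀) ^ n : ℝ) : 𝕜) ^ j) x₀
      = 0 := by
  have h1 := evalAt_opAction lam mu f B (contDiff_monomialAt x₀ j) x₀
  have hfx : f x₀ = x₀ := by rw [hf.self_of_nhds]; simp
  have h2 : (fun y => (jacobianPow lam f).1 y * monomialAt (𝕜 := 𝕜) x₀ j (f y)) =ᶠ[𝓝 x₀]
      fun y => monomialAt x₀ j y *
        ((jacobianPow lam f).1 y * ((1 + ε * (y - x₀) ^ n : ℝ) : 𝕜) ^ j) := by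
    filter_upwards [hf] with y hy
    rw [hy, monomialAt, monomialAt, mul_left_comm, ← mul_pow, ← RCLike.ofReal_mul]
    congr 3
    ring
  obtain ⟨c, hc, hder⟩ := iteratedDeriv_monomialAt_mul (𝕜 := 𝕜) x₀ n j
  have hle : n + j ≤ k := by
    by_contra hlt
    rw [coef_of_lt _ (not_le.1 hlt)] at hj
    exact hj rfl
  rw [hfB, hfx, evalAt_congr B h2, evalAt_monomialAt, hB j (by omega), zero_mul, mul_zero, evalAt,
    Finset.sum_eq_single (n + j), hder, mul_eq_zero, mul_eq_zero] at h1
  · exact (h1.resolve_left hj).resolve_left hc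
  · exact (jacobianPow lam f).2.1.mul ((contDiff_ofReal_comp (by fun_prop)).pow j)
  · intro m _ hm
    rw [hB m hm, zero_mul]
  · intro h
    exact absurd (Finset.mem_range.2 (Nat.lt_succ_of_le hle)) h

/-- The function through which the jet of the transformed monomial is computed. -/
def jetFun (lam : 𝕜) (c ε : ℝ) (j : ℕ) (t : ℝ) : 𝕜 :=
  NormedSpace.exp (lam * (Real.log (1 + c * ε * t) : 𝕜)) * ((1 + ε * t : ℝ) : 𝕜) ^ j

theorem contDiffAt_jetFun (lam : 𝕜) (c ε : ℝ) (j : ℕ) : ContDiffAt ℝ ∞ (jetFun lam c ε j) 0 := by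
  have h1 : ContDiffAt ℝ ∞ (fun t : ℝ => Real.log (1 + c * ε * t)) 0 :=
    ContDiffAt.log (by fun_prop) (by simp)
  have h2 : ContDiffAt ℝ ∞ (fun t : ℝ => lam * (Real.log (1 + c * ε * t) : 𝕜)) 0 :=
    contDiffAt_const.mul ((RCLike.ofRealCLM (K := 𝕜)).contDiff.contDiffAt.comp 0 h1)
  have he : ContDiff ℝ ∞ (NormedSpace.exp : 𝕜 → 𝕜) :=
    contDiff_iff_contDiffAt.2 fun x => (NormedSpace.exp_analytic (𝕂 := ℝ) x).contDiffAt
  exact (he.contDiffAt.comp 0 h2).mul ((contDiff_ofReal_comp (by fun_prop)).pow j).contDiffAt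

theorem deriv_jetFun (lam : 𝕜) (c ε : ℝ) (j : ℕ) :
    deriv (jetFun lam c ε j) 0 = (c * lam + j) * ε := by
  have h0 : HasDerivAt (fun t : ℝ => 1 + c * ε * t) (c * ε) 0 := by
    simpa using ((hasDerivAt_id (0 : ℝ)).const_mul (c * ε)).const_add 1
  have h0' : HasDerivAt (fun t : ℝ => 1 + ε * t) ε 0 := by
    simpa using ((hasDerivAt_id (0 : ℝ)).const_mul ε).const_add 1
  have h1 : HasDerivAt (fun t : ℝ => Real.log (1 + c * ε * t)) (c * ε) 0 := by
    simpa using h0.log (by simp)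
  have h2 : HasDerivAt (fun t : ℝ => lam * (Real.log (1 + c * ε * t) : 𝕜)) (lam * (c * ε : ℝ)) 0 :=
    ((RCLike.ofRealCLM (K := 𝕜)).hasFDerivAt.comp_hasDerivAt 0 h1).const_mul lam
  have h3 : HasFDerivAt (NormedSpace.exp : 𝕜 → 𝕜) (1 : 𝕜 →L[𝕜] 𝕜)
      (lam * (Real.log (1 + c * ε * 0) : 𝕜)) := by
    simpa using hasFDerivAt_exp_zero (𝕂 := 𝕜) (𝔸 := 𝕜)
  have h4 : HasDerivAt (fun t : ℝ => NormedSpace.exp (lam * (Real.log (1 + c * ε * t) : 𝕜)))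
      (lam * (c * ε : ℝ)) 0 := by
    have := (h3.restrictScalars ℝ).comp_hasDerivAt (0 : ℝ) h2
    exact this
  have h5 : HasDerivAt (fun t : ℝ => ((1 + ε * t : ℝ) : 𝕜)) (ε : 𝕜) 0 :=
    (RCLike.ofRealCLM (K := 𝕜)).hasFDerivAt.comp_hasDerivAt 0 h0'
  refine (h4.mul (h5.pow j)).deriv.trans ?_
  simp
  ring

/-- Only the linear Taylor term of `r` contributes to order `n`. Quadratic and cubic perturbations
suffice, hence the restriction to two values of `n`. -/
theorem iteratedDeriv_comp_pow {r : ℝ → 𝕜} (hr : ContDiffAt ℝ ∞ r 0) {n : ℕ}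
    (hn : n = 1 ∨ n = 2) (x₀ : ℝ) :
    iteratedDeriv n (fun y => r ((y - x₀) ^ n)) x₀ = n.factorial * deriv r 0 := by
  have hin (y : ℝ) : HasDerivAt (fun y : ℝ => (y - x₀) ^ n) (n * (y - x₀) ^ (n - 1)) y := by
    exact (((hasDerivAt_id y).sub_const x₀).pow n).congr_deriv (by simp)
  have hc : Tendsto (fun y : ℝ => (y - x₀) ^ n) (𝓝 x₀) (𝓝 0) := by
    have : Continuous fun y : ℝ => (y - x₀) ^ n := by fun_prop
    have h0 : n ≠ 0 := by omega
    simpa [h0] using this.tendsto x₀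
  have hdiff : ∀ᶠ t in 𝓝 (0 : ℝ), DifferentiableAt ℝ r t := by
    have := (hr.of_le (m := 1) (by exact_mod_cast le_top)).eventually (by simp)
    filter_upwards [this] with t ht using ht.differentiableAt (by simp)
  have hd : deriv (fun y => r ((y - x₀) ^ n)) =ᶠ[𝓝 x₀]
      fun y => ((n * (y - x₀) ^ (n - 1) : ℝ) : 𝕜) * deriv r ((y - x₀) ^ n) := by
    filter_upwards [hc.eventually hdiff] with y hy
    rw [← RCLike.real_smul_eq_coe_mul]
    exact (hy.hasDerivAt.scomp y (hin y)).deriv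
  rcases hn with rfl | rfl
  · rw [iteratedDeriv_one, hd.self_of_nhds]
    simp
  · rw [iteratedDeriv_succ, iteratedDeriv_one, hd.deriv_eq]
    have hdr : DifferentiableAt ℝ (deriv r) 0 := by
      have h1 : ContDiffAt ℝ 1 (fderiv ℝ r) 0 := hr.fderiv_right (by
        rw [one_add_one_eq_two]; exact WithTop.coe_le_coe.2 (le_top (a := (2 : ℕ∞))))
      have h2 : DifferentiableAt ℝ (fderiv ℝ r) 0 := h1.differentiableAt (by simp)
      exact h2.clm_apply (differentiableAt_const 1)
    have hdr' : HasDerivAt (deriv r) (deriv (deriv r) 0) ((x₀ - x₀) ^ 2) := by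
      simpa using hdr.hasDerivAt
    have hlin : HasDerivAt (fun y : ℝ => (((2 : ℕ) * (y - x₀) ^ (2 - 1) : ℝ) : 𝕜)) 2 x₀ := by
      have := (hasDerivAt_ofReal_sub (𝕜 := 𝕜) x₀ x₀).const_mul 2
      rw [mul_one] at this
      refine this.congr_of_eventuallyEq (Eventually.of_forall fun y => ?_)
      push_cast
      ring
    refine (hlin.mul (hdr'.scomp x₀ (hin x₀))).deriv.trans ?_
    simp

/-- Infinitesimally, the vector field `(x - x₀)^(n+1) d/dx` sends the `lam`-density `(x - x₀)^j` to
`((n + 1) lam + j) (x - x₀)^(n+j)`, which an invariant operator with a single coefficient of order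
`n + j` at `x₀` has to kill. -/
theorem weight_of_invariant {n : ℕ} (hn : n = 1 ∨ n = 2)
    (h : ∃ ε₀ > 0, ∀ ε, |ε| < ε₀ → ∃ f : OrientedDiffeo circle,
      ((f : ℝ → ℝ) =ᶠ[𝓝 x₀] fun x => x + ε * (x - x₀) ^ (n + 1)) ∧ opAction k lam mu f B = B)
    {j : ℕ} (hj : (coef B (n + j)).1 x₀ ≠ 0)
    (hB : ∀ m ≠ n + j, (coef B m).1 x₀ = 0) : (n + 1) * lam + j = 0 := by
  obtain ⟨ε₀, hε₀, h⟩ := h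
  obtain ⟨f, hf, hfB⟩ := h (ε₀ / 2) (by rw [abs_of_pos] <;> linarith)
  have h1 := iteratedDeriv_eq_zero_of_invariant (by omega) hf hfB hj hB
  have h2 : (fun y => (jacobianPow lam f).1 y * ((1 + ε₀ / 2 * (y - x₀) ^ n : ℝ) : 𝕜) ^ j) =ᶠ[𝓝 x₀]
      fun y => jetFun lam (n + 1) (ε₀ / 2) j ((y - x₀) ^ n) := by
    filter_upwards [deriv_eventuallyEq_of_perturbation hf] with y hy
    rw [jetFun, ← hy]
    rfl
  rw [h2.iteratedDeriv_eq, iteratedDeriv_comp_pow (contDiffAt_jetFun _ _ _ _) hn, deriv_jetFun,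
    mul_eq_zero, mul_eq_zero] at h1
  have h3 := (h1.resolve_left (Nat.cast_ne_zero.2 n.factorial_ne_zero)).resolve_right (by
    intro h0
    rw [RCLike.ofReal_eq_zero] at h0
    linarith)
  push_cast at h3
  exact h3

/-- On the circle, every symmetry is local when the weights are distinct and differ from those of
the differential of functions. -/
theorem isLocal_of_mem_symmetries_circle_of_ne {T : Module.End 𝕜 (DiffOp 𝕜 circle k)}
    (hT : T ∈ Symmetries circle k lam mu) (hne : lam ≠ mu) (h01 : (lam, mu) ≠ (0, 1)) :
    IsLocal T := by
  refine isLocal_iff.2 fun A x₀ hA i => ?_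
  have hA' : ∀ᶠ y in 𝓝 x₀, ∀ i, (coef A i).1 y = 0 := by
    filter_upwards [hA] with y hy i
    rw [hy, map_zero]
    rfl
  have hinv (n : ℕ) := exists_perturbation_opAction_eq hT hA'
    (G := fun x => (x - x₀) ^ (n + 1)) (by fun_prop)
  by_contra hi
  have hw {m : ℕ} (hm : (coef (T A) m).1 x₀ ≠ 0) := weight_eq_add_of_invariant (hinv 0) hm
  have hothers : ∀ m ≠ i, (coef (T A) m).1 x₀ = 0 := fun m hm => by
    by_contra h
    have := (hw h).symm.trans (hw hi)
    exact hm (Nat.cast_injective (add_left_cancel this))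
  rcases i with _ | i
  · refine hne ?_
    rw [hw hi]
    simp
  · have h1 := weight_of_invariant (Or.inl rfl) (hinv 1) (j := i) (by rwa [add_comm])
      (by rwa [add_comm])
    rcases i with _ | i
    -- Order one gives exactly the excluded weights of the differential.
    · have h0 : lam = 0 := by
        push_cast at h1
        linear_combination h1 / 2
      refine h01 (Prod.ext h0 ?_)
      rw [hw hi, h0]
      simp
    · have h2 := weight_of_invariant (Or.inr rfl) (hinv 2) (j := i)
        (by rwa [add_comm]) (by rwa [add_comm])
      push_cast at h1 h2
      -- In order `i + 2` the quadratic and cubic perturbations give `2 lam + i + 1 = 0` and `3 lam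
      -- + i = 0`; eliminating `lam` leaves `i + 3 = 0`.
      have : ((i + 3 : ℕ) : 𝕜) = 0 := by
        push_cast
        linear_combination 3 * h1 - 2 * h2
      exact Nat.cast_ne_zero.2 (by omega) this

end Weights

/-! ### Transformation of the principal symbol -/

section Symbols

variable {k : ℕ}

theorem mem_diffOp_iff {A : DiffOp 𝕜 P k} {n : ℕ} :
    A.1 ∈ DiffOp 𝕜 P n ↔ ∀ i, n < i → coef A i = 0 := by
  constructor
  · rintro ⟨a, ha⟩ i hi
    rcases le_or_gt i k with hik | hik
    · rw [coef_eq_of_eq_sum (a := fun i => if i ≤ n then a i else 0) _ hik, if_neg hi.not_ge]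
      rw [ha, ← Finset.sum_subset (Finset.range_mono (show n + 1 ≤ k + 1 by omega))]
      · refine Finset.sum_congr rfl fun j hj => ?_
        rw [if_pos (Nat.lt_succ_iff.1 (Finset.mem_range.1 hj))]
      · intro j _ hj
        rw [if_neg (fun h => hj (Finset.mem_range.2 (Nat.lt_succ_of_le h)))]
        simp
    · exact coef_of_lt A hik
  · intro h
    rw [eq_sum_coef A]
    refine Submodule.sum_mem _ fun i _ => ?_
    rcases le_or_gt i n with hi | hi
    · exact mulOp_mul_D_pow_mem hi _
    · rw [h i hi]
      simp

theorem coef_opAction_of_order_lt (lam mu : 𝕜) (f : OrientedDiffeo P) {A : DiffOp 𝕜 P k} {n : ℕ}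
    (hA : ∀ i, n < i → coef A i = 0) {i : ℕ} (hi : n < i) :
    coef (opAction k lam mu f A) i = 0 :=
  mem_diffOp_iff.1 (pullback_mul_mul_pullback_mem lam mu f (mem_diffOp_iff.2 hA)) i hi

/-- As `z` vanishes at `x`, the product vanishes to order `j` there, with leading Taylor coefficient
`w(x) z'(x)^j`. -/
theorem iteratedDeriv_pow_mul {z : ℝ → 𝕜} (hz : ContDiff ℝ ∞ z) {x : ℝ} (hzx : z x = 0) (j i : ℕ)
    (hij : i ≤ j) {w : ℝ → 𝕜} (hw : ContDiff ℝ ∞ w) :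
    iteratedDeriv i (fun y => w y * z y ^ j) x =
      if i = j then j.factorial * deriv z x ^ j * w x else 0 := by
  induction j generalizing i w with
  | zero =>
    obtain rfl : i = 0 := by omega
    simp
  | succ j ih =>
    rcases i with _ | i
    · simp [hzx]
    · rw [iteratedDeriv_succ']
      have hd : deriv (fun y => w y * z y ^ (j + 1)) =
          fun y => (deriv w y * z y + w y * ((j + 1 : ℕ) * deriv z y)) * z y ^ j := by
        funext y
        have h1 := ((hw.differentiable (by simp)) y).hasDerivAt
        have h2 := ((hz.differentiable (by simp)) y).hasDerivAt
        refine (h1.mul (h2.pow (j + 1))).deriv.trans ?_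
        simp
        ring
      rw [hd, ih i (by omega)]
      · simp only [hzx, Nat.factorial_succ, add_left_inj]
        split_ifs
        · push_cast
          ring
        · rfl
      · exact ((contDiff_infty_iff_deriv.1 hw).2.mul hz).add
          (hw.mul (contDiff_const.mul (contDiff_infty_iff_deriv.1 hz).2))

theorem jacobianPow_add_apply (v w : 𝕜) (f : OrientedDiffeo P) (x : ℝ) :
    (jacobianPow (v + w) f).1 x = (jacobianPow v f).1 x * (jacobianPow w f).1 x := by
  change NormedSpace.exp ((v + w) * (Real.log (deriv f x) : 𝕜)) =
    NormedSpace.exp (v * (Real.log (deriv f x) : 𝕜)) *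
    NormedSpace.exp (w * (Real.log (deriv f x) : 𝕜))
  rw [← NormedSpace.exp_add, add_mul]

theorem exp_ofReal (t : ℝ) : NormedSpace.exp (t : 𝕜) = (Real.exp t : 𝕜) := by
  rw [Real.exp_eq_exp_ℝ]
  exact (NormedSpace.algebraMap_exp_comm (𝕂 := ℝ) (𝔸 := 𝕜) t).symm

theorem jacobianPow_ofReal_apply (r : ℝ) (f : OrientedDiffeo P) (x : ℝ) :
    (jacobianPow (r : 𝕜) f).1 x = ((deriv f x ^ r : ℝ) : 𝕜) := by
  change NormedSpace.exp ((r : 𝕜) * (Real.log (deriv f x) : 𝕜)) = _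
  rw [← RCLike.ofReal_mul, exp_ofReal, Real.rpow_def_of_pos (f.deriv_pos x), mul_comm]

/-- The symbol of a differential operator is a density. -/
theorem coef_opAction_symbol (lam mu : 𝕜) (f : OrientedDiffeo P) {A : DiffOp 𝕜 P k} {n : ℕ}
    (hA : ∀ i, n < i → coef A i = 0) (x : ℝ) :
    (coef (opAction k lam mu f A) n).1 x =
      (jacobianPow (mu - lam - n) f).1 x * (coef A n).1 (f x) := by
  rcases le_or_gt n k with hn | hn
  swap
  · rw [coef_of_lt _ hn, coef_of_lt _ hn]
    exact (mul_zero _).symm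
  -- On the monomial of degree `n` centred at `f x` only the term of order `n` survives: the
  -- pull-back vanishes to order `n` at `x`, and the action does not raise the order.
  have h1 := evalAt_opAction lam mu f A (contDiff_monomialAt (f x) n) x
  have hz : ContDiff ℝ ∞ fun y => ((f y - f x : ℝ) : 𝕜) :=
    contDiff_ofReal_comp (f.smooth.sub contDiff_const)
  have hdz : deriv (fun y => ((f y - f x : ℝ) : 𝕜)) x = ((deriv f x : ℝ) : 𝕜) :=
    ((RCLike.ofRealCLM (K := 𝕜)).hasFDerivAt.comp_hasDerivAt x
      ((f.differentiable x).hasDerivAt.sub_const (f x))).deriv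
  have hder := fun i hi => iteratedDeriv_pow_mul hz (x := x) (by simp) n i hi
    (jacobianPow lam f).2.1
  rw [evalAt_monomialAt, evalAt, Finset.sum_eq_single n] at h1
  · have h2 := hder n le_rfl
    rw [if_pos rfl, hdz] at h2
    change (coef (opAction k lam mu f A) n).1 x * iteratedDeriv n (fun y =>
      (jacobianPow lam f).1 y * ((f y - f x : ℝ) : 𝕜) ^ n) x = _ at h1
    rw [h2] at h1
    have h3 : ((deriv f x : ℝ) : 𝕜) ^ n = (jacobianPow (n : 𝕜) f).1 x := by
      have := jacobianPow_ofReal_apply (𝕜 := 𝕜) n f x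
      rw [Real.rpow_natCast] at this
      rw [← RCLike.ofReal_pow, ← this]
      push_cast
      rfl
    rw [h3] at h1
    have h4 : (jacobianPow mu f).1 x = (jacobianPow (mu - lam - n) f).1 x *
        ((jacobianPow lam f).1 x * (jacobianPow (n : 𝕜) f).1 x) := by
      rw [← jacobianPow_add_apply, ← jacobianPow_add_apply,
        show mu - lam - (n : 𝕜) + (lam + n) = mu by ring]
    rw [h4] at h1
    have h5 := jacobianPow_pos_ne lam f x
    have h6 := jacobianPow_pos_ne (n : 𝕜) f x
    have h7 : (n.factorial : 𝕜) ≠ 0 := Nat.cast_ne_zero.2 n.factorial_ne_zero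
    refine mul_right_cancel₀ (mul_ne_zero (mul_ne_zero h5 h6) h7) ?_
    linear_combination h1
  · intro i hi hin
    rcases lt_or_gt_of_ne hin with h | h
    · have h2 := hder i h.le
      rw [if_neg hin] at h2
      change _ * iteratedDeriv i (fun y =>
        (jacobianPow lam f).1 y * ((f y - f x : ℝ) : 𝕜) ^ n) x = _
      rw [h2, mul_zero]
    · rw [coef_opAction_of_order_lt lam mu f hA h]
      exact zero_mul _
  · intro h
    exact absurd (Finset.mem_range.2 (Nat.lt_succ_of_le hn)) h

end Symbols

/-! ### Integrals of negative powers -/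

section Convexity

/-- Two positive numbers with product `(1 - t²)^(-r) > 1` have a sum larger than two. -/
theorem two_lt_rpow_add_rpow {r t : ℝ} (hr : 0 < r) (ht : |t| ≤ 1 / 2) (ht0 : t ≠ 0) :
    2 < (1 + t) ^ (-r) + (1 - t) ^ (-r) := by
  have h := abs_le.1 ht
  have h1 : 0 < (1 + t) ^ (-r) := Real.rpow_pos_of_pos (by linarith) _
  have h2 : 0 < (1 - t) ^ (-r) := Real.rpow_pos_of_pos (by linarith) _
  have h3 : 1 < (1 + t) ^ (-r) * (1 - t) ^ (-r) := by
    rw [← Real.mul_rpow (by linarith) (by linarith)]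
    refine Real.one_lt_rpow_of_pos_of_lt_one_of_neg (by nlinarith) ?_ (by linarith)
    have : 0 < t ^ 2 := by positivity
    nlinarith
  nlinarith [sq_nonneg ((1 + t) ^ (-r) - (1 - t) ^ (-r))]

theorem continuous_one_add_rpow {γ : ℝ → ℝ} (hγ : Continuous γ) (hb : ∀ x, |γ x| ≤ 1 / 2) (r : ℝ) :
    Continuous fun x => (1 + γ x) ^ (-r) :=
  Continuous.rpow_const (by fun_prop) fun x => Or.inl (by linarith [(abs_le.1 (hb x)).1])

theorem two_lt_integral_rpow_add {r : ℝ} (hr : 0 < r) {γ : ℝ → ℝ} (hγ : Continuous γ)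
    (hb : ∀ x, |γ x| ≤ 1 / 2) {x₁ : ℝ} (hx₁ : x₁ ∈ Set.Icc (0 : ℝ) 1) (h1 : γ x₁ ≠ 0) :
    2 < (∫ x in (0 : ℝ)..1, (1 + γ x) ^ (-r)) + ∫ x in (0 : ℝ)..1, (1 - γ x) ^ (-r) := by
  have hc1 := continuous_one_add_rpow hγ hb r
  have hc2 : Continuous fun x => (1 - γ x) ^ (-r) := by
    simpa [sub_eq_add_neg] using continuous_one_add_rpow hγ.neg (by simpa using hb) r
  rw [← intervalIntegral.integral_add (hc1.intervalIntegrable _ _) (hc2.intervalIntegrable _ _)]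
  have h2 : ∫ _ in (0 : ℝ)..1, (2 : ℝ) = 2 := by simp
  have h3 := intervalIntegral.integral_lt_integral_of_continuousOn_of_le_of_exists_lt one_pos
    continuousOn_const (hc1.add hc2).continuousOn
    (fun x _ => ?_) ⟨x₁, hx₁, two_lt_rpow_add_rpow hr (hb x₁) h1⟩
  · rwa [h2] at h3
  · by_cases hx : γ x = 0
    · simp [hx]
      norm_num
    · exact (two_lt_rpow_add_rpow hr (hb x) hx).le

/-- For small `β` there is a multiple `s ψ` of the bump function `ψ` such that the integral of
`(1 + β + s ψ)^(-r)` over a period is one. -/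
theorem exists_integral_rpow_eq_one {r : ℝ} (hr : 0 < r) {β ψ : ℝ → ℝ} (hβ : Continuous β)
    (hβb : ∀ x, |β x| ≤ 1) (hψ : Continuous ψ) (hψ0 : ∀ x, 0 ≤ ψ x) (hψ1 : ∀ x, ψ x ≤ 1 / 4)
    {x₁ : ℝ} (hx₁ : x₁ ∈ Set.Icc (0 : ℝ) 1) (h1 : ψ x₁ ≠ 0) :
    ∃ ε₀ > 0, ∀ ε, |ε| < ε₀ → ∃ s : ℝ, (∀ x, |ε * β x + s * ψ x| ≤ 1 / 2) ∧
      ∫ x in (0 : ℝ)..1, (1 + (ε * β x + s * ψ x)) ^ (-r) = 1 := by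
  -- The maximum with `1 / 4` keeps the base positive, so that `Φ` is continuous on the whole plane;
  -- it is inactive for the small parameters that matter.
  set Φ : ℝ → ℝ → ℝ := fun ε s =>
    ∫ x in (0 : ℝ)..1, (max (1 / 4) (1 + (ε * β x + s * ψ x))) ^ (-r) with hΦ
  have hΦc : Continuous fun q : ℝ × ℝ => Φ q.1 q.2 := by
    refine intervalIntegral.continuous_parametric_intervalIntegral_of_continuous' ?_ 0 1
    refine Continuous.rpow_const ?_ fun q => Or.inl ?_
    · fun_prop
    · exact (lt_of_lt_of_le (by norm_num) (le_max_left _ _)).ne'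
  have hbound {ε s : ℝ} (hε : |ε| ≤ 1 / 4) (hs : |s| ≤ 1) (x : ℝ) :
      |ε * β x + s * ψ x| ≤ 1 / 2 := by
    have h1 : |ε * β x| ≤ 1 / 4 := by
      rw [abs_mul]
      calc |ε| * |β x| ≤ 1 / 4 * 1 := mul_le_mul hε (hβb x) (abs_nonneg _) (by norm_num)
        _ = 1 / 4 := mul_one _
    have h2 : |s * ψ x| ≤ 1 / 4 := by
      rw [abs_mul, abs_of_nonneg (hψ0 x)]
      calc |s| * ψ x ≤ 1 * (1 / 4) := mul_le_mul hs (hψ1 x) (hψ0 x) (by norm_num)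
        _ = 1 / 4 := one_mul _
    exact (abs_add_le _ _).trans (by linarith)
  have hΦeq {ε s : ℝ} (hε : |ε| ≤ 1 / 4) (hs : |s| ≤ 1) :
      Φ ε s = ∫ x in (0 : ℝ)..1, (1 + (ε * β x + s * ψ x)) ^ (-r) := by
    simp only [hΦ]
    congr 1
    funext x
    rw [max_eq_right]
    linarith [(abs_le.1 (hbound hε hs x)).1]
  have hcont {s : ℝ} (hs : |s| ≤ 1) : Continuous fun x => (1 + (0 * β x + s * ψ x)) ^ (-r) :=
    continuous_one_add_rpow (by fun_prop) (hbound (by norm_num) hs) r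
  have hone : ∫ _ in (0 : ℝ)..1, (1 : ℝ) = 1 := by simp
  have hlt : Φ 0 1 < 1 := by
    rw [hΦeq (by norm_num) (by norm_num)]
    refine (intervalIntegral.integral_lt_integral_of_continuousOn_of_le_of_exists_lt one_pos
      (hcont (by norm_num)).continuousOn continuousOn_const (fun x _ => ?_)
      ⟨x₁, hx₁, ?_⟩).trans_eq hone
    · refine Real.rpow_le_one_of_one_le_of_nonpos ?_ (by linarith)
      linarith [hψ0 x]
    · refine Real.rpow_lt_one_of_one_lt_of_neg ?_ (by linarith)
      linarith [(hψ0 x₁).lt_of_ne' h1]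
  have hgt : 1 < Φ 0 (-1) := by
    rw [hΦeq (by norm_num) (by norm_num)]
    refine hone.symm.trans_lt
      (intervalIntegral.integral_lt_integral_of_continuousOn_of_le_of_exists_lt one_pos
      continuousOn_const (hcont (by norm_num)).continuousOn (fun x _ => ?_) ⟨x₁, hx₁, ?_⟩)
    · refine Real.one_le_rpow_of_pos_of_le_one_of_nonpos ?_ ?_ (by linarith)
      · linarith [hψ1 x]
      · linarith [hψ0 x]
    · refine Real.one_lt_rpow_of_pos_of_lt_one_of_neg ?_ ?_ (by linarith)
      · linarith [hψ1 x₁]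
      · linarith [(hψ0 x₁).lt_of_ne' h1]
  have hev (s : ℝ) : Continuous fun ε => Φ ε s := hΦc.comp (continuous_id.prodMk continuous_const)
  have hev1 := ((hev 1).tendsto 0).eventually (Iio_mem_nhds hlt)
  have hev2 := ((hev (-1)).tendsto 0).eventually (Ioi_mem_nhds hgt)
  obtain ⟨ε₀, hε₀, hball⟩ := Metric.eventually_nhds_iff.1 (hev1.and hev2)
  refine ⟨min ε₀ (1 / 4), by positivity, fun ε hε => ?_⟩
  have hε4 : |ε| ≤ 1 / 4 := hε.le.trans (min_le_right _ _)
  obtain ⟨h3, h4⟩ := hball (y := ε) (by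
    rw [Real.dist_eq, sub_zero]
    exact hε.trans_le (min_le_left _ _))
  have hcs : Continuous fun s => Φ ε s := hΦc.comp (continuous_const.prodMk continuous_id)
  -- At `ε = 0` the integral is below one for `s = 1` and above one for `s = -1`; this persists for
  -- small `ε`, and an intermediate value of `s` gives exactly one.
  obtain ⟨s, hs, hs1⟩ := intermediate_value_Icc' (show (-1 : ℝ) ≤ 1 by norm_num) hcs.continuousOn
    ⟨le_of_lt h3, le_of_lt h4⟩
  have hs' : |s| ≤ 1 := abs_le.2 hs
  refine ⟨s, hbound hε4 hs', ?_⟩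
  rw [← hΦeq hε4 hs']
  exact hs1

end Convexity

/-! ### Densities vanishing near a point of the circle are coboundaries -/

section Coboundaries

variable (𝕜) in
/-- The densities of weight `-n` on the circle that are spanned by the differences between a density
and its image under a diffeomorphism that is the identity near `p`. -/
def coboundaries (n : ℕ) (p : ℝ) : Submodule 𝕜 (SmoothFun 𝕜 circle) :=
  Submodule.span 𝕜 {b | ∃ f : OrientedDiffeo circle, (f : ℝ → ℝ) =ᶠ[𝓝 p] id ∧
    ∃ a : SmoothFun 𝕜 circle, b = jacobianPow (-(n : 𝕜)) f * comp a f - a}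

variable (𝕜) in
/-- A real-valued function that is a coboundary. -/
def IsCoboundary (n : ℕ) (p : ℝ) (β : ℝ → ℝ) : Prop :=
  ∃ b ∈ coboundaries 𝕜 n p, ∀ x, b.1 x = (β x : 𝕜)

theorem IsCoboundary.add {n : ℕ} {p : ℝ} {β γ : ℝ → ℝ} (hβ : IsCoboundary 𝕜 n p β)
    (hγ : IsCoboundary 𝕜 n p γ) : IsCoboundary 𝕜 n p fun x => β x + γ x := by
  obtain ⟨b, hb, hb'⟩ := hβ
  obtain ⟨c, hc, hc'⟩ := hγ
  refine ⟨b + c, add_mem hb hc, fun x => ?_⟩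
  rw [RCLike.ofReal_add, ← hb', ← hc']
  rfl

theorem IsCoboundary.const_mul {n : ℕ} {p : ℝ} {β : ℝ → ℝ} (hβ : IsCoboundary 𝕜 n p β) (c : ℝ) :
    IsCoboundary 𝕜 n p fun x => c * β x := by
  obtain ⟨b, hb, hb'⟩ := hβ
  refine ⟨(c : 𝕜) • b, Submodule.smul_mem _ _ hb, fun x => ?_⟩
  rw [RCLike.ofReal_mul, ← hb']
  rfl

/-- Take the constant density `1`: the equation `(f')^(-n) - 1 = β` is solved by `f' = (1 +
β)^(-1/n)`, and the integral condition is what makes `f` a diffeomorphism of the circle. Near `p`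
one has `f' = 1`, so normalizing `f(p) = p` gives the identity there. -/
theorem isCoboundary_of_integral {n : ℕ} (hn : n ≠ 0) {p : ℝ} {β : ℝ → ℝ} (hβ : ContDiff ℝ ∞ β)
    (hper : Function.Periodic β 1) (hp : ∀ᶠ x in 𝓝 p, β x = 0) (hb : ∀ x, |β x| ≤ 1 / 2)
    (hint : ∫ x in (0 : ℝ)..1, (1 + β x) ^ (-(1 / n : ℝ)) = 1) : IsCoboundary 𝕜 n p β := by
  have hpos (x : ℝ) : 0 < 1 + β x := by linarith [(abs_le.1 (hb x)).1]
  obtain ⟨f, hfp, hf⟩ := exists_diffeo_of_deriv (P := circle)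
    (h := fun x => (1 + β x) ^ (-(1 / n : ℝ)))
    ((contDiff_const.add hβ).rpow_const_of_ne fun x => (hpos x).ne')
    (δ := (3 / 2) ^ (-(1 / n : ℝ))) (by positivity)
    (fun x => Real.rpow_le_rpow_of_nonpos (hpos x) (by linarith [(abs_le.1 (hb x)).2]) (by
      rw [neg_nonpos]; positivity))
    (fun x => by
      change (1 + β (x + 1)) ^ (-(1 / n : ℝ)) = _
      rw [hper]) hint p p
  refine ⟨jacobianPow (-(n : 𝕜)) f * comp 1 f - 1, Submodule.subset_span ⟨f, ?_, 1, rfl⟩,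
    fun x => ?_⟩
  · obtain ⟨η, hη, hball⟩ := Metric.eventually_nhds_iff_ball.1 hp
    have heq : Set.EqOn (f : ℝ → ℝ) id (Metric.ball p η) := by
      refine Metric.isOpen_ball.eqOn_of_deriv_eq (convex_ball p η).isPreconnected
        (fun x _ => (hf x).differentiableAt.differentiableWithinAt)
        differentiable_id.differentiableOn (fun x hx => ?_) (Metric.mem_ball_self hη) hfp
      rw [(hf x).deriv, hball x hx]
      simp
    filter_upwards [Metric.ball_mem_nhds p hη] with x hx using heq hx
  · change (jacobianPow (-(n : 𝕜)) f).1 x * 1 - 1 = _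
    have h1 := jacobianPow_ofReal_apply (𝕜 := 𝕜) (-(n : ℝ)) f x
    rw [(hf x).deriv, ← Real.rpow_mul (hpos x).le] at h1
    rw [show (-(1 / n : ℝ)) * -n = 1 by field_simp, Real.rpow_one] at h1
    rw [show (-(n : 𝕜)) = ((-(n : ℝ) : ℝ) : 𝕜) by push_cast; rfl, h1]
    push_cast
    ring

/-- The two values of `d` give two bumps away from `p`; the last clause ensures that the second one
vanishes at the centre of the first, which makes them linearly independent. -/
theorem exists_bump_away_from {p d : ℝ} (hd : d = 1 / 4 ∨ d = 1 / 2) :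
    ∃ χ : ℝ → ℝ, ContDiff ℝ ∞ χ ∧ Function.Periodic χ 1 ∧ (∀ x, 0 ≤ χ x) ∧ (∀ x, χ x ≤ 1) ∧
      χ (p + d) = 1 ∧ (∀ᶠ x in 𝓝 p, χ x = 0) ∧ (d = 1 / 2 → χ (p + 1 / 4) = 0) := by
  obtain ⟨χ, h1, h2, h3, h4, h5, h6⟩ := exists_periodic_bump (p + d) (show (0 : ℝ) < 1 / 8 by
    norm_num)
  refine ⟨χ, h1, h2, h3, h4, h5.self_of_nhds, ?_, ?_⟩
  · filter_upwards [Metric.ball_mem_nhds p (show (0 : ℝ) < 1 / 8 by norm_num)] with x hx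
    by_contra h
    obtain ⟨n, hn⟩ := h6 x h
    rw [Metric.mem_ball, Real.dist_eq] at hx
    have h7 := abs_lt.1 hx
    have h8 := abs_lt.1 hn
    have h9 : (-1 : ℝ) < n := by rcases hd with rfl | rfl <;> linarith
    have h10 : (n : ℝ) < 0 := by rcases hd with rfl | rfl <;> linarith
    have h11 : (-1 : ℤ) < n := by exact_mod_cast h9
    have h12 : n < 0 := by exact_mod_cast h10
    omega
  · rintro rfl
    by_contra h
    obtain ⟨n, hn⟩ := h6 _ h
    have h8 := abs_lt.1 hn
    have h9 : (-1 : ℝ) < n := by linarith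
    have h10 : (n : ℝ) < 0 := by linarith
    have h11 : (-1 : ℤ) < n := by exact_mod_cast h9
    have h12 : n < 0 := by exact_mod_cast h10
    omega

/-- For positive `n`, all functions that vanish near `p` are coboundaries. -/
theorem isCoboundary_of_pos {n : ℕ} (hn : n ≠ 0) {p : ℝ} {β : ℝ → ℝ} (hβ : ContDiff ℝ ∞ β)
    (hper : Function.Periodic β 1) (hp : ∀ᶠ x in 𝓝 p, β x = 0) : IsCoboundary 𝕜 n p β := by
  have hr : (0 : ℝ) < 1 / n := by positivity
  obtain ⟨χ, hχ, hχper, hχ0, hχ1, hχd, hχp, hχz⟩ := exists_bump_away_from (p := p) (Or.inr rfl)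
  set ψ : ℝ → ℝ := fun x => χ x / 4 with hψ
  have hψc : ContDiff ℝ ∞ ψ := hχ.div_const 4
  have hψper : Function.Periodic ψ 1 := fun x => by simp only [hψ, hχper x]
  have hψp : ∀ᶠ x in 𝓝 p, ψ x = 0 := hχp.mono fun x hx => by simp [hψ, hx]
  obtain ⟨x₁, hx₁, hx₁'⟩ := hψper.exists_mem_Ico₀ one_pos (p + 1 / 2)
  have hψ1 : ψ x₁ ≠ 0 := by
    rw [← hx₁']
    simp only [hψ]
    rw [hχd]
    norm_num
  have step {γ : ℝ → ℝ} (hγ : ContDiff ℝ ∞ γ) (hγper : Function.Periodic γ 1)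
      (hγp : ∀ᶠ x in 𝓝 p, γ x = 0) (hγb : ∀ x, |γ x| ≤ 1) :
      ∃ ε₀ > 0, ∀ ε, |ε| < ε₀ → ∃ s : ℝ, (∀ x, |ε * γ x + s * ψ x| ≤ 1 / 2) ∧
      ∫ x in (0 : ℝ)..1, (1 + (ε * γ x + s * ψ x)) ^ (-(1 / n : ℝ)) = 1 ∧
      IsCoboundary 𝕜 n p fun x => ε * γ x + s * ψ x := by
    obtain ⟨ε₀, hε₀, h⟩ := exists_integral_rpow_eq_one hr hγ.continuous hγb hψc.continuous
      (fun x => div_nonneg (hχ0 x) (by norm_num)) (fun x => by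
        have := hχ1 x
        simp only [hψ]
        linarith) ⟨hx₁.1, hx₁.2.le⟩ hψ1
    refine ⟨ε₀, hε₀, fun ε hε => ?_⟩
    obtain ⟨s, hs1, hs2⟩ := h ε hε
    refine ⟨s, hs1, hs2, isCoboundary_of_integral hn
      ((contDiff_const.mul hγ).add (contDiff_const.mul hψc)) (fun x => ?_) ?_ hs1 hs2⟩
    · simp only [hγper x, hψper x]
    · filter_upwards [hγp, hψp] with x h1 h2
      rw [h1, h2]
      ring
  -- Correcting `±(ε₀ / 2) γ` by multiples `s ψ` and `t ψ` and adding the results leaves `(s + t)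
  -- ψ`. If `s + t` were zero, then `σ` and `-σ` would both satisfy the integral condition, against
  -- strict convexity, since `σ` is nonzero at `p + 1 / 4`.
  have hψcob : IsCoboundary 𝕜 n p ψ := by
    obtain ⟨γ, hγ, hγper, hγ0, hγ1, hγd, hγp, -⟩ := exists_bump_away_from (p := p) (Or.inl rfl)
    obtain ⟨ε₀, hε₀, h⟩ := step hγ hγper hγp (fun x => by rw [abs_of_nonneg (hγ0 x)]; exact hγ1 x)
    obtain ⟨s, hs1, hs2, hs3⟩ := h (ε₀ / 2) (by rw [abs_of_pos] <;> linarith)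
    obtain ⟨t, ht1, ht2, ht3⟩ := h (-(ε₀ / 2)) (by rw [abs_neg, abs_of_pos] <;> linarith)
    have hst : s + t ≠ 0 := by
      intro h0
      obtain rfl : t = -s := by linarith
      set σ : ℝ → ℝ := fun x => ε₀ / 2 * γ x + s * ψ x with hσ
      have hσper : Function.Periodic σ 1 := fun x => by simp only [hσ, hγper x, hψper x]
      obtain ⟨x₂, hx₂, hx₂'⟩ := hσper.exists_mem_Ico₀ one_pos (p + 1 / 4)
      have hne : σ x₂ ≠ 0 := by
        rw [← hx₂']
        simp only [hσ, hψ, hχz, hγd]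
        simp [hε₀.ne']
      have h4 := two_lt_integral_rpow_add hr
        (((contDiff_const.mul hγ).add (contDiff_const.mul hψc)).continuous : Continuous σ)
        hs1 ⟨hx₂.1, hx₂.2.le⟩ hne
      have h5 : (fun x => (1 - σ x) ^ (-(1 / n : ℝ))) =
          fun x => (1 + (-(ε₀ / 2) * γ x + -s * ψ x)) ^ (-(1 / n : ℝ)) := by
        funext x
        congr 1
        simp only [hσ]
        ring
      rw [h5, ht2, hs2] at h4
      linarith
    have h6 := (hs3.add ht3).const_mul (1 / (s + t))
    have h7 : (fun x => 1 / (s + t) * (ε₀ / 2 * γ x + s * ψ x + (-(ε₀ / 2) * γ x + t * ψ x))) = ψ := by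
      funext x
      field_simp
      ring
    rwa [h7] at h6
  obtain ⟨M, hM0, hM⟩ := exists_abs_le_of_periodic hβ.continuous hper
  obtain ⟨ε₀, hε₀, h⟩ := step (γ := fun x => β x / M) (hβ.div_const M) (fun x => by simp only [hper x])
    (hp.mono fun x hx => by simp [hx]) (fun x => by
      rw [abs_div, abs_of_pos hM0, div_le_one hM0]
      exact hM x)
  obtain ⟨s, -, -, hs⟩ := h (ε₀ / 2) (by rw [abs_of_pos] <;> linarith)
  have h6 := (hs.add (hψcob.const_mul (-s))).const_mul (M / (ε₀ / 2))
  have h7 : (fun x => M / (ε₀ / 2) * (ε₀ / 2 * (β x / M) + s * ψ x + -s * ψ x)) = β := by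
    funext x
    field_simp
    ring
  rwa [h7] at h6

/-- All functions that vanish near `p` are coboundaries in weight zero. -/
theorem isCoboundary_zero {p : ℝ} {β : ℝ → ℝ} (hβ : ContDiff ℝ ∞ β)
    (hper : Function.Periodic β 1) (hp : ∀ᶠ x in 𝓝 p, β x = 0) : IsCoboundary 𝕜 0 p β := by
  obtain ⟨η', hη', hball'⟩ := Metric.eventually_nhds_iff_ball.1 hp
  set η := min η' (1 / 4) with hη
  have hη0 : 0 < η := lt_min hη' (by norm_num)
  have hball (x : ℝ) (hx : |x - p| < η) : β x = 0 :=
    hball' x (by rw [Metric.mem_ball, Real.dist_eq]; exact hx.trans_le (min_le_left _ _))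
  have hη4 : η ≤ 1 / 4 := min_le_right _ _
  -- The periodic function `a` is the coordinate `x` away from `p`, so `a ∘ f - a` is the
  -- displacement of `f`. The margins are such that points of the support of `β`, at distance at
  -- least `η` from `p + ℤ` and moved by at most `η / 2`, remain where `a` is the coordinate.
  obtain ⟨a, ha, haper, haeq, -, -⟩ := exists_periodic_eqOn_Icc (contDiff_id (E := ℝ)) p
    (η := η / 2) (by linarith) (by linarith)
  obtain ⟨ε₀, hε₀, hf⟩ := exists_diffeo_perturbation hβ hper
  obtain ⟨M, hM0, hM⟩ := exists_abs_le_of_periodic hβ.continuous hper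
  set ε := min (ε₀ / 2) (η / (2 * M)) with hε
  have hεpos : 0 < ε := lt_min (by linarith) (by positivity)
  obtain ⟨f, hf⟩ := hf ε (by
    rw [abs_of_pos hεpos]
    exact (min_le_left _ _).trans_lt (by linarith))
  have hsmall (x : ℝ) : |ε * β x| ≤ η / 2 := by
    rw [abs_mul, abs_of_pos hεpos]
    calc ε * |β x| ≤ η / (2 * M) * M :=
          mul_le_mul (min_le_right _ _) (hM x) (abs_nonneg _) (by positivity)
      _ = η / 2 := by field_simp
  have key (x : ℝ) : a (f x) - a x = ε * β x := by
    by_cases hx : β x = 0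
    · rw [hf, hx]
      simp
    · set n := ⌊x - p⌋ with hn
      have hβn : β (x - n) = β x := by
        have := hper.sub_int_mul_eq (x := x) n
        rwa [mul_one] at this
      have han (y : ℝ) : a (y - n) = a y := by
        have := haper.sub_int_mul_eq (x := y) n
        rwa [mul_one] at this
      have h1 : η ≤ x - n - p := by
        by_contra hlt
        refine hx ?_
        rw [← hβn, hball]
        rw [abs_lt]
        constructor <;> linarith [Int.floor_le (x - p)]
      have h2 : x - n - p ≤ 1 - η := by
        by_contra hlt
        refine hx ?_
        have h3 := hper (x - n - 1)
        rw [sub_add_cancel] at h3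
        rw [← hβn, h3, hball]
        rw [abs_lt]
        constructor <;> linarith [Int.lt_floor_add_one (x - p)]
      have h3 := abs_le.1 (hsmall x)
      rw [← han (f x), ← han x, hf, haeq ⟨by linarith, by linarith⟩,
        haeq ⟨by linarith, by linarith⟩]
      simp only [id]
      ring
  have hcob : IsCoboundary 𝕜 0 p fun x => ε * β x := by
    refine ⟨_, Submodule.subset_span ⟨f, ?_, ⟨fun x => (a x : 𝕜), contDiff_ofReal_comp ha,
      fun x => by simp only [haper x]⟩, rfl⟩, fun x => ?_⟩
    · filter_upwards [hp] with x hx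
      rw [hf, hx, mul_zero, add_zero]
      rfl
    · change (jacobianPow (-((0 : ℕ) : 𝕜)) f).1 x * (a (f x) : 𝕜) - (a x : 𝕜) = _
      have h0 : (jacobianPow (-((0 : ℕ) : 𝕜)) f).1 x = 1 := by
        have := jacobianPow_ofReal_apply (𝕜 := 𝕜) 0 f x
        simpa using this
      change _ = ((ε * β x : ℝ) : 𝕜)
      rw [h0, ← key]
      push_cast
      ring
  have h6 := hcob.const_mul (1 / ε)
  have h7 : (fun x => 1 / ε * (ε * β x)) = β := by
    funext x
    field_simp
  rwa [h7] at h6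

/-- The preceding constructions concern real functions; the real and imaginary parts of `b` are
treated separately. -/
theorem mem_coboundaries {n : ℕ} {p : ℝ} {b : SmoothFun 𝕜 circle} (hp : ∀ᶠ x in 𝓝 p, b.1 x = 0) :
    b ∈ coboundaries 𝕜 n p := by
  have h (β : ℝ → ℝ) (hβ : ContDiff ℝ ∞ β) (hper : Function.Periodic β 1)
      (hp : ∀ᶠ x in 𝓝 p, β x = 0) : IsCoboundary 𝕜 n p β := by
    rcases eq_or_ne n 0 with rfl | hn
    · exact isCoboundary_zero hβ hper hp
    · exact isCoboundary_of_pos hn hβ hper hp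
  obtain ⟨c, hc, hc'⟩ := h (fun x => RCLike.re (b.1 x)) ((RCLike.reCLM (K := 𝕜)).contDiff.comp b.2.1)
    (fun x => by
      have h2 : b.1 (x + 1) = b.1 x := b.2.2 x
      simp only [h2]) (hp.mono fun x hx => by simp [hx])
  obtain ⟨d, hd, hd'⟩ := h (fun x => RCLike.im (b.1 x)) ((RCLike.imCLM (K := 𝕜)).contDiff.comp b.2.1)
    (fun x => by
      have h2 : b.1 (x + 1) = b.1 x := b.2.2 x
      simp only [h2]) (hp.mono fun x hx => by simp [hx])
  have : b = c + (RCLike.I : 𝕜) • d := by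
    refine Subtype.ext <| funext fun x => ?_
    change b.1 x = c.1 x + RCLike.I * d.1 x
    rw [hc', hd', mul_comm]
    exact (RCLike.re_add_im _).symm
  rw [this]
  exact add_mem hc (Submodule.smul_mem _ _ hd)

end Coboundaries

/-! ### Locality on the circle for equal weights -/

section CircleLocality

variable {k : ℕ} {lam mu : 𝕜}

attribute [local instance] diffOpAddCommGroup

/-- A generator `f^*a - a` is the symbol of `f^*B - B` with `B = a dⁿ/dxⁿ`. As `f` is the identity
near `p`, both this operator and its image `f^*(T B) - T B` vanish at `p`. -/
theorem exists_coboundary_operator {T : Module.End 𝕜 (DiffOp 𝕜 circle k)}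
    (hT : T ∈ Symmetries circle k lam lam) {n : ℕ} (hn : n ≤ k) {p : ℝ} {b : SmoothFun 𝕜 circle}
    (hb : b ∈ coboundaries 𝕜 n p) :
    ∃ A : DiffOp 𝕜 circle k, (∀ᶠ x in 𝓝 p, ∀ i, (coef A i).1 x = 0) ∧
      (∀ i, (coef (T A) i).1 p = 0) ∧ (∀ i, n < i → coef A i = 0) ∧ coef A n = b := by
  refine Submodule.span_induction (p := fun b _ => ∃ A : DiffOp 𝕜 circle k,
    (∀ᶠ x in 𝓝 p, ∀ i, (coef A i).1 x = 0) ∧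
      (∀ i, (coef (T A) i).1 p = 0) ∧ (∀ i, n < i → coef A i = 0) ∧ coef A n = b)
    ?_ ?_ ?_ ?_ hb
  · rintro _ ⟨f, hf, a, rfl⟩
    set B : DiffOp 𝕜 circle k := ofCoef k (Pi.single n a) with hB
    have hBlt (i : ℕ) (hi : n < i) : coef B i = 0 := by
      rcases le_or_gt i k with hik | hik
      · rw [hB, coef_ofCoef _ hik, Pi.single_eq_of_ne hi.ne']
      · exact coef_of_lt _ hik
    refine ⟨opAction k lam lam f B - B, ?_, fun i => ?_, fun i hi => ?_, ?_⟩
    · filter_upwards [eventually_eventually_nhds.2 hf] with x hx i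
      rw [map_sub]
      change (coef (opAction k lam lam f B) i).1 x - (coef B i).1 x = 0
      rw [coef_opAction_of_eventuallyEq_id lam lam hx, sub_self]
    · rw [map_sub, comm_opAction hT, map_sub]
      change (coef (opAction k lam lam f (T B)) i).1 p - (coef (T B) i).1 p = 0
      rw [coef_opAction_of_eventuallyEq_id lam lam hf, sub_self]
    · rw [map_sub, Pi.sub_apply, coef_opAction_of_order_lt lam lam f hBlt hi, hBlt i hi, sub_zero]
    · refine Subtype.ext <| funext fun x => ?_
      rw [map_sub]
      change (coef (opAction k lam lam f B) n).1 x - (coef B n).1 x =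
        (jacobianPow (-(n : 𝕜)) f).1 x * a.1 (f x) - a.1 x
      rw [coef_opAction_symbol lam lam f hBlt, hB, coef_ofCoef _ hn, Pi.single_eq_same, sub_self,
        zero_sub]
  · refine ⟨0, ?_, ?_, ?_, ?_⟩ <;> simp
  · rintro x y _ _ ⟨A, hA1, hA2, hA3, hA4⟩ ⟨B, hB1, hB2, hB3, hB4⟩
    refine ⟨A + B, ?_, fun i => ?_, fun i hi => ?_, ?_⟩
    · filter_upwards [hA1, hB1] with x hx hy i
      rw [map_add]
      change (coef A i).1 x + (coef B i).1 x = 0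
      rw [hx, hy, add_zero]
    · rw [map_add, map_add]
      change (coef (T A) i).1 p + (coef (T B) i).1 p = 0
      rw [hA2, hB2, add_zero]
    · rw [map_add, Pi.add_apply, hA3 i hi, hB3 i hi, add_zero]
    · rw [map_add, Pi.add_apply, hA4, hB4]
  · rintro c x _ ⟨A, hA1, hA2, hA3, hA4⟩
    refine ⟨c • A, ?_, fun i => ?_, fun i hi => ?_, ?_⟩
    · filter_upwards [hA1] with x hx i
      rw [map_smul]
      change c * (coef A i).1 x = 0
      rw [hx, mul_zero]
    · rw [map_smul, map_smul]
      change c * (coef (T A) i).1 p = 0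
      rw [hA2, mul_zero]
    · rw [map_smul, Pi.smul_apply, hA3 i hi, smul_zero]
    · rw [map_smul, Pi.smul_apply, hA4]

/-- On the circle, every symmetry is local when the weights are equal. -/
theorem isLocal_of_mem_symmetries_circle_self {T : Module.End 𝕜 (DiffOp 𝕜 circle k)}
    (hT : T ∈ Symmetries circle k lam lam) : IsLocal T := by
  have main (n : ℕ) : ∀ (A : DiffOp 𝕜 circle k) (p : ℝ), (∀ i, n ≤ i → coef A i = 0) →
      (∀ᶠ x in 𝓝 p, ∀ i, (coef A i).1 x = 0) → ∀ i, (coef (T A) i).1 p = 0 := by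
    induction n with
    | zero =>
      intro A p hA _ i
      have : A = 0 := ext_coef fun i _ x => by rw [hA i (Nat.zero_le i), map_zero]; rfl
      rw [this, map_zero, map_zero]
      rfl
    | succ n ih =>
      intro A p hA hp i
      rcases le_or_gt n k with hn | hn
      -- Removing an operator with the same leading coefficient, whose image vanishes at `p`, lowers
      -- the order and preserves the vanishing near `p`.
      · obtain ⟨B, hB1, hB2, hB3, hB4⟩ := exists_coboundary_operator hT hn
          (mem_coboundaries (n := n) (hp.mono fun x hx => hx n))
        have h1 := ih (A - B) p (fun i hi => ?_) ?_ i
        · rw [map_sub, map_sub] at h1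
          change (coef (T A) i).1 p - (coef (T B) i).1 p = 0 at h1
          rwa [hB2, sub_zero] at h1
        · rw [map_sub, Pi.sub_apply]
          rcases hi.eq_or_lt with rfl | hi
          · rw [hB4, sub_self]
          · rw [hA i hi, hB3 i hi, sub_zero]
        · filter_upwards [hp, hB1] with x hx hy i
          rw [map_sub]
          change (coef A i).1 x - (coef B i).1 x = 0
          rw [hx, hy, sub_zero]
      · refine ih A p (fun i hi => ?_) hp i
        exact coef_of_lt _ (by omega)
  refine isLocal_iff.2 fun A p hA => main (k + 1) A p (fun i hi => coef_of_lt _ hi) ?_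
  filter_upwards [hA] with y hy i
  rw [hy, map_zero]
  rfl

theorem isLocal_of_mem_symmetries_circle {T : Module.End 𝕜 (DiffOp 𝕜 circle k)}
    (hT : T ∈ Symmetries circle k lam mu) (h01 : (lam, mu) ≠ (0, 1)) : IsLocal T := by
  rcases eq_or_ne lam mu with rfl | hne
  · exact isLocal_of_mem_symmetries_circle_self hT
  · exact isLocal_of_mem_symmetries_circle_of_ne hT hne h01

end CircleLocality

/-! ### From germs on the line to the circle -/

section ExtensionToCircle

/-- Shift the period so that it is centred at `x`; then only an interval of length `2 η`
contributes. -/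
theorem abs_integral_le_of_small_support {v : ℝ → ℝ} (hv : Continuous v)
    (hper : Function.Periodic v 1) {M η x : ℝ} (hM : ∀ y, |v y| ≤ M) (hη : 0 < η) (hη' : η < 1 / 2)
    (hsupp : ∀ y, v y ≠ 0 → ∃ n : ℤ, |y - x - n| < η) : |∫ y in (0 : ℝ)..1, v y| ≤ 2 * η * M := by
  have hz (y : ℝ) (hy : η ≤ |y - x|) (hy' : |y - x| ≤ 1 / 2) : v y = 0 := by
    by_contra h
    obtain ⟨n, hn⟩ := hsupp y h
    have h1 := abs_lt.1 hn
    have h2 := abs_le.1 hy'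
    have h3 : (n : ℝ) < 1 := by linarith
    have h4 : (-1 : ℝ) < n := by linarith
    have h5 : n < 1 := by exact_mod_cast h3
    have h6 : -1 < n := by exact_mod_cast h4
    obtain rfl : n = 0 := by omega
    rw [Int.cast_zero, sub_zero] at hn
    exact absurd hn hy.not_gt
  have h1 := hper.intervalIntegral_add_eq 0 (x - 1 / 2)
  rw [zero_add] at h1
  have hi (a b : ℝ) : IntervalIntegrable v MeasureTheory.volume a b := hv.intervalIntegrable a b
  rw [h1, ← intervalIntegral.integral_add_adjacent_intervals (hi _ (x - η)) (hi _ _),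
    ← intervalIntegral.integral_add_adjacent_intervals (hi (x - η) (x + η)) (hi _ _)]
  have h2 : ∫ y in (x - 1 / 2)..(x - η), v y = 0 := by
    refine intervalIntegral.integral_zero_ae (Eventually.of_forall fun y hy => ?_)
    rw [Set.uIoc_of_le (by linarith)] at hy
    refine hz y ?_ ?_
    · rw [abs_of_neg (by linarith [hy.2])]
      linarith [hy.2]
    · rw [abs_of_neg (by linarith [hy.2])]
      linarith [hy.1]
  have h3 : ∫ y in (x + η)..(x - 1 / 2 + 1), v y = 0 := by
    refine intervalIntegral.integral_zero_ae (Eventually.of_forall fun y hy => ?_)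
    rw [Set.uIoc_of_le (by linarith)] at hy
    refine hz y ?_ ?_
    · rw [abs_of_pos (by linarith [hy.1])]
      linarith [hy.1]
    · rw [abs_of_pos (by linarith [hy.1])]
      linarith [hy.2]
  rw [h2, h3, zero_add, add_zero]
  have h4 := intervalIntegral.norm_integral_le_of_norm_le_const (a := x - η) (b := x + η) (f := v)
    (C := M) (fun y _ => hM y)
  rw [Real.norm_eq_abs, abs_of_pos (show 0 < x + η - (x - η) by linarith)] at h4
  linarith

theorem exists_pos_le_of_periodic {v : ℝ → ℝ} (hv : Continuous v) (hper : Function.Periodic v 1)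
    (hpos : ∀ x, 0 < v x) : ∃ δ > 0, ∀ x, δ ≤ v x := by
  obtain ⟨y, -, hy⟩ := isCompact_Icc.exists_isMinOn (s := Set.Icc (0 : ℝ) 1)
    (Set.nonempty_Icc.2 zero_le_one) hv.continuousOn
  refine ⟨v y, hpos y, fun x => ?_⟩
  obtain ⟨z, hz, hxz⟩ := hper.exists_mem_Ico₀ one_pos x
  rw [hxz]
  exact hy ⟨hz.1, hz.2.le⟩

/-- Every germ of a diffeomorphism of the line is the germ of a diffeomorphism of the circle. -/
theorem exists_circle_diffeo_eventuallyEq (f : OrientedDiffeo line) (x : ℝ) :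
    ∃ g : OrientedDiffeo circle, (g : ℝ → ℝ) =ᶠ[𝓝 x] f := by
  obtain ⟨G, hG⟩ := exists_smoothFun_eventuallyEq (𝕜 := ℝ) circle f.contDiff_deriv x
  have hGper : Function.Periodic G.1 1 := G.2.2
  have hGpos : ∀ᶠ y in 𝓝 x, 0 < G.1 y := hG.mono fun y hy => by rw [hy]; exact f.deriv_pos y
  obtain ⟨η₁, hη₁, hball⟩ := Metric.eventually_nhds_iff.1 hGpos
  obtain ⟨M, hM0, hM⟩ := exists_abs_le_of_periodic G.2.1.continuous hGper
  -- With this radius the integrals of `χ G` and of `χ` are at most `1 / 4`, which leaves room for a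
  -- positive derivative on the rest of the circle.
  set η := min η₁ (1 / (8 * (M + 1))) with hη
  have hη0 : 0 < η := lt_min hη₁ (by positivity)
  have hηM : η * (M + 1) ≤ 1 / 8 := by
    calc η * (M + 1) ≤ 1 / (8 * (M + 1)) * (M + 1) := by gcongr; exact min_le_right _ _
      _ = 1 / 8 := by field_simp
  have hη2 : η ≤ 1 / 8 := by nlinarith
  obtain ⟨χ, hχ, hχper, hχ0, hχ1, hχx, hsupp⟩ := exists_periodic_bump x hη0
  have hI1 := abs_le.1 (abs_integral_le_of_small_support (v := fun y => χ y * G.1 y)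
    (hχ.continuous.mul G.2.1.continuous) (hχper.mul hGper) (M := M) (fun y => by
      rw [abs_mul, abs_of_nonneg (hχ0 y)]
      calc χ y * |G.1 y| ≤ 1 * M := mul_le_mul (hχ1 y) (hM y) (abs_nonneg _) zero_le_one
        _ = M := one_mul M) hη0 (by linarith) (fun y hy => hsupp y (left_ne_zero_of_mul hy)))
  have hI2 := abs_le.1 (abs_integral_le_of_small_support hχ.continuous hχper (M := 1) (fun y => by
      rw [abs_of_nonneg (hχ0 y)]; exact hχ1 y) hη0 (by linarith) hsupp)
  set I₁ := ∫ y in (0 : ℝ)..1, χ y * G.1 y with hI₁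
  set I₂ := ∫ y in (0 : ℝ)..1, χ y with hI₂
  have h1 : 0 < 1 - I₁ := by nlinarith
  have h2 : 0 < 1 - I₂ := by nlinarith
  -- The derivative of `g` is that of `f` near `x` and the constant `c` away from `x`, with `c`
  -- determined by the requirement that the integral over a period be one.
  set c := (1 - I₁) / (1 - I₂) with hc
  have hc0 : 0 < c := div_pos h1 h2
  set h : ℝ → ℝ := fun y => χ y * G.1 y + c * (1 - χ y) with hh
  have hhs : ContDiff ℝ ∞ h := (hχ.mul G.2.1).add (contDiff_const.mul (contDiff_const.sub hχ))
  have hhper : Function.Periodic h 1 := fun y => by simp only [hh, hχper y, hGper y]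
  have hhpos (y : ℝ) : 0 < h y := by
    by_cases hy : χ y = 0
    · simp [hh, hy, hc0]
    · obtain ⟨n, hn⟩ := hsupp y hy
      have hG0 : 0 < G.1 y := by
        have := hGper.sub_int_mul_eq (x := y) n
        rw [mul_one] at this
        rw [← this]
        refine hball ?_
        rw [Real.dist_eq, sub_right_comm]
        exact hn.trans_le (min_le_left _ _)
      have h3 : 0 < χ y * G.1 y := mul_pos ((hχ0 y).lt_of_ne' hy) hG0
      have h4 : 0 ≤ c * (1 - χ y) := mul_nonneg hc0.le (by linarith [hχ1 y])
      simp only [hh]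
      linarith
  obtain ⟨δ, hδ, hδh⟩ := exists_pos_le_of_periodic hhs.continuous hhper hhpos
  have hint : ∫ y in (0 : ℝ)..circle, h y = circle := by
    change ∫ y in (0 : ℝ)..1, χ y * G.1 y + c * (1 - χ y) = 1
    have hi1 : IntervalIntegrable (fun y => χ y * G.1 y) MeasureTheory.volume 0 1 :=
      (hχ.continuous.mul G.2.1.continuous).intervalIntegrable _ _
    have hi2 : IntervalIntegrable χ MeasureTheory.volume 0 1 := hχ.continuous.intervalIntegrable _ _
    rw [intervalIntegral.integral_add hi1 ((intervalIntegrable_const.sub hi2).const_mul c),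
      intervalIntegral.integral_const_mul, intervalIntegral.integral_sub intervalIntegrable_const
        hi2, ← hI₁, ← hI₂, hc]
    simp
    field_simp
    ring
  obtain ⟨g, hgx, hg⟩ := exists_diffeo_of_deriv (P := circle) hhs hδ hδh hhper hint x (f x)
  refine ⟨g, ?_⟩
  have hev : ∀ᶠ y in 𝓝 x, h y = deriv f y := by
    filter_upwards [hχx, hG] with y hy hy'
    simp only [hh, hy, hy']
    ring
  obtain ⟨ρ, hρ, hballρ⟩ := Metric.eventually_nhds_iff_ball.1 hev
  have heq : Set.EqOn (g : ℝ → ℝ) f (Metric.ball x ρ) := by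
    refine Metric.isOpen_ball.eqOn_of_deriv_eq (convex_ball x ρ).isPreconnected
      (fun y _ => (hg y).differentiableAt.differentiableWithinAt)
      f.differentiable.differentiableOn (fun y hy => ?_) (Metric.mem_ball_self hρ) hgx
    rw [(hg y).deriv, hballρ y hy]
  filter_upwards [Metric.ball_mem_nhds x hρ] with y hy using heq hy

variable {k : ℕ}

theorem exists_germEq (B : DiffOp 𝕜 P k) (Q x : ℝ) : ∃ A : DiffOp 𝕜 Q k, GermEq x A B := by
  choose a ha using fun i => exists_smoothFun_eventuallyEq Q (coef B i).2.1 x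
  refine ⟨ofCoef k a, ?_⟩
  filter_upwards [(Filter.eventually_all_finset (Finset.range (k + 1))).2 fun i _ => ha i] with y hy i
  rcases le_or_gt i k with hi | hi
  · rw [coef_ofCoef _ hi]
    exact hy i (Finset.mem_range.2 (Nat.lt_succ_of_le hi))
  · rw [coef_of_lt _ hi, coef_of_lt _ hi]
    rfl

end ExtensionToCircle

/-! ### Comparison of the symmetries on the circle and on the line -/

section Lift

variable {k : ℕ} {lam mu : 𝕜}

/-- The lift of differential operators from the circle to the line. -/
def liftOp : DiffOp 𝕜 circle k →ₗ[𝕜] DiffOp 𝕜 line k where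
  toFun A := ofCoef k fun i => unroll (coef A i)
  map_add' A B := by
    refine ext_coef fun i hi x => ?_
    rw [map_add, coef_ofCoef _ hi, map_add, Pi.add_apply, Pi.add_apply, coef_ofCoef _ hi,
      coef_ofCoef _ hi]
    rfl
  map_smul' c A := by
    refine ext_coef fun i hi x => ?_
    rw [map_smul, coef_ofCoef _ hi, RingHom.id_apply, map_smul, Pi.smul_apply, Pi.smul_apply,
      coef_ofCoef _ hi]
    rfl

theorem coef_liftOp (A : DiffOp 𝕜 circle k) (i : ℕ) (x : ℝ) :
    (coef (liftOp A) i).1 x = (coef A i).1 x := by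
  rcases le_or_gt i k with hi | hi
  · change (coef (ofCoef k fun i => unroll (coef A i)) i).1 x = _
    rw [coef_ofCoef _ hi]
    rfl
  · rw [coef_of_lt _ hi, coef_of_lt _ hi]
    rfl

theorem germEq_liftOp (A : DiffOp 𝕜 circle k) (x : ℝ) : GermEq x A (liftOp A) :=
  Eventually.of_forall fun y i => (coef_liftOp A i y).symm

theorem liftOp_injective : Function.Injective (liftOp (𝕜 := 𝕜) (k := k)) := fun A B h =>
  ext_coef fun i _ x => by rw [← coef_liftOp, h, coef_liftOp]

/-- Being a lift is tested on periodic functions only, but their germs are all germs, so the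
coefficients of the lift are determined. -/
theorem isLift_iff {A : DiffOp 𝕜 circle k} {B : DiffOp 𝕜 line k} :
    IsLift A B ↔ B = liftOp A := by
  constructor
  · intro h
    refine ext_coef fun i _ x => ?_
    rw [coef_liftOp]
    refine coef_eq_of_evalAt_eq (fun φ hφ => ?_) i
    obtain ⟨ψ, hψ⟩ := exists_smoothFun_eventuallyEq circle hφ x
    rw [← evalAt_congr B hψ, ← evalAt_congr A hψ, ← apply_eq_evalAt]
    have h1 := congrFun (congrArg Subtype.val (h ψ)) x
    rw [apply_eq_evalAt] at h1
    exact h1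
  · rintro rfl φ
    refine Subtype.ext <| funext fun x => ?_
    rw [apply_eq_evalAt, evalAt_eq_of_coef_eq (B := A) (fun i => coef_liftOp A i x)]
    exact (apply_eq_evalAt A φ x).symm

/-- A diffeomorphism of the circle as a diffeomorphism of the line. -/
def OrientedDiffeo.toLine (f : OrientedDiffeo circle) : OrientedDiffeo line :=
  ⟨f.toOrderIso, f.smooth, f.smooth_symm, fun x => by simp⟩

theorem liftOp_opAction (f : OrientedDiffeo circle) (A : DiffOp 𝕜 circle k) :
    liftOp (opAction k lam mu f A) = opAction k lam mu f.toLine (liftOp A) := by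
  refine ext_coef fun i _ x => ?_
  rw [coef_liftOp]
  exact coef_opAction_congr lam mu (f := f) (g := f.toLine) EventuallyEq.rfl (A := A)
    (B := liftOp A) (fun i => (coef_liftOp A i _).symm) i

/-- The unit translation fixes lifted operators and commutes with `T`, hence fixes their images. -/
theorem coef_periodic_of_mem_symmetries {T : Module.End 𝕜 (DiffOp 𝕜 line k)}
    (hT : T ∈ Symmetries line k lam mu) (A : DiffOp 𝕜 circle k) (i : ℕ) :
    Function.Periodic (coef (T (liftOp A)) i).1 circle := by
  intro x
  have h : opAction k lam mu (translation line 1) (liftOp A) = liftOp A := by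
    refine ext_coef fun i _ x => ?_
    rw [coef_opAction_translation, coef_liftOp, coef_liftOp]
    exact (coef A i).2.2 x
  have h1 := coef_opAction_translation lam mu 1 (T (liftOp A)) i x
  rw [← comm_opAction hT, h] at h1
  exact h1.symm

theorem exists_liftOp_eq {T : Module.End 𝕜 (DiffOp 𝕜 line k)}
    (hT : T ∈ Symmetries line k lam mu) (A : DiffOp 𝕜 circle k) :
    ∃ A' : DiffOp 𝕜 circle k, liftOp A' = T (liftOp A) := by
  refine ⟨ofCoef k fun i => ⟨(coef (T (liftOp A)) i).1, (coef (T (liftOp A)) i).2.1,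
    coef_periodic_of_mem_symmetries hT A i⟩, ext_coef fun i hi x => ?_⟩
  rw [coef_liftOp, coef_ofCoef _ hi]

/-- The restriction of a symmetry on the line to the periodic differential operators. -/
def restrictOp (T : Symmetries line k lam mu) : Module.End 𝕜 (DiffOp 𝕜 circle k) where
  toFun A := (exists_liftOp_eq T.2 A).choose
  map_add' A B := by
    apply liftOp_injective
    refine (exists_liftOp_eq T.2 (A + B)).choose_spec.trans ?_
    refine Eq.trans ?_ (map_add liftOp _ _).symm
    rw [(exists_liftOp_eq T.2 A).choose_spec, (exists_liftOp_eq T.2 B).choose_spec, map_add,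
      map_add]
  map_smul' c A := by
    apply liftOp_injective
    refine (exists_liftOp_eq T.2 (c • A)).choose_spec.trans ?_
    refine Eq.trans ?_ (map_smul liftOp _ _).symm
    rw [RingHom.id_apply, (exists_liftOp_eq T.2 A).choose_spec, map_smul, map_smul]

theorem liftOp_restrictOp (T : Symmetries line k lam mu) (A : DiffOp 𝕜 circle k) :
    liftOp (restrictOp T A) = T.1 (liftOp A) :=
  (exists_liftOp_eq T.2 A).choose_spec

theorem restrictOp_eq {T : Symmetries line k lam mu} {S : Module.End 𝕜 (DiffOp 𝕜 circle k)}
    (h : ∀ A, T.1 (liftOp A) = liftOp (S A)) : restrictOp T = S := by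
  refine LinearMap.ext fun A => liftOp_injective ?_
  rw [liftOp_restrictOp, h]

theorem restrictOp_mem (T : Symmetries line k lam mu) :
    restrictOp T ∈ Symmetries circle k lam mu := by
  refine mem_symmetries fun f A => liftOp_injective ?_
  rw [liftOp_restrictOp, liftOp_opAction, liftOp_opAction, liftOp_restrictOp, comm_opAction T.2]

variable (k lam mu) in
/-- The restriction of the symmetries on the line to the periodic differential operators. -/
def restrictSymmetries : Symmetries line k lam mu →ₐ[𝕜] Symmetries circle k lam mu :=
  AlgHom.ofLinearMap
    { toFun T := ⟨restrictOp T, restrictOp_mem T⟩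
      map_add' S T := Subtype.ext <| restrictOp_eq fun A => by
        change S.1 (liftOp A) + T.1 (liftOp A) = liftOp (restrictOp S A + restrictOp T A)
        rw [map_add, liftOp_restrictOp, liftOp_restrictOp]
      map_smul' c T := Subtype.ext <| restrictOp_eq fun A => by
        change c • T.1 (liftOp A) = liftOp (c • restrictOp T A)
        rw [map_smul, liftOp_restrictOp] }
    (Subtype.ext <| restrictOp_eq fun _ => rfl)
    (fun S T => Subtype.ext <| restrictOp_eq fun A => by
      change S.1 (T.1 (liftOp A)) = liftOp (restrictOp S (restrictOp T A))
      rw [liftOp_restrictOp, liftOp_restrictOp])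

theorem liftOp_restrictSymmetries (T : Symmetries line k lam mu) (A : DiffOp 𝕜 circle k) :
    liftOp ((restrictSymmetries k lam mu T).1 A) = T.1 (liftOp A) :=
  liftOp_restrictOp T A

/-- Symmetries on the line are local, and every germ of an operator is the germ of a lifted one. -/
theorem restrictSymmetries_injective : Function.Injective (restrictSymmetries k lam mu) := by
  intro S T h
  refine Subtype.ext <| LinearMap.ext fun B => eq_of_germEq fun x => ?_
  obtain ⟨A, hA⟩ := exists_germEq B circle x
  have h1 : GermEq x B (liftOp A) := hA.symm.trans (germEq_liftOp A x)
  have h2 := (isLocal_of_mem_symmetries_line S.2).germEq h1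
  have h3 := (isLocal_of_mem_symmetries_line T.2).germEq h1
  rw [← liftOp_restrictSymmetries, h, liftOp_restrictSymmetries] at h2
  exact h2.trans h3.symm

/-- The germ of `C` at `x` is that of `T A` for any periodic `A` with the germ of `B` at `x`.
Locality makes this independent of `A`, and the same `A` serves at all nearby points, whence
smoothness. -/
theorem exists_extension {T : Module.End 𝕜 (DiffOp 𝕜 circle k)} (hT : IsLocal T)
    (B : DiffOp 𝕜 line k) :
    ∃ C : DiffOp 𝕜 line k, ∀ (x : ℝ) (A : DiffOp 𝕜 circle k), GermEq x A B → GermEq x (T A) C := by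
  choose A hA using exists_germEq B circle
  have key {x : ℝ} {A' : DiffOp 𝕜 circle k} (h : GermEq x A' B) :
      ∀ᶠ y in 𝓝 x, ∀ i, (coef (T A') i).1 y = (coef (T (A y)) i).1 y := by
    filter_upwards [h.eventually] with y hy i
    exact (hT.germEq (hy.trans (hA y).symm)).self i
  refine ⟨ofCoef k fun i => ⟨fun y => (coef (T (A y)) i).1 y, contDiff_iff_contDiffAt.2 fun x =>
    (coef (T (A x)) i).2.1.contDiffAt.congr_of_eventuallyEq ((key (hA x)).mono fun y hy => (hy i).symm),
    fun x => by simp⟩, fun x A' h => ?_⟩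
  filter_upwards [key h] with y hy i
  rw [hy]
  rcases le_or_gt i k with hi | hi
  · rw [coef_ofCoef _ hi]
  · rw [coef_of_lt _ hi, coef_of_lt _ hi]
    rfl

/-- The germwise extension is linear by uniqueness. It commutes with a diffeomorphism of the line
because near each point this agrees with a diffeomorphism of the circle. -/
theorem restrictSymmetries_surjective
    (hloc : ∀ T : Symmetries circle k lam mu, IsLocal T.1) :
    Function.Surjective (restrictSymmetries k lam mu) := by
  intro T
  choose E hE using exists_extension (hloc T)
  have huniq {B C : DiffOp 𝕜 line k}
      (h : ∀ x, ∃ A : DiffOp 𝕜 circle k, GermEq x A B ∧ GermEq x (T.1 A) C) : E B = C :=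
    eq_of_germEq fun x => by
      obtain ⟨A, hA, hA'⟩ := h x
      exact (hE B x A hA).symm.trans hA'
  let S : Module.End 𝕜 (DiffOp 𝕜 line k) :=
    { toFun := E
      map_add' B C := huniq fun x => by
        obtain ⟨A, hA⟩ := exists_germEq B circle x
        obtain ⟨A', hA'⟩ := exists_germEq C circle x
        refine ⟨A + A', hA.add hA', ?_⟩
        rw [map_add]
        exact (hE B x A hA).add (hE C x A' hA')
      map_smul' c B := huniq fun x => by
        obtain ⟨A, hA⟩ := exists_germEq B circle x
        refine ⟨c • A, hA.smul c, ?_⟩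
        rw [map_smul]
        exact (hE B x A hA).smul c }
  have hS : S ∈ Symmetries line k lam mu := mem_symmetries fun f B => huniq fun x => by
    obtain ⟨g, hg⟩ := exists_circle_diffeo_eventuallyEq f x
    obtain ⟨A, hA⟩ := exists_germEq B circle (g x)
    refine ⟨opAction k lam mu g A, GermEq.opAction lam mu hg hA, ?_⟩
    rw [comm_opAction T.2]
    exact GermEq.opAction lam mu hg (hE B (g x) A hA)
  refine ⟨⟨S, hS⟩, Subtype.ext <| LinearMap.ext fun A => liftOp_injective ?_⟩
  rw [liftOp_restrictSymmetries]
  exact huniq fun x => ⟨A, germEq_liftOp A x, germEq_liftOp _ x⟩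

/-- The symmetries on the circle and on the line coincide, outside of the exceptional weights. -/
theorem exists_algEquiv_symmetries (k : ℕ) (lam mu : 𝕜) (h01 : (lam, mu) ≠ (0, 1)) :
    ∃ e : Symmetries circle k lam mu ≃ₐ[𝕜] Symmetries line k lam mu,
      ∀ (T : Symmetries circle k lam mu) (A : DiffOp 𝕜 circle k) (B : DiffOp 𝕜 line k),
        IsLift A B → IsLift (T.1 A) ((e T).1 B) := by
  let r : Symmetries line k lam mu ≃ₐ[𝕜] Symmetries circle k lam mu :=
    AlgEquiv.ofBijective (restrictSymmetries k lam mu) ⟨restrictSymmetries_injective,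
      restrictSymmetries_surjective fun T => isLocal_of_mem_symmetries_circle T.2 h01⟩
  refine ⟨r.symm, fun T A B h => ?_⟩
  rw [isLift_iff] at h ⊢
  rw [h, ← liftOp_restrictSymmetries]
  have : restrictSymmetries k lam mu (r.symm T) = T := r.apply_symm_apply T
  rw [this]

end Lift

/-! ### The action for the weights `(0, 1)` -/

section Conjugation

variable {k : ℕ}

/-- The operator `a(x) dⁱ/dxⁱ`, as a linear function of `a`. -/
def term {i : ℕ} (hi : i ≤ k) : SmoothFun 𝕜 P →ₗ[𝕜] DiffOp 𝕜 P k where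
  toFun a := ⟨mulOp a * D ^ i, mulOp_mul_D_pow_mem hi a⟩
  map_add' a b := Subtype.ext <| LinearMap.ext fun φ => add_mul a b ((D ^ i) φ)
  map_smul' c a := Subtype.ext <| LinearMap.ext fun φ => smul_mul_assoc c a ((D ^ i) φ)

theorem coef_term {i : ℕ} (hi : i ≤ k) (a : SmoothFun 𝕜 P) (j : ℕ) :
    coef (term hi a) j = if j = i then a else 0 := by
  rcases le_or_gt j k with hj | hj
  · refine coef_eq_of_eq_sum (a := fun j => if j = i then a else 0) ?_ hj
    rw [Finset.sum_eq_single i]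
    · simp [term]
    · intro l _ hl
      simp [hl]
    · intro h
      exact absurd (Finset.mem_range.2 (Nat.lt_succ_of_le hi)) h
  · rw [coef_of_lt _ hj, if_neg (by omega)]

theorem pullback_zero_apply (f : OrientedDiffeo P) (φ : SmoothFun 𝕜 P) :
    pullback 0 f φ = comp φ f := by
  refine Subtype.ext <| funext fun x => ?_
  change NormedSpace.exp (0 * _ : 𝕜) * φ.1 (f x) = φ.1 (f x)
  rw [zero_mul, NormedSpace.exp_zero, one_mul]

theorem pullback_one_apply (f : OrientedDiffeo P) (φ : SmoothFun 𝕜 P) :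
    pullback 1 f φ = derivFun f * comp φ f := by
  refine Subtype.ext <| funext fun x => ?_
  change (jacobianPow (1 : 𝕜) f).1 x * φ.1 (f x) = ((deriv f x : ℝ) : 𝕜) * φ.1 (f x)
  rw [← RCLike.ofReal_one, jacobianPow_ofReal_apply, Real.rpow_one]

/-- The substitution by a diffeomorphism, as an automorphism of the space of functions. -/
def compEquiv (f : OrientedDiffeo P) : SmoothFun 𝕜 P ≃ₗ[𝕜] SmoothFun 𝕜 P where
  toFun φ := comp φ f
  map_add' _ _ := rfl
  map_smul' _ _ := rfl
  invFun φ := comp φ f.symm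
  left_inv φ := Subtype.ext <| funext fun x => congrArg φ.1 (f.apply_symm x)
  right_inv φ := Subtype.ext <| funext fun x => congrArg φ.1 (f.symm_apply x)

/-- The change of coordinates by a diffeomorphism in operators on functions. -/
def conj (f : OrientedDiffeo P) :
    Module.End 𝕜 (SmoothFun 𝕜 P) ≃ₐ[𝕜] Module.End 𝕜 (SmoothFun 𝕜 P) :=
  (compEquiv f).conjAlgEquiv 𝕜

theorem conj_apply (f : OrientedDiffeo P) (E : Module.End 𝕜 (SmoothFun 𝕜 P)) (φ : SmoothFun 𝕜 P) :
    conj f E φ = comp (E (comp φ f.symm)) f := rfl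

/-- The inverse `1 / f'` of the derivative of a diffeomorphism. -/
def invDeriv (f : OrientedDiffeo P) : SmoothFun 𝕜 P := comp (derivFun f.symm) f

theorem invDeriv_mul_derivFun (f : OrientedDiffeo P) :
    invDeriv f * derivFun f = (1 : SmoothFun 𝕜 P) := by
  refine Subtype.ext <| funext fun x => ?_
  change ((deriv f.symm (f x) : ℝ) : 𝕜) * ((deriv f x : ℝ) : 𝕜) = 1
  rw [← RCLike.ofReal_mul, deriv_symm_mul_deriv, RCLike.ofReal_one]

theorem conj_mulOp (f : OrientedDiffeo P) (a : SmoothFun 𝕜 P) :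
    conj f (mulOp a) = mulOp (comp a f) := by
  ext1 φ
  refine Subtype.ext <| funext fun x => ?_
  change a.1 (f x) * φ.1 (f.symm (f x)) = a.1 (f x) * φ.1 x
  rw [f.symm_apply]

theorem conj_D (f : OrientedDiffeo P) :
    conj f D = mulOp (invDeriv f) * (D : Module.End 𝕜 (SmoothFun 𝕜 P)) := by
  ext1 φ
  rw [conj_apply, D_comp]
  refine Subtype.ext <| funext fun x => ?_
  change _ * (D φ).1 (f.symm (f x)) = _
  rw [f.symm_apply]
  rfl

/-- Functions are transformed by substitution and one-forms by substitution times `f'`. The action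
is thus an algebra automorphism followed by multiplication by `f'`, which makes compositions
computable. -/
theorem opAction_zero_one (f : OrientedDiffeo P) (A : DiffOp 𝕜 P k) :
    (opAction k 0 1 f A).1 = mulOp (derivFun f) * conj f A.1 := by
  ext1 φ
  change pullback 1 f (A.1 (pullback 0 f.symm φ)) = derivFun f * conj f A.1 φ
  rw [pullback_one_apply, pullback_zero_apply, conj_apply]

theorem opAction_term (f : OrientedDiffeo P) {i : ℕ} (hi : i ≤ k) (a : SmoothFun 𝕜 P) :
    (opAction k 0 1 f (term hi a)).1 =
      mulOp (derivFun f * comp a f) * (mulOp (invDeriv f) * D) ^ i := by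
  rw [opAction_zero_one, mulOp_mul, mul_assoc, ← conj_mulOp, ← conj_D, ← map_pow, ← map_mul]
  rfl

theorem opAction_term_zero (f : OrientedDiffeo P) (hi : 0 ≤ k) (a : SmoothFun 𝕜 P) :
    opAction k 0 1 f (term hi a) = term hi (derivFun f * comp a f) := by
  refine Subtype.ext ?_
  rw [opAction_term]
  rfl

theorem opAction_term_one (f : OrientedDiffeo P) (hi : 1 ≤ k) (a : SmoothFun 𝕜 P) :
    opAction k 0 1 f (term hi a) = term hi (comp a f) := by
  refine Subtype.ext ?_
  rw [opAction_term, pow_one, ← mul_assoc, ← mulOp_mul, mul_right_comm, mul_comm (derivFun f),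
    invDeriv_mul_derivFun, one_mul]
  change _ = mulOp _ * D ^ 1
  rw [pow_one]

/-- The diffeomorphism `x ↦ 2 x` of the line. -/
def doubling : OrientedDiffeo line where
  toOrderIso := OrderIso.mulLeft₀ 2 two_pos
  smooth := contDiff_const.mul contDiff_id
  smooth_symm := contDiff_const.mul contDiff_id
  map_add_period x := by simp

theorem deriv_doubling (x : ℝ) : deriv doubling x = 2 := by
  change deriv (fun y : ℝ => 2 * y) x = 2
  simp

theorem derivFun_doubling : (derivFun doubling : SmoothFun 𝕜 line) = 2 := by
  refine Subtype.ext <| funext fun x => ?_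
  change ((deriv doubling x : ℝ) : 𝕜) = _
  rw [deriv_doubling]
  exact RCLike.ofReal_ofNat 2

theorem smul_mulOp (c : 𝕜) (a : SmoothFun 𝕜 P) : mulOp (c • a) = c • mulOp a :=
  LinearMap.ext fun φ => smul_mul_assoc c a φ

theorem invDeriv_doubling : (invDeriv doubling : SmoothFun 𝕜 line) = (2⁻¹ : 𝕜) • 1 := by
  have h := invDeriv_mul_derivFun (𝕜 := 𝕜) doubling
  rw [derivFun_doubling] at h
  rw [← h, mul_two, ← two_smul 𝕜, smul_smul, inv_mul_cancel₀ two_ne_zero, one_smul]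

/-- The coefficient of order `i` is scaled by `2^(1-i)`, so the dilation separates the orders; the
equation is written without negative powers. -/
theorem coef_opAction_doubling (A : DiffOp 𝕜 line k) {i : ℕ} (hi : i ≤ k) (x : ℝ) :
    2 ^ i * (coef (opAction k 0 1 doubling A) i).1 x = 2 * (coef A i).1 (2 * x) := by
  have h : (opAction k 0 1 doubling A).1 = ∑ i ∈ Finset.range (k + 1),
      mulOp ((2⁻¹ ^ i : 𝕜) • (2 * comp (coef A i) doubling)) * D ^ i := by
    conv_lhs => rw [opAction_zero_one, eq_sum_coef A, map_sum, Finset.mul_sum]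
    refine Finset.sum_congr rfl fun i _ => ?_
    rw [map_mul, map_pow, conj_mulOp, conj_D, invDeriv_doubling, derivFun_doubling, smul_mulOp,
      show mulOp (1 : SmoothFun 𝕜 line) = 1 from LinearMap.ext fun φ => one_mul φ, smul_mul_assoc,
      one_mul, smul_pow, smul_mulOp, mulOp_mul, mul_smul_comm, mul_smul_comm, smul_mul_assoc,
      mul_assoc]
  rw [coef_eq_of_eq_sum h hi]
  change 2 ^ i * (2⁻¹ ^ i * (2 * (coef A i).1 (2 * x))) = _
  rw [← mul_assoc, ← mul_pow, mul_inv_cancel₀ two_ne_zero, one_pow, one_mul]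

end Conjugation

/-! ### Values of a symmetry on `dⁿ/dxⁿ` and on `x d/dx` -/

section Eigenvalues

variable {k : ℕ}

theorem one_apply (x : ℝ) : (1 : SmoothFun 𝕜 P).1 x = 1 := rfl

theorem two_pow_injective : Function.Injective fun n : ℕ => (2 : 𝕜) ^ n := by
  intro m n h
  have h' : ((2 ^ m : ℕ) : 𝕜) = ((2 ^ n : ℕ) : 𝕜) := by
    push_cast
    exact h
  exact Nat.pow_right_injective le_rfl (Nat.cast_injective h')

theorem opAction_translation_term_one (c : ℝ) {n : ℕ} (hn : n ≤ k) :
    opAction k 0 1 (translation line c) (term hn (1 : SmoothFun 𝕜 line)) = term hn 1 := by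
  refine ext_coef fun i _ x => ?_
  rw [coef_opAction_translation, coef_term]
  split_ifs <;> rfl

theorem opAction_doubling_term_one {n : ℕ} (hn : n ≤ k) :
    (2 ^ n : 𝕜) • opAction k 0 1 doubling (term hn (1 : SmoothFun 𝕜 line)) =
      (2 : 𝕜) • term hn 1 := by
  refine ext_coef fun i hi x => ?_
  have h := coef_opAction_doubling (term hn (1 : SmoothFun 𝕜 line)) hi x
  rw [map_smul, map_smul]
  change (2 : 𝕜) ^ n * (coef _ i).1 x = 2 * (coef _ i).1 x
  rw [coef_term] at h ⊢
  by_cases hin : i = n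
  · subst hin
    rw [if_pos rfl] at h ⊢
    exact h
  · rw [if_neg hin] at h ⊢
    have h0 : (2 : 𝕜) ^ i * (coef (opAction k 0 1 doubling (term hn 1)) i).1 x = 2 * 0 := h
    rw [mul_zero, mul_eq_zero, or_iff_right (pow_ne_zero _ two_ne_zero)] at h0
    rw [h0, mul_zero]
    exact (mul_zero _).symm

/-- The value of a symmetry on `dⁿ/dxⁿ`, up to the factor `dⁿ/dxⁿ`. -/
def eigenvalue {n : ℕ} (hn : n ≤ k) (T : Module.End 𝕜 (DiffOp 𝕜 line k)) : 𝕜 :=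
  (coef (T (term hn 1)) n).1 0

/-- Invariance of `dⁿ/dxⁿ` under translations makes the coefficients of the image constant, and
homogeneity under `x ↦ 2 x` leaves only order `n`, as the powers of two are distinct. -/
theorem map_term_one {T : Module.End 𝕜 (DiffOp 𝕜 line k)} (hT : T ∈ Symmetries line k (0 : 𝕜) 1)
    {n : ℕ} (hn : n ≤ k) : T (term hn 1) = eigenvalue hn T • term hn 1 := by
  have hconst : ∀ i x y, (coef (T (term hn 1)) i).1 x = (coef (T (term hn 1)) i).1 y := by
    intro i x y
    have h := coef_opAction_translation 0 1 (x - y) (T (term hn 1)) i y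
    rw [← comm_opAction hT, opAction_translation_term_one, add_sub_cancel] at h
    exact h.symm
  refine ext_coef fun i hi x => ?_
  rw [map_smul]
  change _ = eigenvalue hn T * (coef _ i).1 x
  rw [coef_term]
  split_ifs with hin
  · subst hin
    rw [one_apply, mul_one]
    exact hconst _ _ _
  · have h := coef_opAction_doubling (T (term hn 1)) hi x
    have h2 := congrArg (fun A => (coef (T A) i).1 x) (opAction_doubling_term_one (𝕜 := 𝕜) hn)
    simp only [map_smul] at h2
    rw [comm_opAction hT] at h2
    change (2 : 𝕜) ^ n * (coef _ i).1 x = 2 * (coef _ i).1 x at h2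
    rw [hconst i (2 * x) x] at h
    have h3 : (2 ^ n - 2 ^ i : 𝕜) * (coef (T (term hn 1)) i).1 x = 0 := by
      linear_combination (2 ^ i / 2 : 𝕜) * h2 - (2 ^ n / 2 : 𝕜) * h
    rw [mul_eq_zero, sub_eq_zero, or_iff_right fun h => hin (two_pow_injective h).symm] at h3
    rw [h3]
    exact (mul_zero _).symm

variable (𝕜) in
/-- The coordinate function of the line. -/
def coordFun : SmoothFun 𝕜 line :=
  ⟨fun x => (x : 𝕜), contDiff_ofReal_comp contDiff_id, fun x => by simp⟩

theorem opAction_translation_coordFun (c : ℝ) (hk : 1 ≤ k) :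
    opAction k 0 1 (translation line c) (term hk (coordFun 𝕜)) =
      term hk (coordFun 𝕜) + (c : 𝕜) • term hk 1 := by
  rw [opAction_term_one, ← map_smul, ← map_add]
  congr 1
  refine Subtype.ext <| funext fun x => ?_
  change (((x + c : ℝ)) : 𝕜) = x + c * 1
  push_cast
  ring

theorem opAction_doubling_coordFun (hk : 1 ≤ k) :
    opAction k 0 1 doubling (term hk (coordFun 𝕜)) = (2 : 𝕜) • term hk (coordFun 𝕜) := by
  rw [opAction_term_one, ← map_smul]
  congr 1
  refine Subtype.ext <| funext fun x => ?_
  change ((2 * x : ℝ) : 𝕜) = 2 * x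
  push_cast
  rfl

/-- The coefficient at the identity in the value of a symmetry on `x d/dx`. -/
def shear (hk : 1 ≤ k) (T : Module.End 𝕜 (DiffOp 𝕜 line k)) : 𝕜 :=
  (coef (T (term hk (coordFun 𝕜))) 0).1 0

/-- Translation by `c` adds `c d/dx` to `x d/dx`, so the coefficients of the image are constant
except for the linear term in order one. The dilation kills every constant except the one in order
zero, which is the invariant `shear`. -/
theorem map_term_coordFun {T : Module.End 𝕜 (DiffOp 𝕜 line k)}
    (hT : T ∈ Symmetries line k (0 : 𝕜) 1) (hk : 1 ≤ k) :
    T (term hk (coordFun 𝕜)) =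
      eigenvalue hk T • term hk (coordFun 𝕜) + shear hk T • term (Nat.zero_le k) 1 := by
  have htrans : ∀ i x, (coef (T (term hk (coordFun 𝕜))) i).1 x =
      (coef (T (term hk (coordFun 𝕜))) i).1 0 + if i = 1 then eigenvalue hk T * x else 0 := by
    intro i x
    have h := coef_opAction_translation 0 1 x (T (term hk (coordFun 𝕜))) i 0
    rw [← comm_opAction hT, opAction_translation_coordFun, map_add, map_smul, map_term_one hT,
      zero_add, map_add, map_smul, map_smul] at h
    rw [← h]
    change (coef _ i).1 0 + x * (eigenvalue hk T * (coef _ i).1 0) = _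
    rw [coef_term]
    split_ifs
    · rw [one_apply]
      ring
    · change _ + x * (_ * (0 : 𝕜)) = _
      ring
  have hdouble : ∀ i ≤ k, ∀ x, (2 : 𝕜) ^ i * (coef (T (term hk (coordFun 𝕜))) i).1 x =
      (coef (T (term hk (coordFun 𝕜))) i).1 (2 * x) := by
    intro i hi x
    have h := coef_opAction_doubling (T (term hk (coordFun 𝕜))) hi x
    rw [← comm_opAction hT, opAction_doubling_coordFun, map_smul, map_smul] at h
    change (2 : 𝕜) ^ i * (2 * (coef _ i).1 x) = 2 * (coef _ i).1 (2 * x) at h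
    refine mul_left_cancel₀ (two_ne_zero (α := 𝕜)) ?_
    rw [← h]
    ring
  refine ext_coef fun i hi x => ?_
  rw [map_add, map_smul, map_smul]
  change _ = eigenvalue hk T * (coef _ i).1 x + shear hk T * (coef _ i).1 x
  rw [coef_term, coef_term]
  by_cases h1 : i = 1
  · subst h1
    rw [if_pos rfl, if_neg one_ne_zero, htrans, if_pos rfl]
    have h := hdouble 1 hi 0
    rw [mul_zero] at h
    have h0 : (coef (T (term hk (coordFun 𝕜))) 1).1 0 = 0 := by linear_combination h
    rw [h0, zero_add]
    change _ = _ * (x : 𝕜) + _ * (0 : 𝕜)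
    rw [mul_zero, add_zero]
  by_cases h0 : i = 0
  · subst h0
    rw [if_pos rfl, if_neg zero_ne_one, htrans, if_neg zero_ne_one]
    change (coef _ 0).1 0 + 0 = _ * (0 : 𝕜) + _ * (1 : 𝕜)
    rw [mul_zero, zero_add, add_zero, mul_one]
    rfl
  · rw [if_neg h1, if_neg h0, htrans, if_neg h1]
    have h := hdouble i hi 0
    rw [mul_zero] at h
    have h2 : (2 ^ i - 2 ^ 0 : 𝕜) * (coef (T (term hk (coordFun 𝕜))) i).1 0 = 0 := by
      linear_combination h
    rw [mul_eq_zero, sub_eq_zero, or_iff_right fun h => h0 (two_pow_injective h)] at h2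
    rw [h2]
    change _ = _ * (0 : 𝕜) + _ * (0 : 𝕜)
    ring

end Eigenvalues

/-! ### The three leading coefficients of `(v d/dx)^m` -/

section PowersOfVectorFields

theorem D_pow_succ (v : SmoothFun 𝕜 P) (m : ℕ) : D (v ^ (m + 1)) = (m + 1) • (v ^ m * D v) := by
  induction m with
  | zero => simp
  | succ m ih =>
    rw [pow_succ, D_mul, ih]
    simp only [nsmul_eq_mul]
    push_cast
    ring

theorem D_one : D (1 : SmoothFun 𝕜 P) = 0 :=
  Subtype.ext <| funext fun x => deriv_const x (1 : 𝕜)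

/-- The coefficient of `dⁱ/dxⁱ` in the power `(v(x) d/dx)^m` of a vector field. -/
def powCoef (v : SmoothFun 𝕜 P) : ℕ → ℕ → SmoothFun 𝕜 P
  | 0, 0 => 1
  | 0, _ + 1 => 0
  | m + 1, 0 => v * D (powCoef v m 0)
  | m + 1, i + 1 => v * (D (powCoef v m (i + 1)) + powCoef v m i)

variable (v : SmoothFun 𝕜 P)

theorem powCoef_of_lt (m : ℕ) : ∀ i, m < i → powCoef v m i = 0 := by
  induction m with
  | zero =>
    rintro (_ | i) hi
    · exact absurd hi (lt_irrefl _)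
    · rfl
  | succ m ih =>
    rintro (_ | i) hi
    · exact absurd hi (Nat.not_lt_zero _)
    · rw [powCoef, ih _ (by omega), ih _ (by omega), map_zero, add_zero, mul_zero]

theorem mulOp_mul_D_pow_eq_sum (m : ℕ) :
    (mulOp v * D) ^ m = ∑ i ∈ Finset.range (m + 1), mulOp (powCoef v m i) * D ^ i := by
  induction m with
  | zero =>
    rw [zero_add, Finset.sum_range_one]
    exact LinearMap.ext fun φ => (one_mul φ).symm
  | succ m ih =>
    have h1 : ∀ i, mulOp v * D * (mulOp (powCoef v m i) * D ^ i) =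
        mulOp (v * D (powCoef v m i)) * D ^ i + mulOp (v * powCoef v m i) * D ^ (i + 1) := by
      intro i
      rw [mul_assoc, ← mul_assoc D, D_mul_mulOp, mulOp_mul, mulOp_mul, pow_succ']
      simp only [mul_add, add_mul, mul_assoc]
    have h2 : ∑ i ∈ Finset.range (m + 1), mulOp (v * D (powCoef v m i)) * D ^ i =
        ∑ i ∈ Finset.range (m + 1 + 1), mulOp (v * D (powCoef v m i)) * D ^ i := by
      rw [Finset.sum_range_succ _ (m + 1), powCoef_of_lt v m _ m.lt_succ_self, map_zero, mul_zero]
      exact (add_zero _).symm.trans (congrArg _ (LinearMap.ext fun φ => (zero_mul _).symm))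
    rw [pow_succ', ih, Finset.mul_sum, Finset.sum_congr rfl fun i _ => h1 i,
      Finset.sum_add_distrib, h2, Finset.sum_range_succ' _ (m + 1), Finset.sum_range_succ' _ (m + 1),
      add_right_comm, ← Finset.sum_add_distrib]
    congr 1
    refine Finset.sum_congr rfl fun i _ => ?_
    rw [powCoef, mul_add]
    exact LinearMap.ext fun φ => (add_mul _ _ _).symm

theorem powCoef_self (m : ℕ) : powCoef v m m = v ^ m := by
  induction m with
  | zero => exact (pow_zero v).symm
  | succ m ih =>
    rw [powCoef, powCoef_of_lt v m _ m.lt_succ_self, map_zero, zero_add, ih, pow_succ']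

theorem powCoef_succ_zero (m : ℕ) : powCoef v (m + 1) 0 = 0 := by
  induction m with
  | zero =>
    change v * D 1 = 0
    rw [D_one, mul_zero]
  | succ m ih => rw [powCoef, ih, map_zero, mul_zero]

theorem two_smul_powCoef_succ (m : ℕ) :
    2 • powCoef v (m + 1) m = ((m + 1) * m) • (v ^ m * D v) := by
  induction m with
  | zero => simp [powCoef_succ_zero]
  | succ m ih =>
    rw [powCoef, powCoef_self, D_pow_succ]
    simp only [nsmul_eq_mul] at ih ⊢
    push_cast at ih ⊢
    linear_combination v * ih

/-- The recursion expresses this coefficient through its predecessor and the derivative of the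
coefficient just above; the factor `24` clears the denominators. This is where the obstruction for
orders at least four is found. -/
theorem powCoef_add_two (m : ℕ) :
    24 • powCoef v (m + 2) m = ((m + 2) * (m + 1) * m) •
      ((3 * m + 1) • (v ^ m * D v ^ 2) + 4 • (v ^ (m + 1) * D (D v))) := by
  induction m with
  | zero => simp [powCoef_succ_zero]
  | succ m ih =>
    have h := congrArg D (two_smul_powCoef_succ v (m + 1))
    rw [map_nsmul, map_nsmul, D_mul, D_pow_succ] at h
    rw [powCoef]
    simp only [nsmul_eq_mul] at ih h ⊢
    push_cast at ih h ⊢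
    linear_combination v * ih + 12 * v * h

end PowersOfVectorFields

/-! ### A symmetry is determined by its values on finitely many operators -/

section Vanishing

variable {k : ℕ}

attribute [local instance] diffOpAddCommGroup

variable (𝕜) in
/-- A smooth real function on the line, with values in `𝕜`. -/
def realFun {ψ : ℝ → ℝ} (hψ : ContDiff ℝ ∞ ψ) : SmoothFun 𝕜 line :=
  ⟨fun x => (ψ x : 𝕜), contDiff_ofReal_comp hψ, fun x => by simp⟩

/-- Locality allows the coefficient to be cut off, and its real and imaginary parts to be treated
separately. Compact support provides the bounds needed to turn coefficients into positive functions
or diffeomorphisms. -/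
theorem IsLocal.map_term_eq_zero {T : Module.End 𝕜 (DiffOp 𝕜 line k)} (hT : IsLocal T) {n : ℕ}
    (hn : n ≤ k) (h : ∀ (ψ : ℝ → ℝ) (hψ : ContDiff ℝ ∞ ψ), HasCompactSupport ψ →
      T (term hn (realFun 𝕜 hψ)) = 0) (a : SmoothFun 𝕜 line) : T (term hn a) = 0 := by
  refine eq_of_germEq fun x => ?_
  let χ : ContDiffBump x := ⟨1, 2, one_pos, one_lt_two⟩
  have h1 : ContDiff ℝ ∞ fun y => χ y * RCLike.re (a.1 y) :=
    χ.contDiff.mul ((RCLike.reCLM (K := 𝕜)).contDiff.comp a.2.1)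
  have h2 : ContDiff ℝ ∞ fun y => χ y * RCLike.im (a.1 y) :=
    χ.contDiff.mul ((RCLike.imCLM (K := 𝕜)).contDiff.comp a.2.1)
  have h0 : T (term hn (realFun 𝕜 h1 + (RCLike.I : 𝕜) • realFun 𝕜 h2)) = 0 := by
    rw [map_add, map_smul, map_add, map_smul, h _ _ χ.hasCompactSupport.mul_right,
      h _ _ χ.hasCompactSupport.mul_right, smul_zero, add_zero]
  rw [← h0]
  refine hT.germEq ?_
  filter_upwards [χ.eventuallyEq_one] with y hy
  intro i
  rw [coef_term, coef_term]
  split_ifs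
  · change a.1 y = ((χ y * RCLike.re (a.1 y) : ℝ) : 𝕜) +
      RCLike.I * ((χ y * RCLike.im (a.1 y) : ℝ) : 𝕜)
    rw [hy, Pi.one_apply, one_mul, one_mul, mul_comm, RCLike.re_add_im]
  · rfl

theorem exists_pos_le_rpow {u : ℝ → ℝ} {δ M : ℝ} (hδ : 0 < δ) (h1 : ∀ x, δ ≤ u x)
    (h2 : ∀ x, u x ≤ M) (r : ℝ) : ∃ η > 0, ∀ x, η ≤ u x ^ r := by
  have hM : 0 < M := hδ.trans_le ((h1 0).trans (h2 0))
  rcases le_total 0 r with hr | hr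
  · exact ⟨δ ^ r, Real.rpow_pos_of_pos hδ r, fun x => Real.rpow_le_rpow hδ.le (h1 x) hr⟩
  · exact ⟨M ^ r, Real.rpow_pos_of_pos hM r,
      fun x => Real.rpow_le_rpow_of_nonpos (hδ.trans_le (h1 x)) (h2 x) hr⟩

/-- A symmetry that kills the operators of order less than `n` sends `u dⁿ/dxⁿ`, for a positive
function `u`, to a transform of the value at `dⁿ/dxⁿ`. -/
theorem exists_map_term_eq {T : Module.End 𝕜 (DiffOp 𝕜 line k)}
    (hT : T ∈ Symmetries line k (0 : 𝕜) 1) {n : ℕ} (hn : n ≤ k) (hn1 : n ≠ 1)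
    (hlow : ∀ A : DiffOp 𝕜 line k, (∀ i, n ≤ i → coef A i = 0) → T A = 0) {u : ℝ → ℝ}
    (hu : ContDiff ℝ ∞ u) {δ M : ℝ} (hδ : 0 < δ) (h1 : ∀ x, δ ≤ u x) (h2 : ∀ x, u x ≤ M) :
    ∃ f : OrientedDiffeo line, (∀ x, deriv f x = u x ^ ((1 - n : ℝ)⁻¹)) ∧
      T (term hn (realFun 𝕜 hu)) = opAction k 0 1 f (T (term hn 1)) := by
  have hpos : ∀ x, 0 < u x := fun x => hδ.trans_le (h1 x)
  obtain ⟨η, hη, hle⟩ := exists_pos_le_rpow hδ h1 h2 ((1 - n : ℝ)⁻¹)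
  obtain ⟨f, -, hf⟩ := exists_diffeo_of_deriv (P := line)
    (hu.rpow_const_of_ne fun x => (hpos x).ne') hη hle (fun x => by simp) (by simp) 0 0
  refine ⟨f, fun x => (hf x).deriv, ?_⟩
  -- The leading coefficient of the transform of `dⁿ/dxⁿ` is `(f')^(1-n) = u`, so it differs from `u
  -- dⁿ/dxⁿ` by an operator of lower order, which `T` kills.
  rw [← comm_opAction hT, ← sub_eq_zero, ← map_sub]
  have hcoef : ∀ i, n < i → coef (term hn (1 : SmoothFun 𝕜 line)) i = 0 := fun i hi => by
    rw [coef_term, if_neg hi.ne']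
  refine hlow _ fun i hi => ?_
  rw [map_sub, Pi.sub_apply, coef_term]
  rcases hi.eq_or_lt with rfl | hi
  · rw [if_pos rfl, sub_eq_zero]
    refine Subtype.ext <| funext fun x => ?_
    have hcast : (1 - 0 - n : 𝕜) = ((1 - n : ℝ) : 𝕜) := by
      push_cast
      ring
    rw [coef_opAction_symbol 0 1 f hcoef, hcast, jacobianPow_ofReal_apply, (hf x).deriv, coef_term,
      if_pos rfl, one_apply, mul_one, ← Real.rpow_mul (hpos x).le, inv_mul_cancel₀,
      Real.rpow_one]
    · rfl
    · rw [sub_ne_zero]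
      exact_mod_cast hn1.symm
  · rw [if_neg hi.ne', coef_opAction_of_order_lt 0 1 f hcoef hi, sub_zero]

/-- A bounded function is the difference of a positive function and a constant, and `T` kills
`dⁿ/dxⁿ` with both as coefficients. -/
theorem map_term_eq_zero_of_ne_one {T : Module.End 𝕜 (DiffOp 𝕜 line k)}
    (hT : T ∈ Symmetries line k (0 : 𝕜) 1) {n : ℕ} (hn : n ≤ k) (hn1 : n ≠ 1)
    (hlow : ∀ A : DiffOp 𝕜 line k, (∀ i, n ≤ i → coef A i = 0) → T A = 0)
    (h : T (term hn 1) = 0) (a : SmoothFun 𝕜 line) : T (term hn a) = 0 := by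
  refine (isLocal_of_mem_symmetries_line hT).map_term_eq_zero hn (fun ψ hψ hs => ?_) a
  obtain ⟨M, hM⟩ := hs.exists_bound_of_continuous hψ.continuous
  have hu : ContDiff ℝ ∞ fun x => ψ x + (M + 1) := hψ.add contDiff_const
  obtain ⟨f, -, hf⟩ := exists_map_term_eq hT hn hn1 hlow hu one_pos
    (fun x => by linarith [(abs_le.1 (hM x)).1]) (M := M + (M + 1))
    (fun x => by linarith [(abs_le.1 (hM x)).2])
  have hsum : realFun 𝕜 hψ = realFun 𝕜 hu - ((M + 1 : ℝ) : 𝕜) • 1 := by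
    refine Subtype.ext <| funext fun x => ?_
    change (ψ x : 𝕜) = ((ψ x + (M + 1) : ℝ) : 𝕜) - ((M + 1 : ℝ) : 𝕜) * 1
    push_cast
    ring
  rw [hsum, map_sub, map_smul, map_sub, map_smul, hf, h, map_zero, smul_zero, sub_zero]

/-- In order one the coefficient has weight zero, so `d/dx` is transformed into itself and `x d/dx`
takes its place: its transform by `f` is `f d/dx`. If `ψ'` is bounded, then `ψ + C x` is a
diffeomorphism for large `C`. -/
theorem map_term_one_eq_zero {T : Module.End 𝕜 (DiffOp 𝕜 line k)}
    (hT : T ∈ Symmetries line k (0 : 𝕜) 1) (hk : 1 ≤ k)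
    (h : T (term hk (coordFun 𝕜)) = 0) (a : SmoothFun 𝕜 line) : T (term hk a) = 0 := by
  refine (isLocal_of_mem_symmetries_line hT).map_term_eq_zero hk (fun ψ hψ hs => ?_) a
  obtain ⟨M, hM⟩ := hs.deriv.exists_bound_of_continuous (hψ.continuous_deriv (by simp))
  obtain ⟨f, hf⟩ := exists_diffeo (P := line) (F := fun x => ψ x + (M + 1) * x)
    (hψ.add (contDiff_const.mul contDiff_id)) one_pos (fun x => by
      have hd : HasDerivAt (fun x => ψ x + (M + 1) * x) (deriv ψ x + (M + 1) * 1) x :=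
        (hψ.differentiable (by simp) x).hasDerivAt.add ((hasDerivAt_id x).const_mul _)
      rw [hd.deriv]
      linarith [(abs_le.1 (hM x)).1]) (fun x => by simp)
  have hsum : realFun 𝕜 hψ = comp (coordFun 𝕜) f - ((M + 1 : ℝ) : 𝕜) • coordFun 𝕜 := by
    refine Subtype.ext <| funext fun x => ?_
    change (ψ x : 𝕜) = ((f x : ℝ) : 𝕜) - ((M + 1 : ℝ) : 𝕜) * x
    rw [hf]
    push_cast
    ring
  rw [hsum, map_sub, map_smul, map_sub, map_smul, h, ← opAction_term_one, comm_opAction hT, h,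
    map_zero, smul_zero, sub_zero]

theorem coef_opAction_term (f : OrientedDiffeo P) {n : ℕ} (hn : n ≤ k) (a : SmoothFun 𝕜 P) {i : ℕ}
    (hi : i ≤ k) : coef (opAction k 0 1 f (term hn a)) i =
      derivFun f * comp a f * powCoef (invDeriv f) n i := by
  refine coef_eq_of_eq_sum (a := fun i => derivFun f * comp a f * powCoef (invDeriv f) n i) ?_ hi
  rw [opAction_term, mulOp_mul_D_pow_eq_sum, Finset.mul_sum]
  refine Eq.trans (Finset.sum_subset (Finset.range_mono (by omega)) fun j _ hj => ?_)
    (Finset.sum_congr rfl fun j _ => ?_)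
  · rw [powCoef_of_lt _ _ _ (by simpa using hj)]
    exact LinearMap.ext fun φ => (congrArg _ (zero_mul _)).trans (mul_zero _)
  · rw [mulOp_mul (derivFun f * comp a f), mul_assoc]

/-- With `n = l + 4` and `v = 1 / f'` one has `v^(n-1) = u`. As `u` is affine near `0`, this gives
`v' = s / (n - 1)` and `v'' = -(n - 2) v'²` at `0`, and the coefficient of order `n - 2` becomes a
multiple of `s²`. Its factor `l + 1 = n - 3` explains why order three escapes. -/
theorem coef_opAction_term_add_four (f : OrientedDiffeo line) {l : ℕ} (hl : l + 4 ≤ k) {s : ℝ}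
    {u : ℝ → ℝ} (hu : ∀ᶠ x in 𝓝 0, u x = 1 + s * x) (hu0 : ∀ x, 0 < u x)
    (hf : ∀ x, deriv f x = u x ^ ((1 - (l + 4 : ℕ) : ℝ)⁻¹)) (hcu : ContDiff ℝ ∞ u) :
    24 * (l + 3) ^ 2 * (coef (opAction k 0 1 f (term hl (1 : SmoothFun 𝕜 line))) (l + 2)).1 0 =
      -((l + 4) * (l + 3) * (l + 2) * (l + 1) * (s : 𝕜) ^ 2) := by
  have hv : invDeriv f ^ (l + 3) = realFun 𝕜 hcu := by
    have h1 : derivFun f ^ (l + 3) * realFun 𝕜 hcu = 1 := by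
      refine Subtype.ext <| funext fun x => ?_
      change ((deriv f x : ℝ) : 𝕜) ^ (l + 3) * ((u x : ℝ) : 𝕜) = 1
      rw [hf, ← RCLike.ofReal_pow, ← RCLike.ofReal_mul, ← Real.rpow_natCast,
        ← Real.rpow_mul (hu0 x).le]
      have h2 : ((1 - (l + 4 : ℕ) : ℝ)⁻¹ * (l + 3 : ℕ)) = -1 := by
        have h3 : (l + 3 : ℝ) ≠ 0 := by positivity
        push_cast
        rw [show (1 - (l + 4) : ℝ) = -(l + 3) by ring, inv_neg, neg_mul, inv_mul_cancel₀ h3]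
      rw [h2, Real.rpow_neg_one, inv_mul_cancel₀ (hu0 x).ne', RCLike.ofReal_one]
    have h4 := congrArg (· ^ (l + 3)) (invDeriv_mul_derivFun (𝕜 := 𝕜) f)
    simp only [mul_pow, one_pow] at h4
    linear_combination (realFun 𝕜 hcu) * h4 - invDeriv f ^ (l + 3) * h1
  have hd1 := congrArg D hv
  have hd2 := congrArg D hd1
  rw [D_pow_succ] at hd1 hd2
  rw [map_nsmul, D_mul, D_pow_succ] at hd2
  have hu1 : deriv (fun x => (u x : 𝕜)) =ᶠ[𝓝 0] fun _ => (s : 𝕜) := by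
    filter_upwards [hu.eventually_nhds] with x hx
    have h1 : HasDerivAt (fun x : ℝ => (1 + s * x : ℝ)) s x := by
      simpa using ((hasDerivAt_id x).const_mul s).const_add 1
    have h2 : HasDerivAt (fun x : ℝ => ((1 + s * x : ℝ) : 𝕜)) (s : 𝕜) x :=
      (RCLike.ofRealCLM (K := 𝕜)).hasFDerivAt.comp_hasDerivAt x h1
    exact (h2.congr_of_eventuallyEq (hx.mono fun y hy => by rw [hy])).deriv
  have hu2 : deriv (deriv (fun x => (u x : 𝕜))) 0 = 0 := by
    rw [hu1.deriv_eq, deriv_const]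
  have e4 : (derivFun f : SmoothFun 𝕜 line).1 0 = 1 := by
    change ((deriv f 0 : ℝ) : 𝕜) = 1
    rw [hf, hu.self_of_nhds, mul_zero, add_zero, Real.one_rpow, RCLike.ofReal_one]
  have e0 : (invDeriv f).1 0 * (derivFun f : SmoothFun 𝕜 line).1 0 = 1 :=
    congrFun (congrArg Subtype.val (invDeriv_mul_derivFun (𝕜 := 𝕜) f)) 0
  rw [e4, mul_one] at e0
  have e1 : (l + 2 + 1) • ((invDeriv f).1 0 ^ (l + 2) * (D (invDeriv f)).1 0) = (s : 𝕜) :=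
    (congrFun (congrArg Subtype.val hd1) 0).trans hu1.eq_of_nhds
  have e2 : (l + 2 + 1) • ((l + 1 + 1) • ((invDeriv f).1 0 ^ (l + 1) * (D (invDeriv f)).1 0) *
      (D (invDeriv f)).1 0 + (invDeriv f).1 0 ^ (l + 2) * (D (D (invDeriv f))).1 0) = (0 : 𝕜) :=
    (congrFun (congrArg Subtype.val hd2) 0).trans hu2
  have e3 : 24 • (powCoef (invDeriv f) (l + 2 + 2) (l + 2)).1 0 =
      ((l + 2 + 2) * (l + 2 + 1) * (l + 2)) • ((3 * (l + 2) + 1) • ((invDeriv f).1 0 ^ (l + 2) *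
        (D (invDeriv f)).1 0 ^ 2) + 4 • ((invDeriv f).1 0 ^ (l + 2 + 1) *
          (D (D (invDeriv f : SmoothFun 𝕜 line))).1 0)) :=
    congrFun (congrArg Subtype.val (powCoef_add_two (invDeriv f) (l + 2))) 0
  have hcoef : (coef (opAction k 0 1 f (term hl (1 : SmoothFun 𝕜 line))) (l + 2)).1 0 =
      (powCoef (invDeriv f) (l + 2 + 2) (l + 2)).1 0 := by
    rw [coef_opAction_term f hl _ (by omega)]
    change (derivFun f : SmoothFun 𝕜 line).1 0 * 1 * (powCoef _ _ _).1 0 = _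
    rw [e4, one_mul, one_mul]
  rw [hcoef]
  rw [e0] at e1 e2 e3
  generalize (D (invDeriv f : SmoothFun 𝕜 line)).1 0 = w at *
  generalize (D (D (invDeriv f : SmoothFun 𝕜 line))).1 0 = z at *
  generalize (powCoef (invDeriv f : SmoothFun 𝕜 line) (l + 2 + 2) (l + 2)).1 0 = c at *
  simp only [nsmul_eq_mul, one_pow, one_mul] at e1 e2 e3
  push_cast at e1 e2 e3
  rw [← e1]
  linear_combination (l + 3 : 𝕜) ^ 2 * e3 + 4 * (l + 4 : 𝕜) * (l + 3) ^ 2 * (l + 2) * e2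

theorem term_one_eigenvalue_eq_zero {T : Module.End 𝕜 (DiffOp 𝕜 line k)}
    (hT : T ∈ Symmetries line k (0 : 𝕜) 1) {n : ℕ} (hn : n ≤ k) (h4 : 4 ≤ n)
    (hlow : ∀ A : DiffOp 𝕜 line k, (∀ i, n ≤ i → coef A i = 0) → T A = 0) :
    T (term hn 1) = 0 := by
  obtain ⟨l, rfl⟩ : ∃ l, n = l + 4 := ⟨n - 4, by omega⟩
  let χ : ContDiffBump (0 : ℝ) := ⟨1 / 4, 1 / 2, by norm_num, by norm_num⟩
  have hχ : ∀ x, |χ x * x| ≤ 1 / 2 := by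
    intro x
    rcases le_or_gt (1 / 2) |x| with hx | hx
    · rw [χ.zero_of_le_dist (by rwa [dist_zero_right, Real.norm_eq_abs]), zero_mul, abs_zero]
      norm_num
    · rw [abs_mul, abs_of_nonneg χ.nonneg]
      exact (mul_le_of_le_one_left (abs_nonneg x) χ.le_one).trans hx.le
  have hsmooth : ∀ s : ℝ, ContDiff ℝ ∞ fun x => 1 + s * (χ x * x) := fun s =>
    contDiff_const.add (contDiff_const.mul (χ.contDiff.mul contDiff_id))
  have key : ∀ s : ℝ, |s| ≤ 1 → 24 * (l + 3 : 𝕜) ^ 2 *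
      (coef (T (term hn (realFun 𝕜 (hsmooth s)))) (l + 2)).1 0 =
        eigenvalue hn T * -((l + 4) * (l + 3) * (l + 2) * (l + 1) * (s : 𝕜) ^ 2) := by
    intro s hs
    have hb : ∀ x, |s * (χ x * x)| ≤ 1 / 2 := fun x => by
      rw [abs_mul]
      exact (mul_le_of_le_one_left (abs_nonneg _) hs).trans (hχ x)
    have h1 : ∀ x, 1 / 2 ≤ 1 + s * (χ x * x) := fun x => by linarith [(abs_le.1 (hb x)).1]
    obtain ⟨f, hf, hTf⟩ := exists_map_term_eq hT hn (by omega) hlow (hsmooth s)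
      (by norm_num : (0 : ℝ) < 1 / 2) h1 (M := 3 / 2) fun x => by linarith [(abs_le.1 (hb x)).2]
    rw [hTf, map_term_one hT, map_smul, map_smul, ← coef_opAction_term_add_four f hn (s := s)
      (χ.eventuallyEq_one.mono fun x hx => by rw [hx, Pi.one_apply, one_mul])
      (fun x => by linarith [h1 x]) hf (hsmooth s)]
    change _ * (eigenvalue hn T * (coef _ _).1 0) = _
    ring
  -- The terms linear in `s` cancel and the sum has no coefficient of order `n - 2`, whereas `key`
  -- gives two equal contributions proportional to `s²`; so the eigenvalue vanishes.
  have hsum : T (term hn (realFun 𝕜 (hsmooth 1))) + T (term hn (realFun 𝕜 (hsmooth (-1)))) =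
      (2 : 𝕜) • T (term hn 1) := by
    rw [← map_add, ← map_add, ← map_smul, ← map_smul]
    congr 2
    refine Subtype.ext <| funext fun x => ?_
    change ((1 + 1 * (χ x * x) : ℝ) : 𝕜) + ((1 + -1 * (χ x * x) : ℝ) : 𝕜) = 2 * 1
    push_cast
    ring
  have h0 : (coef (T (term hn (realFun 𝕜 (hsmooth 1)))) (l + 2)).1 0 +
      (coef (T (term hn (realFun 𝕜 (hsmooth (-1))))) (l + 2)).1 0 = 0 := by
    have h := congrArg (fun A => (coef A (l + 2)).1 0) hsum
    rw [map_term_one hT] at h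
    simp only [map_add, map_smul] at h
    refine h.trans ?_
    change 2 * (eigenvalue hn T * (coef _ (l + 2)).1 0) = (0 : 𝕜)
    rw [coef_term, if_neg (by omega)]
    change 2 * (eigenvalue hn T * 0) = (0 : 𝕜)
    ring
  have k1 := key 1 (by norm_num)
  have k2 := key (-1) (by norm_num)
  rw [RCLike.ofReal_neg, neg_sq] at k2
  rw [RCLike.ofReal_one, one_pow] at k1 k2
  have h5 : eigenvalue hn T * (2 * ((l + 4) * (l + 3) * (l + 2) * (l + 1)) : ℕ) = (0 : 𝕜) := by
    push_cast
    linear_combination k1 + k2 - 24 * (l + 3 : 𝕜) ^ 2 * h0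
  rw [mul_eq_zero, or_iff_left (Nat.cast_ne_zero.2 (by positivity))] at h5
  rw [map_term_one hT, h5, zero_smul]

theorem map_eq_zero_of_forall_term {T : Module.End 𝕜 (DiffOp 𝕜 line k)} {n : ℕ} (hn : n ≤ k)
    (hlow : ∀ A : DiffOp 𝕜 line k, (∀ i, n ≤ i → coef A i = 0) → T A = 0)
    (h : ∀ a, T (term hn a) = 0) (A : DiffOp 𝕜 line k) (hA : ∀ i, n + 1 ≤ i → coef A i = 0) :
    T A = 0 := by
  have h1 : T (A - term hn (coef A n)) = 0 := by
    refine hlow _ fun i hi => ?_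
    rw [map_sub, Pi.sub_apply, coef_term]
    rcases hi.eq_or_lt with rfl | hi
    · rw [if_pos rfl, sub_self]
    · rw [if_neg hi.ne', hA i hi, sub_zero]
  rwa [map_sub, h, sub_zero] at h1

/-- A symmetry vanishing on `dⁿ/dxⁿ` for `n ≤ 3` and on `x d/dx` is zero. -/
theorem eq_zero_of_forall_eigenvalue {T : Module.End 𝕜 (DiffOp 𝕜 line k)}
    (hT : T ∈ Symmetries line k (0 : 𝕜) 1) (h : ∀ n ≤ 3, ∀ hn : n ≤ k, eigenvalue hn T = 0)
    (hs : ∀ hk : 1 ≤ k, shear hk T = 0) : T = 0 := by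
  have key : ∀ n ≤ k + 1, ∀ A : DiffOp 𝕜 line k, (∀ i, n ≤ i → coef A i = 0) → T A = 0 := by
    intro n
    induction n with
    | zero =>
      intro _ A hA
      have h0 : A = 0 := ext_coef fun i _ x => by rw [hA i i.zero_le, map_zero]; rfl
      rw [h0, map_zero]
    | succ n ih =>
      intro hn
      have hn : n ≤ k := by omega
      have hlow := ih (by omega)
      refine map_eq_zero_of_forall_term hn hlow fun a => ?_
      by_cases hn1 : n = 1
      · subst hn1
        refine map_term_one_eq_zero hT hn ?_ a
        rw [map_term_coordFun hT, h 1 (by norm_num), hs, zero_smul, zero_smul, add_zero]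
      · refine map_term_eq_zero_of_ne_one hT hn hn1 hlow ?_ a
        rcases le_or_gt 4 n with h4 | h4
        · exact term_one_eigenvalue_eq_zero hT hn h4 hlow
        · rw [map_term_one hT, h n (by omega), zero_smul]
  exact LinearMap.ext fun A => key (k + 1) le_rfl A fun i hi => coef_of_lt A hi

end Vanishing

/-! ### The formal adjoint and its potential -/

section FormalAdjoint

theorem mulOp_one : mulOp (1 : SmoothFun 𝕜 P) = 1 := LinearMap.ext fun φ => one_mul φ

theorem mulOp_add (a b : SmoothFun 𝕜 P) : mulOp (a + b) = mulOp a + mulOp b :=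
  LinearMap.ext fun φ => add_mul a b φ

variable (𝕜 P) in
/-- The operator `-d/dx`. -/
def negD : Module.End 𝕜 (SmoothFun 𝕜 P) := (-1 : 𝕜) • D

theorem mulOp_mul_negD (a : SmoothFun 𝕜 P) :
    mulOp a * negD 𝕜 P = mulOp (D a) + negD 𝕜 P * mulOp a := by
  ext1 φ
  change a * ((-1 : 𝕜) • D φ) = D a * φ + (-1 : 𝕜) • D (a * φ)
  rw [D_mul, neg_one_smul, neg_one_smul]
  ring

variable (𝕜 P) in
/-- The differential operator with given coefficients. -/
def symbolOp : (ℕ →₀ SmoothFun 𝕜 P) →ₗ[𝕜] Module.End 𝕜 (SmoothFun 𝕜 P) :=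
  Finsupp.lsum 𝕜 fun i =>
    { toFun a := mulOp a * D ^ i
      map_add' a b := by rw [mulOp_add, add_mul]
      map_smul' c a := by rw [smul_mulOp, smul_mul_assoc, RingHom.id_apply] }

variable (𝕜 P) in
/-- The formal adjoint of the differential operator with given coefficients. -/
def adjointOp : (ℕ →₀ SmoothFun 𝕜 P) →ₗ[𝕜] Module.End 𝕜 (SmoothFun 𝕜 P) :=
  Finsupp.lsum 𝕜 fun i =>
    { toFun a := negD 𝕜 P ^ i * mulOp a
      map_add' a b := by rw [mulOp_add, mul_add]
      map_smul' c a := by rw [smul_mulOp, mul_smul_comm, RingHom.id_apply] }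

theorem symbolOp_single (i : ℕ) (a : SmoothFun 𝕜 P) :
    symbolOp 𝕜 P (Finsupp.single i a) = mulOp a * D ^ i :=
  Finsupp.lsum_single _ _ _ _

theorem adjointOp_single (i : ℕ) (a : SmoothFun 𝕜 P) :
    adjointOp 𝕜 P (Finsupp.single i a) = negD 𝕜 P ^ i * mulOp a :=
  Finsupp.lsum_single _ _ _ _

theorem symbolOp_eq_sum {c : ℕ →₀ SmoothFun 𝕜 P} {n : ℕ} (h : c.support ⊆ Finset.range n) :
    symbolOp 𝕜 P c = ∑ i ∈ Finset.range n, mulOp (c i) * D ^ i := by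
  change c.sum (fun i a => mulOp a * D ^ i) = _
  refine Finsupp.sum_of_support_subset _ h _ fun i _ => ?_
  exact LinearMap.ext fun φ => zero_mul _

/-- This makes the formal adjoint, defined on families of coefficients, depend only on the operator.
-/
theorem symbolOp_injective : Function.Injective (symbolOp 𝕜 P) := by
  intro a b h
  obtain ⟨n, hn⟩ := (a.support ∪ b.support).exists_nat_subset_range
  rw [symbolOp_eq_sum (Finset.subset_union_left.trans hn),
    symbolOp_eq_sum (Finset.subset_union_right.trans hn)] at h
  refine Finsupp.ext fun i => ?_
  by_cases hi : i < n
  · exact coefficients_unique h hi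
  · have h0 : i ∉ a.support ∪ b.support := fun h' => hi (Finset.mem_range.1 (hn h'))
    rw [Finset.mem_union, not_or, Finsupp.notMem_support_iff, Finsupp.notMem_support_iff] at h0
    rw [h0.1, h0.2]

/-- The operator `A'` is the formal adjoint of the differential operator `A`. -/
def IsAdjoint (A A' : Module.End 𝕜 (SmoothFun 𝕜 P)) : Prop :=
  ∃ c, symbolOp 𝕜 P c = A ∧ adjointOp 𝕜 P c = A'

namespace IsAdjoint

variable {A A' B B' : Module.End 𝕜 (SmoothFun 𝕜 P)}

theorem unique (h : IsAdjoint A A') (h' : IsAdjoint A B') : A' = B' := by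
  obtain ⟨c, hc, rfl⟩ := h
  obtain ⟨d, hd, rfl⟩ := h'
  rw [symbolOp_injective (hc.trans hd.symm)]

theorem zero : IsAdjoint (0 : Module.End 𝕜 (SmoothFun 𝕜 P)) 0 := ⟨0, map_zero _, map_zero _⟩

theorem add (h : IsAdjoint A A') (h' : IsAdjoint B B') : IsAdjoint (A + B) (A' + B') := by
  obtain ⟨c, rfl, rfl⟩ := h
  obtain ⟨d, rfl, rfl⟩ := h'
  exact ⟨c + d, map_add _ _ _, map_add _ _ _⟩

theorem smul (r : 𝕜) (h : IsAdjoint A A') : IsAdjoint (r • A) (r • A') := by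
  obtain ⟨c, rfl, rfl⟩ := h
  exact ⟨r • c, map_smul _ _ _, map_smul _ _ _⟩

theorem single (a : SmoothFun 𝕜 P) (i : ℕ) : IsAdjoint (mulOp a * D ^ i) (negD 𝕜 P ^ i * mulOp a) :=
  ⟨Finsupp.single i a, symbolOp_single i a, adjointOp_single i a⟩

theorem induction {p : Module.End 𝕜 (SmoothFun 𝕜 P) → Module.End 𝕜 (SmoothFun 𝕜 P) → Prop}
    (h0 : p 0 0) (hadd : ∀ A A' B B', p A A' → p B B' → p (A + B) (A' + B'))
    (hsingle : ∀ a i, p (mulOp a * D ^ i) (negD 𝕜 P ^ i * mulOp a)) (h : IsAdjoint A A') : p A A' := by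
  obtain ⟨c, rfl, rfl⟩ := h
  induction c using Finsupp.induction_linear with
  | zero => simpa using h0
  | add c d hc hd => simpa using hadd _ _ _ _ hc hd
  | single i a => rw [symbolOp_single, adjointOp_single]; exact hsingle a i

theorem mulOp (a : SmoothFun 𝕜 P) : IsAdjoint (mulOp a) (DensityOperators.mulOp a) := by
  simpa using single a 0

theorem mulOp_mul (b : SmoothFun 𝕜 P) (h : IsAdjoint A A') :
    IsAdjoint (DensityOperators.mulOp b * A) (A' * DensityOperators.mulOp b) := by
  refine IsAdjoint.induction (p := fun A A' => IsAdjoint (DensityOperators.mulOp b * A) (A' * DensityOperators.mulOp b))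
    ?_ ?_ ?_ h
  · simpa using zero
  · intro A A' B B' hA hB
    rw [mul_add, add_mul]
    exact hA.add hB
  · intro a i
    rw [← mul_assoc, mul_assoc _ _ (DensityOperators.mulOp b), ← DensityOperators.mulOp_mul,
      ← DensityOperators.mulOp_mul, mul_comm a b]
    exact single _ _

theorem D_mul (h : IsAdjoint A A') : IsAdjoint (D * A) (A' * negD 𝕜 P) := by
  refine IsAdjoint.induction (p := fun A A' => IsAdjoint (DensityOperators.D * A) (A' * negD 𝕜 P))
    ?_ ?_ ?_ h
  · simpa using zero
  · intro A A' B B' hA hB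
    rw [mul_add, add_mul]
    exact hA.add hB
  · intro a i
    have h1 : D * (DensityOperators.mulOp a * D ^ i) =
        DensityOperators.mulOp (D a) * D ^ i + DensityOperators.mulOp a * D ^ (i + 1) := by
      rw [← mul_assoc, D_mul_mulOp, add_mul, pow_succ', mul_assoc _ D]
    have h2 : negD 𝕜 P ^ i * DensityOperators.mulOp a * negD 𝕜 P =
        negD 𝕜 P ^ i * DensityOperators.mulOp (D a) + negD 𝕜 P ^ (i + 1) * DensityOperators.mulOp a := by
      rw [pow_succ, mul_assoc, mul_assoc, ← mul_add, mulOp_mul_negD]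
    rw [h1, h2]
    exact (single _ _).add (single _ _)

/-- Stability under left composition with `D` and with multiplications gives the claim when the left
factor is `a Dⁱ`, and additivity gives the rest. -/
theorem mul (h : IsAdjoint A A') (h' : IsAdjoint B B') : IsAdjoint (A * B) (B' * A') := by
  have hpow : ∀ i, IsAdjoint (D ^ i * B) (B' * negD 𝕜 P ^ i) := by
    intro i
    induction i with
    | zero => simpa using h'
    | succ i ih =>
      rw [pow_succ', pow_succ, mul_assoc, ← mul_assoc B']
      exact ih.D_mul
  refine IsAdjoint.induction (p := fun A A' => IsAdjoint (A * B) (B' * A'))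
    ?_ ?_ ?_ h
  · simpa using zero
  · intro A A' C C' hA hC
    rw [add_mul, mul_add]
    exact hA.add hC
  · intro a i
    rw [mul_assoc, ← mul_assoc B']
    exact (hpow i).mulOp_mul a

theorem pow (h : IsAdjoint A A') (i : ℕ) : IsAdjoint (A ^ i) (A' ^ i) := by
  induction i with
  | zero =>
    rw [pow_zero, pow_zero, ← mulOp_one]
    exact IsAdjoint.mulOp 1
  | succ i ih =>
    rw [pow_succ', pow_succ]
    exact h.mul ih

theorem D : IsAdjoint (D : Module.End 𝕜 (SmoothFun 𝕜 P)) (negD 𝕜 P) := by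
  have h := single (1 : SmoothFun 𝕜 P) 1
  rwa [mulOp_one, pow_one, pow_one, one_mul, mul_one] at h

/-- The change of variables in the pairing `∫ φ ψ dx` produces a Jacobian on either side of the
conjugated adjoint. -/
theorem conj (f : OrientedDiffeo P) (h : IsAdjoint A A') :
    IsAdjoint (conj f A) (DensityOperators.mulOp (derivFun f) * DensityOperators.conj f A' *
      DensityOperators.mulOp (invDeriv f)) := by
  refine IsAdjoint.induction (p := fun A A' => IsAdjoint (DensityOperators.conj f A) (DensityOperators.mulOp (derivFun f) *
      DensityOperators.conj f A' * DensityOperators.mulOp (invDeriv f)))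
    ?_ ?_ ?_ h
  · simpa using zero
  · intro A A' C C' hA hC
    rw [map_add, map_add, mul_add, add_mul]
    exact hA.add hC
  · intro a i
    have hinv : DensityOperators.mulOp (derivFun f) * DensityOperators.mulOp (invDeriv f) =
        (1 : Module.End 𝕜 (SmoothFun 𝕜 P)) := by
      rw [← DensityOperators.mulOp_mul, mul_comm, invDeriv_mul_derivFun, mulOp_one]
    have hinv' : DensityOperators.mulOp (invDeriv f) * DensityOperators.mulOp (derivFun f) =
        (1 : Module.End 𝕜 (SmoothFun 𝕜 P)) := by
      rw [← DensityOperators.mulOp_mul, invDeriv_mul_derivFun, mulOp_one]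
    -- Multiplication by `f'` intertwines `-(1/f') D`, the conjugate of `-D`, with the adjoint `-D
    -- (1/f')` of `(1/f') D`.
    have hsemi : SemiconjBy (DensityOperators.mulOp (derivFun f))
        ((-1 : 𝕜) • (DensityOperators.mulOp (invDeriv f) * DensityOperators.D))
        (negD 𝕜 P * DensityOperators.mulOp (invDeriv f)) := by
      change _ * _ = _ * _
      rw [mul_smul_comm, ← mul_assoc, hinv, one_mul, mul_assoc, hinv', mul_one]
      rfl
    have h1 : DensityOperators.mulOp (derivFun f) *
        DensityOperators.conj f ((negD 𝕜 P) ^ i * DensityOperators.mulOp a) *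
          DensityOperators.mulOp (invDeriv f) =
        (negD 𝕜 P * DensityOperators.mulOp (invDeriv f)) ^ i *
          DensityOperators.mulOp (comp a f) := by
      rw [map_mul, map_pow, negD, map_smul, conj_D, conj_mulOp, ← mul_assoc, ← negD, (hsemi.pow_right i).eq,
        mul_assoc, mul_assoc, ← DensityOperators.mulOp_mul, ← DensityOperators.mulOp_mul,
        mul_left_comm, mul_comm (derivFun f), invDeriv_mul_derivFun, mul_one]
    rw [h1, map_mul, map_pow, conj_D, conj_mulOp]
    exact (((IsAdjoint.mulOp _).mul IsAdjoint.D).pow i).mulOp_mul _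

end IsAdjoint

theorem diffOp_mono {m n : ℕ} (h : m ≤ n) : DiffOp 𝕜 P m ≤ DiffOp 𝕜 P n := by
  rintro _ ⟨a, rfl⟩
  exact Submodule.sum_mem _ fun i hi =>
    mulOp_mul_D_pow_mem ((Nat.lt_succ_iff.1 (Finset.mem_range.1 hi)).trans h) _

theorem D_mul_mem {n : ℕ} {A : Module.End 𝕜 (SmoothFun 𝕜 P)} (hA : A ∈ DiffOp 𝕜 P n) :
    D * A ∈ DiffOp 𝕜 P (n + 1) := by
  obtain ⟨a, rfl⟩ := hA
  rw [Finset.mul_sum]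
  refine Submodule.sum_mem _ fun i hi => ?_
  have hi : i < n + 1 := Finset.mem_range.1 hi
  rw [← mul_assoc, D_mul_mulOp, add_mul, mul_assoc _ D, ← pow_succ']
  exact add_mem (mulOp_mul_D_pow_mem hi.le _) (mulOp_mul_D_pow_mem hi _)

theorem neg_D_pow_mul_mulOp_mem (a : SmoothFun 𝕜 P) (i : ℕ) :
    negD 𝕜 P ^ i * mulOp a ∈ DiffOp 𝕜 P i := by
  induction i with
  | zero => simpa using mulOp_mul_D_pow_mem (le_refl 0) a
  | succ i ih =>
    rw [pow_succ', mul_assoc, negD, smul_mul_assoc, ← negD]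
    exact Submodule.smul_mem _ _ (D_mul_mem ih)

variable {k : ℕ}

theorem adjointOp_mem {c : ℕ →₀ SmoothFun 𝕜 P} (h : c.support ⊆ Finset.range (k + 1)) :
    adjointOp 𝕜 P c ∈ DiffOp 𝕜 P k :=
  Submodule.sum_mem _ fun i hi =>
    diffOp_mono (Nat.lt_succ_iff.1 (Finset.mem_range.1 (h hi))) (neg_D_pow_mul_mulOp_mem _ i)

/-- The coefficients of a differential operator, as a finitely supported family. -/
def finCoef (A : DiffOp 𝕜 P k) : ℕ →₀ SmoothFun 𝕜 P :=
  Finsupp.onFinset (Finset.range (k + 1)) (coef A) fun i hi => by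
    by_contra h
    exact hi (coef_of_lt A (by simpa using h))

theorem support_finCoef (A : DiffOp 𝕜 P k) : (finCoef A).support ⊆ Finset.range (k + 1) :=
  Finsupp.support_onFinset_subset

theorem symbolOp_finCoef (A : DiffOp 𝕜 P k) : symbolOp 𝕜 P (finCoef A) = A.1 :=
  (symbolOp_eq_sum (support_finCoef A)).trans (eq_sum_coef A).symm

theorem isAdjoint_finCoef (A : DiffOp 𝕜 P k) : IsAdjoint A.1 (adjointOp 𝕜 P (finCoef A)) :=
  ⟨_, symbolOp_finCoef A, rfl⟩

variable (𝕜 P k) in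
/-- The formal adjoint, as a linear map. -/
def adjointMap : Module.End 𝕜 (DiffOp 𝕜 P k) where
  toFun A := ⟨adjointOp 𝕜 P (finCoef A), adjointOp_mem (support_finCoef A)⟩
  map_add' A B := Subtype.ext <|
    (isAdjoint_finCoef (A + B)).unique ((isAdjoint_finCoef A).add (isAdjoint_finCoef B))
  map_smul' r A := Subtype.ext <|
    (isAdjoint_finCoef (r • A)).unique ((isAdjoint_finCoef A).smul r)

theorem isAdjoint_adjointMap (A : DiffOp 𝕜 P k) : IsAdjoint A.1 (adjointMap 𝕜 P k A).1 :=
  isAdjoint_finCoef A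

/-- Functions and one-forms are dual by integration, so the adjoint of an operator from functions to
one-forms is again of this type. Algebraically, the adjoint of `f' · conj f A` is again `f'` times a
conjugate because the outer factors `1 / f'` and `f'` cancel. -/
theorem adjointMap_mem_symmetries : adjointMap 𝕜 P k ∈ Symmetries P k (0 : 𝕜) 1 := by
  refine mem_symmetries fun f A => Subtype.ext ?_
  refine (isAdjoint_adjointMap _).unique (B' := _) ?_
  rw [opAction_zero_one, opAction_zero_one]
  have h := ((isAdjoint_adjointMap A).conj f).mulOp_mul (derivFun f)
  rwa [mul_assoc, ← mulOp_mul, invDeriv_mul_derivFun, mulOp_one, mul_one] at h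

/-- The part of positive order of a differential operator, divided by `d/dx`. -/
def shiftCoef (A : DiffOp 𝕜 P k) : ℕ →₀ SmoothFun 𝕜 P :=
  Finsupp.onFinset (Finset.range k) (fun i => coef A (i + 1)) fun i hi => by
    by_contra h
    exact hi (coef_of_lt A (by simpa [Nat.lt_succ_iff] using h))

theorem symbolOp_shiftCoef (A : DiffOp 𝕜 P k) :
    A.1 = symbolOp 𝕜 P (shiftCoef A) * D + mulOp (coef A 0) := by
  rw [symbolOp_eq_sum (c := shiftCoef A) Finsupp.support_onFinset_subset, eq_sum_coef A, Finset.sum_range_succ',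
    Finset.sum_mul, pow_zero, mul_one]
  congr 1

theorem mul_D_injective {c d : ℕ →₀ SmoothFun 𝕜 P}
    (h : symbolOp 𝕜 P c * D = symbolOp 𝕜 P d * D) : c = d := by
  have hshift : ∀ c : ℕ →₀ SmoothFun 𝕜 P,
      symbolOp 𝕜 P (c.mapDomain Nat.succ) = symbolOp 𝕜 P c * D := by
    intro c
    induction c using Finsupp.induction_linear with
    | zero => simp
    | add c d hc hd => rw [Finsupp.mapDomain_add, map_add, map_add, hc, hd, add_mul]
    | single i a =>
      rw [Finsupp.mapDomain_single, symbolOp_single, symbolOp_single, pow_succ, mul_assoc]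
  rw [← hshift, ← hshift] at h
  exact Finsupp.mapDomain_injective Nat.succ_injective (symbolOp_injective h)

variable (𝕜 P k) in
/-- The function `b = ∑ᵢ (-d/dx)ⁱ aᵢ₊₁` for which the adjoint of `∑ᵢ aᵢ dⁱ/dxⁱ` sends `1` to
`a₀ - b'`. -/
def adjointPotential : DiffOp 𝕜 P k →ₗ[𝕜] SmoothFun 𝕜 P where
  toFun A := adjointOp 𝕜 P (shiftCoef A) 1
  map_add' A B := by
    have h : shiftCoef (A + B) = shiftCoef A + shiftCoef B := Finsupp.ext fun i => by
      change coef (A + B) (i + 1) = coef A (i + 1) + coef B (i + 1)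
      rw [map_add]
      rfl
    rw [h, map_add]
    rfl
  map_smul' r A := by
    have h : shiftCoef (r • A) = r • shiftCoef A := Finsupp.ext fun i => by
      change coef (r • A) (i + 1) = r • coef A (i + 1)
      rw [map_smul]
      rfl
    rw [h, map_smul]
    rfl

/-- Any factorization `A = B D + a` computes the potential, by uniqueness of `B`; the coefficients
need not be known. -/
theorem adjointPotential_eq {A : DiffOp 𝕜 P k} {B B' : Module.End 𝕜 (SmoothFun 𝕜 P)}
    {a : SmoothFun 𝕜 P} (h : A.1 = B * D + mulOp a) (hB : IsAdjoint B B') :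
    adjointPotential 𝕜 P k A = B' 1 := by
  obtain ⟨c, rfl, rfl⟩ := hB
  have h1 := h.symm.trans (symbolOp_shiftCoef A)
  have h2 : a = coef A 0 := by
    have h3 := congrArg (fun E : Module.End 𝕜 (SmoothFun 𝕜 P) => E 1) h1
    change symbolOp 𝕜 P c (D 1) + a * 1 = symbolOp 𝕜 P (shiftCoef A) (D 1) + coef A 0 * 1 at h3
    rwa [D_one, map_zero, map_zero, zero_add, zero_add, mul_one, mul_one] at h3
  rw [h2] at h1
  rw [mul_D_injective (LinearMap.ext fun φ => add_right_cancel (LinearMap.congr_fun h1 φ))]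
  rfl

/-- In the factorization of the transformed operator the left factor is `f' · conj f B · (1/f')`,
whose adjoint is the conjugate of `B'`. Since `1` is invariant, the potential transforms as a
function. -/
theorem adjointPotential_opAction (f : OrientedDiffeo P) (A : DiffOp 𝕜 P k) :
    adjointPotential 𝕜 P k (opAction k 0 1 f A) = comp (adjointPotential 𝕜 P k A) f := by
  have hB : IsAdjoint (symbolOp 𝕜 P (shiftCoef A)) (adjointOp 𝕜 P (shiftCoef A)) := ⟨_, rfl, rfl⟩
  have h := ((hB.conj f).mulOp_mul (derivFun f)).mul (IsAdjoint.mulOp (invDeriv f))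
  have h1 : mulOp (invDeriv f) * (mulOp (derivFun f) * conj f (adjointOp 𝕜 P (shiftCoef A)) *
      mulOp (invDeriv f) * mulOp (derivFun f)) = conj f (adjointOp 𝕜 P (shiftCoef A)) := by
    rw [mul_assoc _ (mulOp (invDeriv f)), ← mulOp_mul, invDeriv_mul_derivFun, mulOp_one, mul_one,
      ← mul_assoc, ← mulOp_mul, invDeriv_mul_derivFun, mulOp_one, one_mul]
  rw [h1] at h
  rw [adjointPotential_eq (a := derivFun f * comp (coef A 0) f) _ h]
  · rfl
  · rw [opAction_zero_one, symbolOp_shiftCoef A, map_add, map_mul, conj_D, conj_mulOp, mul_add,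
      mulOp_mul]
    simp only [mul_assoc]

end FormalAdjoint

/-! ### Five symmetries for the weights `(0, 1)` and the structure of the algebra -/

section Classification

variable {k : ℕ}

section Combinations

variable {M : Type*} [AddCommMonoid M] [Module 𝕜 M] (X Y : M) (a b c d e : 𝕜)

theorem smul_smul_add_smul_add_smul :
    a • (b • X + c • Y) + d • (e • Y) = (b * a) • X + (c * a + e * d) • Y := by module

theorem combination_const :
    a • X + b • (-1 : 𝕜) ^ 0 • X + (c - a - b) • X + d • (0 : M) + e • (0 : M) = c • X := by
  module

theorem combination_vectorField :
    a • X + b • (-1 : 𝕜) ^ 1 • X + c • (0 : M) + (d - a + b) • X + e • (0 : M) = d • X := by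
  module

theorem combination_coord :
    a • X + b • ((-1 : 𝕜) • X + (-1 : 𝕜) • Y) + c • (0 : M) + (d - a + b) • X + (e + b) • Y =
      d • X + e • Y := by
  module

theorem combination_higher (n : ℕ) :
    a • X + b • (-1 : 𝕜) ^ n • X + c • (0 : M) + d • (0 : M) + e • (0 : M) =
      (a + (-1) ^ n * b) • X := by
  module

end Combinations

theorem term_zero {n : ℕ} (hn : n ≤ k) : term hn (0 : SmoothFun 𝕜 P) = 0 :=
  LinearMap.map_zero _

variable (𝕜 P k) in
/-- The projection of a differential operator to its term of order `0`. -/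
def constMap : Module.End 𝕜 (DiffOp 𝕜 P k) :=
  term (Nat.zero_le k) ∘ₗ LinearMap.applyₗ 1 ∘ₗ (DiffOp 𝕜 P k).subtype

theorem constMap_mem_symmetries : constMap 𝕜 P k ∈ Symmetries P k (0 : 𝕜) 1 := by
  refine mem_symmetries fun f A => ?_
  change term (Nat.zero_le k) ((opAction k 0 1 f A).1 1) =
    opAction k 0 1 f (term (Nat.zero_le k) (A.1 1))
  rw [opAction_term_zero, opAction_zero_one]
  rfl

variable (𝕜 P) in
/-- The map `A ↦ b d/dx`, where `b` is the potential of the adjoint of `A`. -/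
def vectorFieldMap (hk : 1 ≤ k) : Module.End 𝕜 (DiffOp 𝕜 P k) :=
  term hk ∘ₗ adjointPotential 𝕜 P k

theorem vectorFieldMap_mem_symmetries (hk : 1 ≤ k) :
    vectorFieldMap 𝕜 P hk ∈ Symmetries P k (0 : 𝕜) 1 := by
  refine mem_symmetries fun f A => ?_
  change term hk (adjointPotential 𝕜 P k (opAction k 0 1 f A)) =
    opAction k 0 1 f (term hk (adjointPotential 𝕜 P k A))
  rw [opAction_term_one, adjointPotential_opAction]

variable (𝕜 P k) in
/-- The map `A ↦ b'`, where `b` is the potential of the adjoint of `A`. -/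
def divergenceMap : Module.End 𝕜 (DiffOp 𝕜 P k) :=
  term (Nat.zero_le k) ∘ₗ D ∘ₗ adjointPotential 𝕜 P k

/-- The potential is a function, and its differential is naturally a one-form. -/
theorem divergenceMap_mem_symmetries :
    divergenceMap 𝕜 P k ∈ Symmetries P k (0 : 𝕜) 1 := by
  refine mem_symmetries fun f A => ?_
  change term (Nat.zero_le k) (D (adjointPotential 𝕜 P k (opAction k 0 1 f A))) =
    opAction k 0 1 f (term (Nat.zero_le k) (D (adjointPotential 𝕜 P k A)))
  rw [opAction_term_zero, adjointPotential_opAction, D_comp]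

theorem D_pow_one {n : ℕ} (hn : n ≠ 0) : (D ^ n) (1 : SmoothFun 𝕜 P) = 0 := by
  obtain ⟨n, rfl⟩ := Nat.exists_eq_succ_of_ne_zero hn
  rw [pow_succ, Module.End.mul_apply, D_one, map_zero]

theorem negD_pow (n : ℕ) : negD 𝕜 P ^ n = (-1 : 𝕜) ^ n • D ^ n := smul_pow _ _ _

theorem constMap_term {n : ℕ} (hn : n ≤ k) (a : SmoothFun 𝕜 P) :
    constMap 𝕜 P k (term hn a) = if n = 0 then term (Nat.zero_le k) a else 0 := by
  change term (Nat.zero_le k) (a * (D ^ n) 1) = _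
  split_ifs with h
  · subst h
    rw [pow_zero, Module.End.one_apply, mul_one]
  · rw [D_pow_one h, mul_zero, map_zero]

theorem adjointPotential_term_zero (a : SmoothFun 𝕜 P) :
    adjointPotential 𝕜 P k (term (Nat.zero_le k) a) = 0 := by
  rw [adjointPotential_eq (a := a) _ IsAdjoint.zero]
  · rfl
  · rw [zero_mul, zero_add]
    exact (mul_one _)

theorem adjointPotential_term_succ {n : ℕ} (hn : n + 1 ≤ k) (a : SmoothFun 𝕜 P) :
    adjointPotential 𝕜 P k (term hn a) = (negD 𝕜 P ^ n) a := by
  rw [adjointPotential_eq (a := 0) _ (IsAdjoint.single a n)]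
  · change (negD 𝕜 P ^ n) (a * 1) = _
    rw [mul_one]
  · change mulOp a * D ^ (n + 1) = _
    rw [pow_succ, mul_assoc]
    exact LinearMap.ext fun φ => ((congrArg _ (zero_mul φ)).trans (add_zero _)).symm

theorem adjointPotential_term_one {n : ℕ} (hn : n ≤ k) :
    adjointPotential 𝕜 P k (term hn 1) = if n = 1 then 1 else 0 := by
  rcases n with _ | n
  · exact adjointPotential_term_zero 1
  · rw [adjointPotential_term_succ, negD_pow]
    by_cases h : n = 0
    · subst h
      simp
    · rw [if_neg (by omega), LinearMap.smul_apply, D_pow_one h, smul_zero]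

theorem adjointMap_term {n : ℕ} (hn : n ≤ k) (a : SmoothFun 𝕜 P) :
    (adjointMap 𝕜 P k (term hn a)).1 = negD 𝕜 P ^ n * mulOp a :=
  (isAdjoint_adjointMap _).unique (IsAdjoint.single a n)

theorem adjointMap_term_one {n : ℕ} (hn : n ≤ k) :
    adjointMap 𝕜 P k (term hn 1) = (-1 : 𝕜) ^ n • term hn 1 := by
  refine Subtype.ext ?_
  rw [adjointMap_term, negD_pow, mulOp_one, mul_one]
  change _ = (-1 : 𝕜) ^ n • (mulOp 1 * D ^ n)
  rw [mulOp_one, one_mul]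

theorem D_coordFun : D (coordFun 𝕜) = 1 := by
  refine Subtype.ext <| funext fun x => ?_
  have h := hasDerivAt_ofReal_sub (𝕜 := 𝕜) 0 x
  simp only [sub_zero] at h
  exact h.deriv

theorem adjointMap_coordFun (hk : 1 ≤ k) :
    adjointMap 𝕜 line k (term hk (coordFun 𝕜)) =
      (-1 : 𝕜) • term hk (coordFun 𝕜) + (-1 : 𝕜) • term (Nat.zero_le k) 1 := by
  refine Subtype.ext ?_
  rw [adjointMap_term, pow_one, negD, smul_mul_assoc, D_mul_mulOp, D_coordFun, smul_add, add_comm]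
  change _ = (-1 : 𝕜) • (mulOp (coordFun 𝕜) * D ^ 1) + (-1 : 𝕜) • (mulOp 1 * D ^ 0)
  rw [pow_one, pow_zero, mul_one]

theorem eigenvalue_eq {n : ℕ} (hn : n ≤ k) {T : Module.End 𝕜 (DiffOp 𝕜 line k)} {c : 𝕜}
    (h : T (term hn 1) = c • term hn 1) : eigenvalue hn T = c := by
  rw [eigenvalue, h, map_smul]
  change c * (coef _ n).1 0 = c
  rw [coef_term, if_pos rfl, one_apply, mul_one]

theorem shear_eq (hk : 1 ≤ k) {T : Module.End 𝕜 (DiffOp 𝕜 line k)} {c d : 𝕜}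
    (h : T (term hk (coordFun 𝕜)) = c • term hk (coordFun 𝕜) + d • term (Nat.zero_le k) 1) :
    shear hk T = d := by
  rw [shear, h, map_add, map_smul, map_smul]
  change c * (coef _ 0).1 0 + d * (coef _ 0).1 0 = d
  rw [coef_term, coef_term, if_neg zero_ne_one, if_pos rfl, one_apply, mul_one]
  change c * 0 + d = d
  rw [mul_zero, zero_add]

theorem vectorFieldMap_term_one (hk : 1 ≤ k) {n : ℕ} (hn : n ≤ k) :
    vectorFieldMap 𝕜 P hk (term hn 1) = if n = 1 then term hk 1 else 0 := by
  change term hk (adjointPotential 𝕜 P k (term hn 1)) = _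
  rw [adjointPotential_term_one]
  split_ifs
  · rfl
  · exact term_zero hk

theorem divergenceMap_term_one {n : ℕ} (hn : n ≤ k) : divergenceMap 𝕜 P k (term hn 1) = 0 := by
  change term (Nat.zero_le k) (D (adjointPotential 𝕜 P k (term hn 1))) = _
  have h : D (adjointPotential 𝕜 P k (term hn 1)) = 0 := by
    rw [adjointPotential_term_one]
    split_ifs
    · exact D_one
    · exact LinearMap.map_zero _
  rw [h]
  exact term_zero _

theorem vectorFieldMap_coordFun (hk : 1 ≤ k) :
    vectorFieldMap 𝕜 line hk (term hk (coordFun 𝕜)) = term hk (coordFun 𝕜) :=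
  congrArg (term hk) (adjointPotential_term_succ (n := 0) hk _)

theorem divergenceMap_coordFun (hk : 1 ≤ k) :
    divergenceMap 𝕜 line k (term hk (coordFun 𝕜)) = term (Nat.zero_le k) 1 :=
  congrArg (term (Nat.zero_le k))
    ((congrArg D (adjointPotential_term_succ (n := 0) hk _)).trans D_coordFun)

theorem exists_combination (hk : 1 ≤ k) (a b c d e : 𝕜) :
    ∃ S ∈ Symmetries P k (0 : 𝕜) 1, ∀ A, S A =
      a • A + b • adjointMap 𝕜 P k A + c • constMap 𝕜 P k A + d • vectorFieldMap 𝕜 P hk A +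
        e • divergenceMap 𝕜 P k A :=
  ⟨a • 1 + b • adjointMap 𝕜 P k + c • constMap 𝕜 P k + d • vectorFieldMap 𝕜 P hk +
    e • divergenceMap 𝕜 P k,
    add_mem (add_mem (add_mem (add_mem (Subalgebra.smul_mem _ (one_mem _) _)
      (Subalgebra.smul_mem _ adjointMap_mem_symmetries _))
      (Subalgebra.smul_mem _ constMap_mem_symmetries _))
      (Subalgebra.smul_mem _ (vectorFieldMap_mem_symmetries hk) _))
      (Subalgebra.smul_mem _ divergenceMap_mem_symmetries _), fun _ => rfl⟩

-- On `dⁿ/dxⁿ` the adjoint acts by `(-1)ⁿ`, the projection and the vector field map act only for `n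
-- = 0` and `n = 1`, and the divergence not at all. On `x d/dx` the adjoint contributes `-1` to the
-- shear and the divergence `1`. The coefficients `p`, `q`, `α - p - q`, `κ - p + q`, `τ + q` solve
-- the resulting system.
set_option maxHeartbeats 1000000 in
theorem exists_symmetry (hk : 1 ≤ k) (α κ τ p q : 𝕜) :
    ∃ T : Symmetries line k (0 : 𝕜) 1, eigenvalue (Nat.zero_le k) T.1 = α ∧
      eigenvalue hk T.1 = κ ∧ shear hk T.1 = τ ∧
        ∀ n (hn : n ≤ k), 2 ≤ n → eigenvalue hn T.1 = p + (-1) ^ n * q := by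
  obtain ⟨S, hS, happ⟩ := exists_combination (P := line) hk p q (α - p - q) (κ - p + q) (τ + q)
  refine ⟨⟨S, hS⟩, eigenvalue_eq _ ?_, eigenvalue_eq _ ?_, shear_eq (c := κ) _ ?_,
    fun n hn h2 => eigenvalue_eq _ ?_⟩
  · rw [happ, adjointMap_term_one, constMap_term, vectorFieldMap_term_one, divergenceMap_term_one,
      if_pos (Eq.refl 0), if_neg Nat.zero_ne_one]
    exact combination_const _ _ _ _ _ _
  · rw [happ, adjointMap_term_one, constMap_term, vectorFieldMap_term_one, divergenceMap_term_one,
      if_neg Nat.one_ne_zero, if_pos (Eq.refl 1)]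
    exact combination_vectorField _ _ _ _ _ _
  · rw [happ, adjointMap_coordFun, constMap_term, vectorFieldMap_coordFun, divergenceMap_coordFun,
      if_neg Nat.one_ne_zero]
    exact combination_coord _ _ _ _ _ _ _
  · rw [happ, adjointMap_term_one, constMap_term, vectorFieldMap_term_one, divergenceMap_term_one,
      if_neg (by omega), if_neg (by omega)]
    exact combination_higher _ _ _ _ _ _ _

section Uniqueness

attribute [local instance] diffOpAddCommGroup

theorem symmetry_ext {S T : Symmetries line k (0 : 𝕜) 1}
    (h : ∀ n ≤ 3, ∀ hn : n ≤ k, eigenvalue hn S.1 = eigenvalue hn T.1)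
    (hs : ∀ hk : 1 ≤ k, shear hk S.1 = shear hk T.1) : S = T := by
  have h0 : S.1 + (-1 : 𝕜) • T.1 = 0 := by
    refine eq_zero_of_forall_eigenvalue (add_mem S.2 (Subalgebra.smul_mem _ T.2 _)) ?_ ?_
    · intro n hn3 hn
      refine eigenvalue_eq hn ?_
      rw [LinearMap.add_apply, LinearMap.smul_apply, map_term_one S.2, map_term_one T.2, h n hn3]
      module
    · intro hk
      refine shear_eq (c := 0) hk ?_
      rw [LinearMap.add_apply, LinearMap.smul_apply, map_term_coordFun S.2, map_term_coordFun T.2,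
        h 1 (by norm_num), hs]
      module
  refine Subtype.ext <| LinearMap.ext fun A => ?_
  have h1 : S.1 A + (-1 : 𝕜) • T.1 A = 0 := LinearMap.congr_fun h0 A
  rwa [neg_one_smul, ← sub_eq_add_neg, sub_eq_zero] at h1

end Uniqueness

theorem eigenvalue_add {n : ℕ} (hn : n ≤ k) (S T : Module.End 𝕜 (DiffOp 𝕜 line k)) :
    eigenvalue hn (S + T) = eigenvalue hn S + eigenvalue hn T := by
  rw [eigenvalue, LinearMap.add_apply, map_add]
  rfl

theorem eigenvalue_smul {n : ℕ} (hn : n ≤ k) (c : 𝕜) (T : Module.End 𝕜 (DiffOp 𝕜 line k)) :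
    eigenvalue hn (c • T) = c * eigenvalue hn T := by
  rw [eigenvalue, LinearMap.smul_apply, map_smul]
  rfl

theorem eigenvalue_one {n : ℕ} (hn : n ≤ k) :
    eigenvalue hn (1 : Module.End 𝕜 (DiffOp 𝕜 line k)) = 1 :=
  eigenvalue_eq hn (one_smul _ _).symm

theorem eigenvalue_mul {n : ℕ} (hn : n ≤ k) {S T : Module.End 𝕜 (DiffOp 𝕜 line k)}
    (hS : S ∈ Symmetries line k (0 : 𝕜) 1) (hT : T ∈ Symmetries line k (0 : 𝕜) 1) :
    eigenvalue hn (S * T) = eigenvalue hn S * eigenvalue hn T :=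
  eigenvalue_eq hn <| by
    rw [Module.End.mul_apply, map_term_one hT, map_smul, map_term_one hS, smul_smul, mul_comm]

theorem shear_add (hk : 1 ≤ k) (S T : Module.End 𝕜 (DiffOp 𝕜 line k)) :
    shear hk (S + T) = shear hk S + shear hk T := by
  rw [shear, LinearMap.add_apply, map_add]
  rfl

theorem shear_smul (hk : 1 ≤ k) (c : 𝕜) (T : Module.End 𝕜 (DiffOp 𝕜 line k)) :
    shear hk (c • T) = c * shear hk T := by
  rw [shear, LinearMap.smul_apply, map_smul]
  rfl

theorem shear_one (hk : 1 ≤ k) : shear hk (1 : Module.End 𝕜 (DiffOp 𝕜 line k)) = 0 := by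
  rw [shear, Module.End.one_apply, coef_term]
  rfl

/-- The span of `x d/dx` and `1` is stable, and symmetries act on it by triangular matrices; this is
the off-diagonal entry of a product. -/
theorem shear_mul (hk : 1 ≤ k) {S T : Module.End 𝕜 (DiffOp 𝕜 line k)}
    (hS : S ∈ Symmetries line k (0 : 𝕜) 1) (hT : T ∈ Symmetries line k (0 : 𝕜) 1) :
    shear hk (S * T) =
      shear hk S * eigenvalue hk T + eigenvalue (Nat.zero_le k) S * shear hk T := by
  have h : S (T (term hk (coordFun 𝕜))) =
      (eigenvalue hk S * eigenvalue hk T) • term hk (coordFun 𝕜) +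
        (shear hk S * eigenvalue hk T + eigenvalue (Nat.zero_le k) S * shear hk T) •
          term (Nat.zero_le k) 1 := by
    rw [map_term_coordFun hT, LinearMap.map_add S, LinearMap.map_smul S, LinearMap.map_smul S,
      map_term_coordFun hS, map_term_one hS]
    exact smul_smul_add_smul_add_smul _ _ _ _ _ _ _
  exact shear_eq hk h

/-- The character of the algebra of symmetries given by the value on `dⁿ/dxⁿ`. -/
def eigenvalueHom {n : ℕ} (hn : n ≤ k) : Symmetries line k (0 : 𝕜) 1 →ₐ[𝕜] 𝕜 :=
  AlgHom.ofLinearMap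
    { toFun T := eigenvalue hn T.1
      map_add' S T := eigenvalue_add hn S.1 T.1
      map_smul' c T := eigenvalue_smul hn c T.1 }
    (eigenvalue_one hn) fun S T => eigenvalue_mul hn S.2 T.2

/-- A lower triangular matrix of size two. -/
def lowerMatrix (a b c : 𝕜) : lowerTriangular 𝕜 2 :=
  ⟨!![a, 0; b, c], by
    intro i j hij
    obtain ⟨rfl, rfl⟩ : i = 0 ∧ j = 1 := by omega
    rfl⟩

theorem lowerMatrix_add (a b c a' b' c' : 𝕜) :
    lowerMatrix (a + a') (b + b') (c + c') = lowerMatrix a b c + lowerMatrix a' b' c' :=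
  Subtype.ext <| by
    change !![_, _; _, _] = !![_, _; _, _] + !![_, _; _, _]
    simp

theorem lowerMatrix_smul (r a b c : 𝕜) :
    lowerMatrix (r * a) (r * b) (r * c) = r • lowerMatrix a b c :=
  Subtype.ext <| by
    change !![_, _; _, _] = r • !![_, _; _, _]
    simp

theorem lowerMatrix_one : lowerMatrix (1 : 𝕜) 0 1 = 1 := Subtype.ext Matrix.one_fin_two.symm

theorem lowerMatrix_mul (a b c a' b' c' : 𝕜) :
    lowerMatrix (a * a') (b * a' + c * b') (c * c') = lowerMatrix a b c * lowerMatrix a' b' c' :=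
  Subtype.ext <| by
    change !![_, _; _, _] = !![_, _; _, _] * !![_, _; _, _]
    rw [Matrix.mul_fin_two]
    simp

theorem lowerMatrix_congr {a b c a' b' c' : 𝕜} (ha : a = a') (hb : b = b') (hc : c = c') :
    lowerMatrix a b c = lowerMatrix a' b' c' := by
  rw [ha, hb, hc]

/-- The action of the symmetries on the span of `d/dx`, `x d/dx` and `1`, as lower triangular
matrices. -/
def matrixHom (hk : 1 ≤ k) : Symmetries line k (0 : 𝕜) 1 →ₐ[𝕜] lowerTriangular 𝕜 2 :=
  AlgHom.ofLinearMap
    { toFun T := lowerMatrix (eigenvalue hk T.1) (shear hk T.1) (eigenvalue (Nat.zero_le k) T.1)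
      map_add' S T := (lowerMatrix_congr (eigenvalue_add hk S.1 T.1) (shear_add hk S.1 T.1)
        (eigenvalue_add _ S.1 T.1)).trans (lowerMatrix_add _ _ _ _ _ _)
      map_smul' c T := (lowerMatrix_congr (eigenvalue_smul hk c T.1) (shear_smul hk c T.1)
        (eigenvalue_smul _ c T.1)).trans (lowerMatrix_smul _ _ _ _) }
    ((lowerMatrix_congr (eigenvalue_one hk) (shear_one hk) (eigenvalue_one _)).trans
      lowerMatrix_one)
    fun S T => (lowerMatrix_congr (eigenvalue_mul hk S.2 T.2) (shear_mul hk S.2 T.2)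
      (eigenvalue_mul _ S.2 T.2)).trans (lowerMatrix_mul _ _ _ _ _ _)

theorem matrixHom_eq_iff (hk : 1 ≤ k) (T : Symmetries line k (0 : 𝕜) 1) (M : lowerTriangular 𝕜 2) :
    matrixHom hk T = M ↔ eigenvalue hk T.1 = M.1 0 0 ∧ shear hk T.1 = M.1 1 0 ∧
      eigenvalue (Nat.zero_le k) T.1 = M.1 1 1 := by
  constructor
  · rintro rfl
    exact ⟨rfl, rfl, rfl⟩
  · rintro ⟨h1, h2, h3⟩
    refine Subtype.ext <| Matrix.ext fun i j => ?_
    fin_cases i <;> fin_cases j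
    · exact h1
    · exact (M.2 0 1 Fin.zero_lt_one).symm
    · exact h2
    · exact h3

theorem nonempty_algEquiv_symmetries_one :
    Nonempty (Symmetries line 1 (0 : 𝕜) 1 ≃ₐ[𝕜] lowerTriangular 𝕜 2) := by
  refine ⟨AlgEquiv.ofBijective (matrixHom le_rfl) ⟨fun S T h => ?_, fun M => ?_⟩⟩
  · obtain ⟨h1, h2, h3⟩ := (matrixHom_eq_iff _ _ _).1 h
    refine symmetry_ext (fun n _ hn => ?_) fun _ => h2
    interval_cases n
    exacts [h3, h1]
  · obtain ⟨T, h0, h1, hs, -⟩ := exists_symmetry le_rfl (M.1 1 1) (M.1 0 0) (M.1 1 0) 0 0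
    exact ⟨T, (matrixHom_eq_iff _ _ _).2 ⟨h1, hs, h0⟩⟩

theorem nonempty_algEquiv_symmetries_two :
    Nonempty (Symmetries line 2 (0 : 𝕜) 1 ≃ₐ[𝕜] lowerTriangular 𝕜 2 × 𝕜) := by
  refine ⟨AlgEquiv.ofBijective ((matrixHom one_le_two).prod (eigenvalueHom le_rfl))
    ⟨fun S T h => ?_, fun ⟨M, c⟩ => ?_⟩⟩
  · obtain ⟨h1, h2, h3⟩ := (matrixHom_eq_iff _ _ _).1 (congrArg Prod.fst h)
    refine symmetry_ext (fun n _ hn => ?_) fun _ => h2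
    interval_cases n
    exacts [h3, h1, congrArg Prod.snd h]
  · obtain ⟨T, h0, h1, hs, h2⟩ := exists_symmetry one_le_two (M.1 1 1) (M.1 0 0) (M.1 1 0) c 0
    refine ⟨T, Prod.ext ((matrixHom_eq_iff _ _ _).2 ⟨h1, hs, h0⟩) ?_⟩
    refine (h2 2 le_rfl le_rfl).trans ?_
    rw [mul_zero, add_zero]

theorem nonempty_algEquiv_symmetries_of_three_le (hk : 3 ≤ k) :
    Nonempty (Symmetries line k (0 : 𝕜) 1 ≃ₐ[𝕜] lowerTriangular 𝕜 2 × (Fin 2 → 𝕜)) := by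
  have hk1 : 1 ≤ k := by omega
  refine ⟨AlgEquiv.ofBijective ((matrixHom hk1).prod
    (AlgHom.pi fun i : Fin 2 => eigenvalueHom (n := i + 2) (by omega)))
    ⟨fun S T h => ?_, fun ⟨M, c⟩ => ?_⟩⟩
  · obtain ⟨h1, h2, h3⟩ := (matrixHom_eq_iff _ _ _).1 (congrArg Prod.fst h)
    have h4 := congrArg Prod.snd h
    refine symmetry_ext (fun n _ hn => ?_) fun _ => h2
    interval_cases n
    exacts [h3, h1, congrFun h4 0, congrFun h4 1]
  -- The last two parameters solve `p + q = c 0` in order two and `p - q = c 1` in order three.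
  · obtain ⟨T, h0, h1, hs, h2⟩ := exists_symmetry hk1 (M.1 1 1) (M.1 0 0) (M.1 1 0)
      ((c 0 + c 1) / 2) ((c 0 - c 1) / 2)
    refine ⟨T, Prod.ext ((matrixHom_eq_iff _ _ _).2 ⟨h1, hs, h0⟩) (funext fun i => ?_)⟩
    refine (h2 (i + 2) _ (by omega)).trans ?_
    fin_cases i
    · change (c 0 + c 1) / 2 + (-1) ^ 2 * ((c 0 - c 1) / 2) = c 0
      ring
    · change (c 0 + c 1) / 2 + (-1) ^ 3 * ((c 0 - c 1) / 2) = c 1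
      ring

end Classification

end DensityOperators

end

/-! ### The theorem -/

open DensityOperators in
theorem theorem3p7 {𝕜 : Type*} [RCLike 𝕜] :
    (∀ (k : ℕ) (lam mu : 𝕜), (lam, mu) ≠ (0, 1) →
      ∃ e : Symmetries circle k lam mu ≃ₐ[𝕜] Symmetries line k lam mu,
        ∀ (T : Symmetries circle k lam mu) (A : DiffOp 𝕜 circle k) (B : DiffOp 𝕜 line k),
          IsLift A B → IsLift (T.1 A) ((e T).1 B)) ∧
    (∀ (k : ℕ) (T : Symmetries line k (0 : 𝕜) 1), IsLocal T.1) ∧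
    (∀ k : ℕ, 3 ≤ k →
      Nonempty (Symmetries line k (0 : 𝕜) 1 ≃ₐ[𝕜] lowerTriangular 𝕜 2 × (Fin 2 → 𝕜))) ∧
    Nonempty (Symmetries line 2 (0 : 𝕜) 1 ≃ₐ[𝕜] lowerTriangular 𝕜 2 × 𝕜) ∧
    Nonempty (Symmetries line 1 (0 : 𝕜) 1 ≃ₐ[𝕜] lowerTriangular 𝕜 2) := by
  refine ⟨exists_algEquiv_symmetries, fun k T => isLocal_of_mem_symmetries_line T.2,
    fun k hk => nonempty_algEquiv_symmetries_of_three_le hk, nonempty_algEquiv_symmetries_two,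
    nonempty_algEquiv_symmetries_one⟩
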